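/- Let $k$ be an algebraically closed field, $\Lambda$ a finite-dimensional $k$-algebra, $(\mathcal P,\le)$ a finite non-empty preordered set, and $\{\Delta_i\}_{i\in\mathcal P}$ an admissible homological system for $\Lambda$: the $\Delta_i$ are pairwise non-isomorphic indecomposable finite-dimensional left $\Lambda$-modules; $\mathrm{Hom}_\Lambda(\Delta_i,\Delta_j)\neq0$ implies $i\le j$; $\mathrm{Ext}^1_\Lambda(\Delta_i,\Delta_j)\ne0$ implies $i\le j$ and $j\not\le i$; the module $\Lambda$ has a finite filtration by submodules with each quotient isomorphic to some $\Delta_i$; and the number of isomorphism classes of indecomposable projective $\Lambda$-modules is $|\mathcal P|$. Put $\Delta=\bigoplus_i\Delta_i$, let $e_i\in\mathrm{End}_\Lambda(\Delta)$ be the projection on $\Delta_i$, $S=\bigoplus_i ke_i$, and let $J$ be the Jacobson radical of $\mathrm{End}_\Lambda(\Delta)=S\oplus J$. Let $A=\bigoplus_{n\ge0}\mathrm{Ext}^n_\Lambda(\Delta,\Delta)$ be the Yoneda algebra (so $e_jA_ne_i=\mathrm{Ext}^n_\Lambda(\Delta_i,\Delta_j)$) and suppose that it is given a strict $A_\infty$-structure: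 morphisms of $S$-$S$-bimodules $m_n:A^{\otimes_S n}\to A$ ($n\ge1$) of degree $2-n$ with $\sum_{r+s+t=n}(-1)^{r+st}m_{r+1+t}(\mathrm{id}^{\otimes r}\otimes m_s\otimes\mathrm{id}^{\otimes t})=0$ (Koszul signs), $m_1=0$, $m_2$ the Yoneda product, and $m_n(a_1\otimes\cdots\otimes a_n)=0$ if $n\geq3$ and some $a_u$ is one of the $e_i$. Let $B=A[1]$ be its bar construction: $B_n=A_{n+1}$, with operations $b_n$ given by $b_n\sigma^{\otimes n}=\sigma m_n$, where $\sigma:A\to B$ is the shift. So $e_i\in B_{-1}=S\oplus J$. **The category $H^{-1}(\mathrm{tw}(B))$.** For right $S$-modules $X,Y$ put $\mathrm{ad}(B)(X,Y)_n=\bigoplus_{i,j}\mathrm{Hom}_k(Xe_i,Ye_j)\otimes_k e_jB_ne_i$ and $$b_n^{ad}\big((f_n\otimes x_n)\otimes\cdots\otimes(f_1\otimes x_1)\big)=f_n\cdots f_1\otimes b_n(x_n\otimes\cdots\otimes x_1).$$ An object of $\mathrm{tw}(B)$ is a pair $\underline X=(X,\delta_X)$ with $X$ a right $S$-module and $\delta_X=\sum_x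 f_x\otimes x\in\mathrm{ad}(B)(X,X)_0$ (sum over a basis) such that there is a finite filtration $0=X_0\subseteq\cdots\subseteq X_\ell=X$ by submodules with $f_x(X_r)\subseteq X_{r-1}$ for all $x$ and all $r\geq1$, and $\sum_{s\ge1}b_s^{ad}(\delta_X^{\otimes s})=0$. Let $$b_1^{tw}(t)=\sum_{i_0,i_1\ge0}b^{ad}_{i_0+i_1+1}(\delta_Y^{\otimes i_1}\otimes t\otimes\delta_X^{\otimes i_0}),\qquad b_2^{tw}(t_2\otimes t_1)=\sum_{i_0,i_1,i_2\ge0}b^{ad}_{i_0+i_1+i_2+2}(\delta_{X_2}^{\otimes i_2}\otimes t_2\otimes\delta_{X_1}^{\otimes i_1}\otimes t_1\otimes\delta_{X_0}^{\otimes i_0}).$$ The objects of $H^{-1}(\mathrm{tw}(B))$ are those of $\mathrm{tw}(B)$; the morphisms $\underline X\to\underline Y$ are the $t\in\mathrm{ad}(B)(X,Y)_{-1}$ with $b_1^{tw}(t)=0$, modulo $b_1^{tw}(\mathrm{ad}(B)(X,Y)_{-2})$; the composition is induced by $b_2^{tw}$; the identity of $\underline X$ is the class of $\sum_j\mathrm{id}_{Xe_j}\otimes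 e_j$. **The category $(\mathcal A(\Delta),I)\text{-}\mathrm{Mod}$.** For an $S$-$S$-bimodule $W$ let $\hat D(W)$ be the $S$-$S$-bimodule with $e_j\hat D(W)e_i=\mathrm{Hom}_k(e_jWe_i,k)$. Put $A(\Delta)=T_S(\hat D(B_0))$ and $T(\Delta)=T_S(\hat D(B_0)\oplus\hat D(J))$, the tensor algebras over $S$, graded with $\hat D(B_0)$ in degree $0$ and $\hat D(J)$ in degree $1$. Let $V\cong A(\Delta)\otimes_S\hat D(J)\otimes_SA(\Delta)$ be the component of degree $1$ of $T(\Delta)$. Choose bases $\mathbb B_0$ of $B_0$ and $\mathbb J$ of $J$ consisting of elements of the subspaces $e_jB_0e_i$, respectively $e_jJe_i$, with dual bases $\{x^*\}$. Let $\delta$ be the derivation of degree $1$ of $T(\Delta)$ ($\delta(ab)=\delta(a)b+(-1)^{|a|}a\delta(b)$) with $\delta(S)=0$ and $$\delta(\alpha)=\sum_{n\ge2}\ \sum_{x_1,\dots,x_n\in\mathbb B_0\cup\mathbb J}\alpha\big(b_n(x_n\otimes\cdots\otimes x_1)\big)\,x_n^*\otimes\cdots\otimes x_1^*\qquad(\alpha\in\hat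 D(B_0)\cup\hat D(J)),$$ where $\alpha$ is extended by zero to the other homogeneous components of $B$ and, if $\alpha\in\hat D(J)$, to the $e_i$. Let $I$ be the ideal of $A(\Delta)$ generated by the elements $\sum_{n\ge2}\sum_{x_1,\dots,x_n\in\mathbb B_0}\zeta(b_n(x_n\otimes\cdots\otimes x_1))\,x_n^*\otimes\cdots\otimes x_1^*$ with $\zeta\in\hat D(B_1)$. Objects of $(\mathcal A(\Delta),I)\text{-}\mathrm{Mod}$ are the left $A(\Delta)$-modules $M$ with $IM=0$; a morphism $M\to N$ is a pair $(f^0,f^1)$ with $f^0\in\mathrm{Hom}_k(M,N)$ and $f^1:V\to\mathrm{Hom}_k(M,N)$ a morphism of $A(\Delta)$-bimodules, such that $af^0[m]=f^0[am]+f^1(\delta(a))[m]$ for all $a\in A(\Delta)$ and $m\in M$; the composition is $(g^0,g^1)(f^0,f^1)=(g^0f^0,\;v\mapsto g^0f^1(v)+g^1(v)f^0+(g^1*f^1)(\delta(v)))$, where $(g^1*f^1)(u\otimes v)=g^1(u)f^1(v)$; identities are the pairs $(\mathrm{id},0)$. **Theorem.** $H^{-1}(\mathrm{tw}(B))$ and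 $(\mathcal A(\Delta),I)\text{-}\mathrm{Mod}$ are categories. One has $\mathrm{ad}(B)(X,Y)_n=0$ for $n<-1$; hence the subspaces of boundaries $b_1^{tw}(\mathrm{ad}(B)(X,Y)_{-2})$ vanish, and $H^{-1}(\mathrm{tw}(B))$ coincides with the category $Z_{-1}(\mathrm{tw}(B))$ of cycles. Put $\Psi(\sum_x f_x\otimes x)(\zeta)=\sum_x\zeta(x)f_x$, and let $e_i^*$ be the functional on $B_{-1}=S\oplus J$ with $e_i^*(e_i)=1$, $e_i^*(e_j)=0$ for $j\neq i$ and $e_i^*(J)=0$. Then the following assignment is a well-defined functor $M:H^{-1}(\mathrm{tw}(B))\to(\mathcal A(\Delta),I)\text{-}\mathrm{Mod}$ and an equivalence of categories: $M(X,\delta_X)=(X^{op},\Psi(\delta_X))$, that is, $X$ as a left $S$-module with $\alpha\in\hat D(B_0)$ acting as $\Psi(\delta_X)(\alpha)$; and $M(t)=(M(t)^0,M(t)^1)$ with $M(t)^0=\Psi(t)(\sum_{j}e_j^*)$ and with $M(t)^1$ the bimodule map whose restriction to $\hat D(J)$ is $\xi\mapsto\Psi(t)(\xi)$. -/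

import Mathlib

open CategoryTheory CategoryTheory.Abelian
open scoped ModuleCat TensorProduct

universe u w

set_option linter.unusedSectionVars false
section TensorAlg

/-- Generators of `T_S(W)`: the `e_i` and the elements of `W i j = e_j W e_i`. -/
inductive TGen {P : Type u} (W : P → P → Type u) : Type u
  | e (i : P) : TGen W
  | w (i j : P) (x : W i j) : TGen W

variable (k : Type u) [Field k] {P : Type u} [Fintype P] (W : P → P → Type u)
  [∀ i j, AddCommGroup (W i j)] [∀ i j, Module k (W i j)]

/-- The relations of `T_S(W)`. -/
inductive TRel : FreeAlgebra k (TGen W) → FreeAlgebra k (TGen W) → Prop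
  | idem (i : P) : TRel (FreeAlgebra.ι k (.e i) * FreeAlgebra.ι k (.e i)) (FreeAlgebra.ι k (.e i))
  | ortho (i j : P) (h : i ≠ j) : TRel (FreeAlgebra.ι k (.e i) * FreeAlgebra.ι k (.e j)) 0
  | complete : TRel (∑ i, FreeAlgebra.ι k (.e i)) 1
  | corner (i j : P) (x : W i j) :
      TRel (FreeAlgebra.ι k (.e j) * FreeAlgebra.ι k (.w i j x) * FreeAlgebra.ι k (.e i))
        (FreeAlgebra.ι k (.w i j x))
  | add (i j : P) (x y : W i j) :
      TRel (FreeAlgebra.ι k (.w i j (x + y)))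
        (FreeAlgebra.ι k (.w i j x) + FreeAlgebra.ι k (.w i j y))
  | smul (i j : P) (c : k) (x : W i j) :
      TRel (FreeAlgebra.ι k (.w i j (c • x))) (c • FreeAlgebra.ι k (.w i j x))

/-- The tensor algebra `T_S(W)` over `S = k^P` of the `S`-`S`-bimodule `W = ⨁ W i j`, where
`W i j = e_j W e_i`. -/
def TensorAlg : Type u := RingQuot (TRel k W)

namespace TensorAlg

noncomputable instance : Ring (TensorAlg k W) := inferInstanceAs (Ring (RingQuot (TRel k W)))

noncomputable instance : Algebra k (TensorAlg k W) :=
  inferInstanceAs (Algebra k (RingQuot (TRel k W)))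

/-- The quotient map. -/
noncomputable def mk : FreeAlgebra k (TGen W) →ₐ[k] TensorAlg k W :=
  RingQuot.mkAlgHom k (TRel k W)

variable {W}

theorem mk_eq {x y : FreeAlgebra k (TGen W)} (h : TRel k W x y) : mk k W x = mk k W y :=
  RingQuot.mkAlgHom_rel k h

variable (W)

/-- The idempotent `e_i ∈ S`. -/
noncomputable def e (i : P) : TensorAlg k W := mk k W (FreeAlgebra.ι k (.e i))

/-- The inclusion of `e_j W e_i`. -/
noncomputable def gen (i j : P) : W i j →ₗ[k] TensorAlg k W where
  toFun x := mk k W (FreeAlgebra.ι k (.w i j x))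
  map_add' x y := by rw [mk_eq k (.add i j x y), map_add]
  map_smul' c x := by rw [mk_eq k (.smul i j c x), map_smul, RingHom.id_apply]

theorem e_complete : CompleteOrthogonalIdempotents (e k W) where
  idem i := by
    have := mk_eq k (TRel.idem (k := k) (W := W) i)
    rwa [map_mul] at this
  ortho i j h := by
    have := mk_eq k (TRel.ortho (k := k) (W := W) i j h)
    rwa [map_mul, map_zero] at this
  complete := by
    have := mk_eq k (TRel.complete (k := k) (W := W))
    rwa [map_sum, map_one] at this

variable {k W}

/-- The algebra map with `e_i ↦ ε i` and `x ↦ ε j * φ i j x * ε i` for `x ∈ W i j`. -/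
noncomputable def lift {R : Type w} [Ring R] [Algebra k R] {ε : P → R}
    (hε : CompleteOrthogonalIdempotents ε) (φ : ∀ i j, W i j →ₗ[k] R) :
    TensorAlg k W →ₐ[k] R :=
  RingQuot.liftAlgHom k ⟨FreeAlgebra.lift k fun g => match g with
    | .e i => ε i
    | .w i j x => ε j * φ i j x * ε i, by
      intro x y h
      induction h with
      | idem i => simpa using (hε.idem i).eq
      | ortho i j h => simpa using hε.ortho h
      | complete => simpa using hε.complete
      | corner i j x =>
        have hi : ε i * ε i = ε i := hε.idem i
        have hj : ε j * ε j = ε j := hε.idem j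
        simp only [map_mul, FreeAlgebra.lift_ι_apply]
        rw [mul_assoc (ε j) (_ * _) (ε i), mul_assoc _ (ε i) (ε i), hi, ← mul_assoc, ← mul_assoc, hj]
      | add i j x y => simp [mul_add, add_mul]
      | smul i j c x => simp⟩

theorem lift_e {R : Type w} [Ring R] [Algebra k R] {ε : P → R}
    (hε : CompleteOrthogonalIdempotents ε) (φ : ∀ i j, W i j →ₗ[k] R) (i : P) :
    lift hε φ (e k W i) = ε i := by
  refine (RingQuot.liftAlgHom_mkAlgHom_apply ..).trans ?_
  simp

theorem lift_gen {R : Type w} [Ring R] [Algebra k R] {ε : P → R}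
    (hε : CompleteOrthogonalIdempotents ε) (φ : ∀ i j, W i j →ₗ[k] R) (i j : P) (x : W i j) :
    lift hε φ (gen k W i j x) = ε j * φ i j x * ε i := by
  refine (RingQuot.liftAlgHom_mkAlgHom_apply ..).trans ?_
  simp

variable (k W) in
theorem induction {C : TensorAlg k W → Prop} (he : ∀ i, C (e k W i))
    (hg : ∀ i j x, C (gen k W i j x)) (hs : ∀ c, C (algebraMap k _ c))
    (ha : ∀ x y, C x → C y → C (x + y)) (hm : ∀ x y, C x → C y → C (x * y)) (x : TensorAlg k W) :
    C x := by
  obtain ⟨y, rfl⟩ := RingQuot.mkAlgHom_surjective k (TRel k W) x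
  change C (mk k W y)
  induction y using FreeAlgebra.induction with
  | grade0 c => rw [AlgHom.commutes]; exact hs c
  | grade1 g =>
    cases g with
    | e i => exact he i
    | w i j x => exact hg i j x
  | mul a b iha ihb => rw [map_mul]; exact hm _ _ iha ihb
  | add a b iha ihb => rw [map_add]; exact ha _ _ iha ihb

end TensorAlg

end TensorAlg

/-- A module is indecomposable if it is nonzero and has no nontrivial direct decomposition. -/
def IsIndecomposable (Λ : Type u) [Ring Λ] (M : Type u) [AddCommGroup M] [Module Λ M] : Prop :=
  Nontrivial M ∧ ∀ N N' : Submodule Λ M, IsCompl N N' → N = ⊥ ∨ N' = ⊥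


/-- A module over `S = k^P`; as `S` is commutative, right and left `S`-modules are the same, and
`X^op` is `X` itself. -/
structure SMod (k : Type u) [Field k] (P : Type u) where
  carrier : Type w
  [addCommGroup : AddCommGroup carrier]
  [module : Module k carrier]
  [moduleS : Module (P → k) carrier]
  [isScalarTower : IsScalarTower k (P → k) carrier]

namespace SMod

attribute [instance] addCommGroup module moduleS isScalarTower

/-- The projection `X ⟶ X e_i`, as an endomorphism of `X`. -/
noncomputable def proj {k : Type u} [Field k] {P : Type u} [DecidableEq P] (X : SMod.{u, w} k P)
    (i : P) : Module.End k X.carrier :=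
  Algebra.lsmul k k X.carrier (Pi.single i 1 : P → k)

theorem proj_complete {k : Type u} [Field k] {P : Type u} [DecidableEq P] [Fintype P]
    (X : SMod.{u, w} k P) : CompleteOrthogonalIdempotents X.proj :=
  (CompleteOrthogonalIdempotents.single (fun _ : P => k)).map
    (Algebra.lsmul k k X.carrier : (P → k) →ₐ[k] _).toRingHom

end SMod

/-- A finite homological system for the `k`-algebra `Λ`, indexed by the preordered set `P`. -/
structure HomologicalSystem (k : Type u) [Field k] (Λ : Type u) [Ring Λ] [Algebra k Λ]
    (P : Type u) [Preorder P] where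
  Δ : P → ModuleCat.{u} Λ
  finite : ∀ i, Module.Finite Λ (Δ i)
  indecomposable : ∀ i, IsIndecomposable Λ (Δ i)
  eq_of_iso : ∀ i j, Nonempty (Δ i ≅ Δ j) → i = j
  hom_le : ∀ i j, (∃ f : Δ i ⟶ Δ j, f ≠ 0) → i ≤ j
  ext_lt : ∀ i j, (∃ x : Ext (Δ i) (Δ j) 1, x ≠ 0) → i ≤ j ∧ ¬ j ≤ i

namespace HomologicalSystem

section
variable {k : Type u} [Field k] {Λ : Type u} [Ring Λ] [Algebra k Λ]
  {P : Type u} [Preorder P] [DecidableEq P] [Fintype P] (H : HomologicalSystem k Λ P)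

/-- `M` belongs to `F(Δ)`. -/
def IsFiltered (M : ModuleCat.{u} Λ) : Prop :=
  ∃ (t : ℕ) (F : ℕ → Submodule Λ M), Monotone F ∧ F 0 = ⊥ ∧ F t = ⊤ ∧
    ∀ r < t, ∃ i, Nonempty ((F (r + 1) ⧸ (F r).submoduleOf (F (r + 1))) ≃ₗ[Λ] H.Δ i)

/-- `Λ ∈ F(Δ)`, and the isomorphism classes of indecomposable projective `Λ`-modules are in bijection
with `P`. -/
def IsAdmissible : Prop :=
  H.IsFiltered (ModuleCat.of Λ Λ) ∧
  ∃ Q : P → ModuleCat.{u} Λ,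
    (∀ i, Module.Finite Λ (Q i) ∧ Module.Projective Λ (Q i) ∧ IsIndecomposable Λ (Q i)) ∧
    (∀ i j, Nonempty (Q i ≅ Q j) → i = j) ∧
    ∀ N : ModuleCat.{u} Λ, Module.Finite Λ N → Module.Projective Λ N →
      IsIndecomposable Λ N → ∃ i, Nonempty (N ≅ Q i)

/-- `Δ = ⨁ Δ i`. -/
abbrev sumΔ : ModuleCat.{u} Λ := ModuleCat.of Λ (∀ i, H.Δ i)

/-- `End_Λ(Δ)`, with `f * g` the composite `f ∘ g`. -/
abbrev EndΔ : Type u := CategoryTheory.End H.sumΔ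

/-- The idempotent `e_i` of `End_Λ(Δ)`: the projection onto `Δ i`. -/
def idem (i : P) : H.EndΔ :=
  ModuleCat.ofHom (LinearMap.single Λ (fun j => H.Δ j) i ∘ₗ LinearMap.proj i)

/-- The Jacobson radical `J` of `End_Λ(Δ)`. -/
def radical : Submodule k H.EndΔ := (Ring.jacobson H.EndΔ).restrictScalars k


theorem nilpotent_or_bijective {M : Type u} [AddCommGroup M] [Module Λ M] [IsNoetherian Λ M]
    [IsArtinian Λ M] (hM : IsIndecomposable Λ M) (h : Module.End Λ M) :
    IsNilpotent h ∨ Function.Bijective h := by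
  obtain ⟨n, hn, hc⟩ :=
    ((Filter.eventually_ge_atTop 1).and h.eventually_isCompl_ker_pow_range_pow).exists
  have hn' : n = (n - 1) + 1 := by omega
  rcases hM.2 _ _ hc with h0 | h0
  · right
    have hr : LinearMap.range (h ^ n) = ⊤ := by
      have := hc.sup_eq_top
      rwa [h0, bot_sup_eq] at this
    constructor
    · rw [← LinearMap.ker_eq_bot, eq_bot_iff, ← h0]
      intro x hx
      rw [LinearMap.mem_ker] at hx ⊢
      rw [hn', pow_succ, Module.End.mul_apply, hx, map_zero]
    · intro y
      obtain ⟨x, hx⟩ := (LinearMap.range_eq_top.1 hr) y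
      rw [hn', pow_succ', Module.End.mul_apply] at hx
      exact ⟨_, hx⟩
  · left
    exact ⟨n, LinearMap.range_eq_bot.1 h0⟩

/-- The endomorphism of `Δ` given by a map `Δ i ⟶ Δ j`. -/
def corner (i j : P) (g : H.Δ i →ₗ[Λ] H.Δ j) : H.EndΔ :=
  ModuleCat.ofHom (LinearMap.single Λ (fun j => H.Δ j) j ∘ₗ g ∘ₗ LinearMap.proj i)

theorem bijective_of_retract [Module.Finite k Λ] (i j : P) (g : H.Δ i →ₗ[Λ] H.Δ j)
    (y : H.Δ j →ₗ[Λ] H.Δ i) (hb : Function.Bijective (y ∘ₗ g)) : Function.Bijective g := by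
  have hg : Function.Injective g := by
    intro a b hab
    exact hb.1 (by simp [hab])
  refine ⟨hg, ?_⟩
  have hc : IsCompl (LinearMap.range g) (LinearMap.ker y) := by
    constructor
    · rw [Submodule.disjoint_def]
      rintro _ ⟨a, rfl⟩ ha
      have : a = 0 := hb.1 (by simpa using ha)
      simp [this]
    · rw [codisjoint_iff, eq_top_iff]
      intro m _
      obtain ⟨a, ha⟩ := hb.2 (y m)
      refine Submodule.mem_sup.2 ⟨g a, ⟨a, rfl⟩, m - g a, ?_, by abel⟩
      rw [LinearMap.mem_ker, map_sub, sub_eq_zero]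
      exact ha.symm
  rcases (H.indecomposable j).2 _ _ hc with h0 | h0
  · exfalso
    have := (H.indecomposable i).1
    obtain ⟨a, ha⟩ := exists_ne (0 : H.Δ i)
    rw [LinearMap.range_eq_bot] at h0
    exact ha (hg (by simp [h0]))
  · have := hc.sup_eq_top
    rw [h0, sup_bot_eq] at this
    exact LinearMap.range_eq_top.1 this

theorem corner_mem_radical [Module.Finite k Λ] (i j : P) (g : H.Δ i →ₗ[Λ] H.Δ j)
    (hg : ¬ Function.Bijective g) : H.corner i j g ∈ H.radical := by
  have := H.finite i
  have : IsNoetherianRing Λ := IsNoetherianRing.of_finite k Λ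
  have : IsArtinianRing Λ := IsArtinianRing.of_finite k Λ
  change H.corner i j g ∈ Ring.jacobson H.EndΔ
  rw [← Ideal.jacobson_bot, Ideal.mem_jacobson_iff]
  intro y
  suffices hn : IsNilpotent (y * H.corner i j g) by
    obtain ⟨u, hu⟩ := hn.isUnit_add_one
    refine ⟨(↑u⁻¹ : H.EndΔ), ?_⟩
    have : (↑u⁻¹ : H.EndΔ) * y * H.corner i j g + ↑u⁻¹ = ↑u⁻¹ * (u : H.EndΔ) := by
      rw [hu, mul_add, mul_one, mul_assoc]
    rw [this, Units.inv_mul, sub_self]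
    exact Ideal.zero_mem _
  let y' : H.Δ j →ₗ[Λ] H.Δ i :=
    LinearMap.proj i ∘ₗ y.hom ∘ₗ LinearMap.single Λ (fun j => H.Δ j) j
  let h : Module.End Λ (H.Δ i) := y' ∘ₗ g
  rcases nilpotent_or_bijective (H.indecomposable i) h with ⟨n, hn⟩ | hb
  · have key : ∀ (n : ℕ) (v : ∀ i, H.Δ i),
        (((y * H.corner i j g) ^ n : H.EndΔ).hom v) i = (h ^ n) (v i) := by
      intro n
      induction n with
      | zero => intro v; rfl
      | succ n ih =>
        intro v
        rw [pow_succ, pow_succ, Module.End.mul_apply]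
        exact ih _
    refine ⟨n + 1, ?_⟩
    refine ModuleCat.hom_ext (LinearMap.ext fun v => ?_)
    rw [pow_succ']
    change y.hom (LinearMap.single Λ (fun j => H.Δ j) j
      (g ((((y * H.corner i j g) ^ n : H.EndΔ).hom v) i))) = 0
    rw [key, hn]
    simp
  · exact absurd (H.bijective_of_retract i j g y' hb) hg

theorem sum_idem : ∑ i, H.idem i = 1 := by
  refine ModuleCat.hom_ext (LinearMap.ext fun v => ?_)
  rw [show (∑ i, H.idem i : H.EndΔ).hom v = ∑ i, (H.idem i).hom v from
    map_sum (AddMonoidHom.mk' (fun f : H.EndΔ => f.hom v) fun _ _ => rfl) _ _]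
  exact Finset.univ_sum_single v

theorem idem_mul_mul_idem (f : H.EndΔ) (i j : P) : H.idem j * f * H.idem i = H.corner i j
    (LinearMap.proj j ∘ₗ f.hom ∘ₗ LinearMap.single Λ (fun j => H.Δ j) i) := rfl

/-- `End_Λ(Δ) = S + J`. -/
theorem exists_sub_mem_radical [IsAlgClosed k] [Module.Finite k Λ] (f : H.EndΔ) :
    ∃ c : P → k, f - ∑ i, c i • H.idem i ∈ H.radical := by
  have hc : ∀ i, ∃ c : k, ∃ g : H.Δ i →ₗ[Λ] H.Δ i, ¬ Function.Bijective g ∧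
      H.corner i i g = H.corner i i
        (LinearMap.proj i ∘ₗ f.hom ∘ₗ LinearMap.single Λ (fun j => H.Δ j) i) - c • H.idem i := by
    intro i
    have := H.finite i
    have : Module.Finite k (H.Δ i) := Module.Finite.trans Λ _
    have := (H.indecomposable i).1
    let fi : H.Δ i →ₗ[Λ] H.Δ i :=
      LinearMap.proj i ∘ₗ f.hom ∘ₗ LinearMap.single Λ (fun j => H.Δ j) i
    obtain ⟨c, hc⟩ := Module.End.exists_eigenvalue (K := k) (V := H.Δ i) (fi.restrictScalars k)
    obtain ⟨v, hv⟩ := hc.exists_hasEigenvector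
    refine ⟨c, fi - (c • 𝟙 (H.Δ i) : H.Δ i ⟶ H.Δ i).hom, ?_, ?_⟩
    · intro hb
      apply hv.2
      apply hb.1
      have : fi v = c • v := hv.apply_eq_smul
      simp [this]
    · refine ModuleCat.hom_ext (LinearMap.ext fun v => ?_)
      change (Pi.single i (fi (v i) - c • v i) : ∀ i, H.Δ i) =
        Pi.single i (fi (v i)) - c • (Pi.single i (v i) : ∀ i, H.Δ i)
      rw [Pi.single_sub, Pi.single_smul]
  choose c g hg hcg using hc
  refine ⟨c, ?_⟩
  have hf : f - ∑ i, c i • H.idem i =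
      ∑ j, ∑ i, (H.idem j * f * H.idem i - if i = j then c i • H.idem i else 0) := by
    simp only [Finset.sum_sub_distrib, ← Finset.mul_sum, ← Finset.sum_mul, sum_idem, mul_one,
      one_mul]
    simp
  rw [hf]
  refine Submodule.sum_mem _ fun j _ => Submodule.sum_mem _ fun i _ => ?_
  rw [idem_mul_mul_idem]
  split_ifs with hij
  · subst hij
    rw [← hcg]
    exact H.corner_mem_radical _ _ _ (hg i)
  · rw [sub_zero]
    refine H.corner_mem_radical _ _ _ fun hb => hij ?_
    exact H.eq_of_iso _ _ ⟨(LinearEquiv.ofBijective _ hb).toModuleIso⟩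

theorem idem_mul_idem (i j : P) : H.idem j * H.idem i = if i = j then H.idem i else 0 := by
  refine ModuleCat.hom_ext (LinearMap.ext fun v => ?_)
  change (Pi.single j ((Pi.single i (v i) : ∀ i, H.Δ i) j) : ∀ i, H.Δ i) = _
  split_ifs with hij
  · subst hij
    rw [Pi.single_eq_same]
    rfl
  · rw [Pi.single_eq_of_ne (Ne.symm hij), Pi.single_zero]
    rfl

theorem idem_notMem_radical (i : P) : H.idem i ∉ H.radical := by
  intro h
  have h' : H.idem i ∈ Ring.jacobson H.EndΔ := h
  rw [← Ideal.jacobson_bot, Ideal.mem_jacobson_iff] at h'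
  obtain ⟨z, hz⟩ := h' (-1)
  have hz' : z * -1 * H.idem i + z - 1 = 0 := hz
  have h2 := congrArg (fun x => x * H.idem i) hz'
  simp only [sub_mul, add_mul, mul_assoc, idem_mul_idem, if_true, zero_mul, one_mul,
    neg_mul, mul_neg] at h2
  have h0 : H.idem i = 0 := by simpa using h2
  have := (H.indecomposable i).1
  obtain ⟨a, ha⟩ := exists_ne (0 : H.Δ i)
  apply ha
  have h3 : (H.idem i).hom (Pi.single i a) i = 0 := by rw [h0]; rfl
  change (Pi.single i ((Pi.single i a : ∀ i, H.Δ i) i) : ∀ i, H.Δ i) i = 0 at h3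
  simpa using h3

/-- The classes of the `e_i` form a basis of `End_Λ(Δ) ⧸ J`. -/
noncomputable def topBasis [IsAlgClosed k] [Module.Finite k Λ] :
    Module.Basis P k (H.EndΔ ⧸ H.radical) :=
  Module.Basis.mk (v := fun i => H.radical.mkQ (H.idem i))
    (by
      rw [Fintype.linearIndependent_iff]
      intro c hc i
      have h1 : ∑ i, c i • H.idem i ∈ H.radical := by
        rw [← Submodule.ker_mkQ H.radical, LinearMap.mem_ker, map_sum, ← hc]
        simp
      by_contra hi
      apply H.idem_notMem_radical i
      have h2 : H.idem i * ∑ j, c j • H.idem j ∈ H.radical :=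
        Ideal.mul_mem_left (Ring.jacobson H.EndΔ) _ h1
      have h3 : H.idem i * ∑ j, c j • H.idem j = c i • H.idem i := by
        simp only [Finset.mul_sum, mul_smul_comm, idem_mul_idem]
        simp
      rw [h3] at h2
      simpa [smul_smul, hi] using H.radical.smul_mem (c i)⁻¹ h2)
    (by
      rintro x -
      obtain ⟨f, rfl⟩ := H.radical.mkQ_surjective x
      obtain ⟨c, hc⟩ := H.exists_sub_mem_radical f
      rw [← Submodule.ker_mkQ H.radical, LinearMap.mem_ker, map_sub, sub_eq_zero] at hc
      rw [hc, map_sum]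
      refine Submodule.sum_mem _ fun i _ => ?_
      rw [map_smul]
      exact Submodule.smul_mem _ _ (Submodule.subset_span ⟨i, rfl⟩))

/-- `e_i^*` on `End(Δ) = S ⊕ J`: it is one on `e_i`, zero on the other `e_j` and zero on `J`. -/
noncomputable def starEnd [IsAlgClosed k] [Module.Finite k Λ] (i : P) : H.EndΔ →ₗ[k] k :=
  H.topBasis.coord i ∘ₗ H.radical.mkQ

theorem sub_starEnd_mem [IsAlgClosed k] [Module.Finite k Λ] (f : H.EndΔ) :
    f - ∑ i, H.starEnd i f • H.idem i ∈ H.radical := by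
  rw [← Submodule.ker_mkQ H.radical, LinearMap.mem_ker, map_sub, sub_eq_zero, map_sum]
  conv_lhs => rw [← H.topBasis.sum_repr (H.radical.mkQ f)]
  refine Finset.sum_congr rfl fun i _ => ?_
  rw [map_smul]
  congr 1
  simp [topBasis]


/-- The underlying space of the Yoneda algebra `A = ⨁_{n ≥ 0} Ext^n(Δ, Δ)`. -/
abbrev Yoneda : Type u := DirectSum ℕ (fun n => Ext H.sumΔ H.sumΔ n)

/-- The Yoneda product of `A`: `a b` is first `b`, then `a`. -/
noncomputable def yonedaMul : H.Yoneda →ₗ[k] H.Yoneda →ₗ[k] H.Yoneda :=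
  LinearMap.flip <| DirectSum.toModule k ℕ _ fun q =>
    LinearMap.flip <| DirectSum.toModule k ℕ _ fun p =>
      ((Ext.bilinearCompOfLinear k H.sumΔ H.sumΔ H.sumΔ q p (q + p) rfl).compr₂
        (DirectSum.lof k ℕ (fun n => Ext H.sumΔ H.sumΔ n) (q + p))).flip

/-- The inclusion of `End_Λ(Δ) = Ext^0(Δ, Δ)` into `A`. -/
noncomputable def ofEnd : H.EndΔ →ₗ[k] H.Yoneda :=
  DirectSum.lof k ℕ (fun n => Ext H.sumΔ H.sumΔ n) 0 ∘ₗ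
    (Ext.linearEquiv₀ (R := k) (X := H.sumΔ) (Y := H.sumΔ)).symm.toLinearMap

/-- The component of degree zero of an element of `A`. -/
noncomputable def toEnd : H.Yoneda →ₗ[k] H.EndΔ :=
   (Ext.linearEquiv₀ (R := k) (X := H.sumΔ) (Y := H.sumΔ)).toLinearMap ∘ₗ
    DirectSum.component k ℕ (fun n => Ext H.sumΔ H.sumΔ n) 0


/-- The projection of `A` onto its component of degree `n` (zero when `n < 0`). -/
noncomputable def degProj (n : ℤ) : H.Yoneda →ₗ[k] H.Yoneda :=
  if 0 ≤ n then DirectSum.lof k ℕ (fun n => Ext H.sumΔ H.sumΔ n) n.toNat ∘ₗ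
    DirectSum.component k ℕ (fun n => Ext H.sumΔ H.sumΔ n) n.toNat else 0

/-- The grading involution `a ↦ (-1)^|a| a` of `A`. -/
noncomputable def signInv : H.Yoneda →ₗ[k] H.Yoneda :=
  DirectSum.toModule k ℕ _ fun n =>
    ((-1 : k) ^ n) • DirectSum.lof k ℕ (fun n => Ext H.sumΔ H.sumΔ n) n

/-- The idempotent `e i` of degree zero in the Yoneda algebra. -/
noncomputable def e (i : P) : H.Yoneda := H.ofEnd (H.idem i)

/-- A strict `A_∞`-structure on the Yoneda algebra: operations `m n`, `n ≥ 1`, of degree `2 - n` which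
are morphisms of `S`-`S`-bimodules `A ⊗_S ⋯ ⊗_S A ⟶ A`, satisfy
`∑_{r + s + t = n} (-1)^(r + s t) m_{r + 1 + t} (id^r ⊗ m_s ⊗ id^t) = 0`, and are such that `m 1 = 0`,
`m 2` is the Yoneda product and, for `n ≥ 3`, `m n` vanishes when one of its arguments is some `e i`.
When `id^r ⊗ m_s ⊗ id^t` is applied to elements, the first `r` of them contribute the Koszul sign
`(-1)^(s |a|)`, which is `signInv ^ s`. There is no `m 0` (it is set to zero). -/
structure StrictAInfinity where
  m : ∀ n : ℕ, MultilinearMap k (fun _ : Fin n => H.Yoneda) H.Yoneda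
  m_zero : m 0 = 0
  balanced : ∀ (n q : ℕ) (hq : q + 1 < n) (i : P) (a : Fin n → H.Yoneda),
    m n (Function.update a ⟨q, by omega⟩ (H.yonedaMul (a ⟨q, by omega⟩) (H.e i))) =
      m n (Function.update a ⟨q + 1, hq⟩ (H.yonedaMul (H.e i) (a ⟨q + 1, hq⟩)))
  left_linear : ∀ (n : ℕ) (i : P) (a : Fin (n + 1) → H.Yoneda),
    m (n + 1) (Function.update a 0 (H.yonedaMul (H.e i) (a 0))) =
      H.yonedaMul (H.e i) (m (n + 1) a)
  right_linear : ∀ (n : ℕ) (i : P) (a : Fin (n + 1) → H.Yoneda),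
    m (n + 1) (Function.update a (Fin.last n) (H.yonedaMul (a (Fin.last n)) (H.e i))) =
      H.yonedaMul (m (n + 1) a) (H.e i)
  homogeneous : ∀ (n : ℕ) (d : Fin n → ℤ) (a : Fin n → H.Yoneda),
    (∀ s, H.degProj (d s) (a s) = a s) →
      H.degProj ((∑ s, d s) + 2 - n) (m n a) = m n a
  stasheff : ∀ (n : ℕ) (a : ℕ → H.Yoneda),
    ∑ r ∈ Finset.range (n + 1), ∑ s ∈ Finset.range (n + 1 - r),
      (-1 : k) ^ (r + s * (n - r - s)) •
        m (r + 1 + (n - r - s)) (fun q =>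
          if (q : ℕ) < r then (H.signInv ^ s) (a q)
          else if (q : ℕ) = r then m s (fun p => a (r + p))
          else a (q + s - 1)) = 0
  m_one : m 1 = 0
  m_two : ∀ a : Fin 2 → H.Yoneda, m 2 a = H.yonedaMul (a 0) (a 1)
  strict_unit : ∀ (n : ℕ), 3 ≤ n → ∀ (a : Fin n → H.Yoneda) (s : Fin n) (i : P),
    a s = H.e i → m n a = 0

/-- The projection `A ⟶ e_j B_n e_i`, where `B = A[1]`, that is `B_n = A_{n + 1}`. -/
noncomputable def barProj (n : ℤ) (i j : P) : H.Yoneda →ₗ[k] H.Yoneda :=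
  (H.yonedaMul.flip (H.e i)) ∘ₗ (H.yonedaMul (H.e j)) ∘ₗ H.degProj (n + 1)

/-- `e_j B_n e_i`, as a subspace of `A`. -/
noncomputable abbrev barComp (n : ℤ) (i j : P) : Submodule k H.Yoneda :=
  LinearMap.range (H.barProj n i j)

/-- The operation `b_n` of the bar construction: with `σ : A ⟶ B` the shift, `b_n σ^{⊗ n} = σ m_n`,
that is `b_n (σ a_1, …, σ a_n) = (-1)^(∑ (n - i) |a_i|) σ (m_n (a_1, …, a_n))`. -/
noncomputable def StrictAInfinity.b {H : HomologicalSystem k Λ P} (m : StrictAInfinity H) (n : ℕ) :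
    MultilinearMap k (fun _ : Fin n => H.Yoneda) H.Yoneda :=
  (m.m n).compLinearMap fun s => H.signInv ^ (n - 1 - (s : ℕ))

/-- All `b_n` at once: the word `x_n ⋯ x_1` goes to `b_n (x_n, …, x_1)`. -/
noncomputable def StrictAInfinity.bTotal {H : HomologicalSystem k Λ P} (m : StrictAInfinity H) :
    TensorAlgebra k H.Yoneda →ₗ[k] H.Yoneda :=
  DirectSum.toModule k ℕ _ (fun n => PiTensorProduct.lift (m.b n)) ∘ₗ
    TensorAlgebra.equivDirectSum.toLinearMap

/-- `f ↦ e_j f e_i`. -/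
noncomputable def conj (i j : P) : H.EndΔ →ₗ[k] H.EndΔ :=
  LinearMap.mulRight k (H.idem i) ∘ₗ LinearMap.mulLeft k (H.idem j)

/-- `e_j J e_i`, as a subspace of `A`. -/
noncomputable abbrev radComp (i j : P) : Submodule k H.Yoneda :=
  H.radical.map (H.ofEnd ∘ₗ H.conj i j)

section
variable [IsAlgClosed k] [Module.Finite k Λ]

/-- `e_i^*` as a functional on `A`, zero outside `Ext^0(Δ, Δ) = S ⊕ J`. -/
noncomputable def star (i : P) : H.Yoneda →ₗ[k] k := H.starEnd i ∘ₗ H.toEnd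

/-- The projection of `A` onto `e_j J e_i`, by way of `Ext^0(Δ, Δ) = S ⊕ J`. -/
noncomputable def radProj (i j : P) : H.Yoneda →ₗ[k] H.radComp i j :=
  LinearMap.codRestrict (H.radComp i j)
    (H.ofEnd ∘ₗ H.conj i j ∘ₗ
      (LinearMap.id - ∑ l, (H.starEnd l).smulRight (H.idem l)) ∘ₗ H.toEnd)
    (fun a => ⟨H.toEnd a - ∑ l, H.starEnd l (H.toEnd a) • H.idem l,
      H.sub_starEnd_mem _, by simp [LinearMap.sum_apply]⟩)

end

section Bocs
variable [IsAlgClosed k] [Module.Finite k Λ]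

/-- `e_j D̂(B_n) e_i`, the dual of `e_j B_n e_i`. -/
abbrev dualBar (n : ℤ) (i j : P) : Type u := Module.Dual k (H.barComp n i j)

/-- `e_j D̂(J) e_i`, the dual of `e_j J e_i`. -/
abbrev dualRad (i j : P) : Type u := Module.Dual k (H.radComp i j)

/-- `A(Δ) = T_S(D̂(B_0))`. -/
noncomputable abbrev AΔ : Type u := TensorAlg k (H.dualBar 0)

/-- `T(Δ) = T_S(D̂(B_0) ⊕ D̂(J))`, with `D̂(B_0)` in degree zero and `D̂(J)` in degree one. -/
noncomputable abbrev TΔ : Type u := TensorAlg k (fun i j => H.dualBar 0 i j × H.dualRad i j)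

/-- The inclusion of `A(Δ)` into `T(Δ)`. -/
noncomputable def incl : H.AΔ →ₐ[k] H.TΔ :=
  TensorAlg.lift (TensorAlg.e_complete k _) fun i j =>
    TensorAlg.gen k (fun i j => H.dualBar 0 i j × H.dualRad i j) i j ∘ₗ LinearMap.inl k _ _

/-- The inclusion of `D̂(J)` into `T(Δ)`. -/
noncomputable def inclRad (i j : P) : H.dualRad i j →ₗ[k] H.TΔ :=
  TensorAlg.gen k (fun i j => H.dualBar 0 i j × H.dualRad i j) i j ∘ₗ LinearMap.inr k _ _

/-- The elements of a directed basis of `B_0`. -/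
abbrev Letter₀ : Type u :=
  Σ p : P × P, Module.Basis.ofVectorSpaceIndex k (H.barComp 0 p.1 p.2)

/-- The elements of a directed basis of `J`. -/
abbrev LetterJ : Type u :=
  Σ p : P × P, Module.Basis.ofVectorSpaceIndex k (H.radComp p.1 p.2)

/-- The basis element. -/
noncomputable def val₀ (x : H.Letter₀) : H.Yoneda :=
  (Module.Basis.ofVectorSpace k (H.barComp 0 x.1.1 x.1.2) x.2 : H.barComp 0 x.1.1 x.1.2)

/-- The basis element. -/
noncomputable def valJ (x : H.LetterJ) : H.Yoneda :=
  (Module.Basis.ofVectorSpace k (H.radComp x.1.1 x.1.2) x.2 : H.radComp x.1.1 x.1.2)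

/-- The element `x^*` of the dual basis, in `A(Δ)`. -/
noncomputable def dual₀ (x : H.Letter₀) : H.AΔ :=
  TensorAlg.gen k (H.dualBar 0) x.1.1 x.1.2
    ((Module.Basis.ofVectorSpace k (H.barComp 0 x.1.1 x.1.2)).coord x.2)

/-- The element `x^*` of the dual basis, in `T(Δ)`. -/
noncomputable def dualJ (x : H.LetterJ) : H.TΔ :=
  H.inclRad x.1.1 x.1.2 ((Module.Basis.ofVectorSpace k (H.radComp x.1.1 x.1.2)).coord x.2)

/-- `α ↦ ∑ α(π (b_n (x_n ⊗ ⋯ ⊗ x_1))) x_n^* ⋯ x_1^*`, the sum over `n ≥ 2` and all words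
`x_n, …, x_1` in the letters `x : L`. -/
noncomputable def dualB {H : HomologicalSystem k Λ P} (m : StrictAInfinity H)
    {L : Type u} {U : Type u} [AddCommGroup U] [Module k U] {R : Type u} [Ring R] [Algebra k R]
    (val : L → H.Yoneda) (dual : L → R) (π : H.Yoneda →ₗ[k] U) : Module.Dual k U →ₗ[k] R :=
  ∑ᶠ (n : ℕ) (x : Fin (n + 2) → L),
    LinearMap.toSpanSingleton k R (List.ofFn fun s => dual (x s)).prod ∘ₗ
      Module.Dual.eval k U (π (m.b (n + 2) fun s => val (x s)))

variable {H} (m : StrictAInfinity H)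

/-- `δ` on `e_j D̂(B_0) e_i`: the sum runs over words in the basis of `B_0 ⊕ J`. -/
noncomputable def deltaBar (i j : P) : H.dualBar 0 i j →ₗ[k] H.TΔ :=
  dualB m (Sum.elim H.val₀ H.valJ) (Sum.elim (fun x => H.incl (H.dual₀ x)) H.dualJ)
    (H.barProj 0 i j).rangeRestrict

/-- `δ` on `e_j D̂(J) e_i`; here `ξ ∈ D̂(J)` is extended by zero on the `e_i`. -/
noncomputable def deltaRad (i j : P) : H.dualRad i j →ₗ[k] H.TΔ :=
  dualB m (Sum.elim H.val₀ H.valJ) (Sum.elim (fun x => H.incl (H.dual₀ x)) H.dualJ)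
    (H.radProj i j)

/-- The algebra map `T(Δ) ⟶ Mat_2(T(Δ))`, `x ↦ [[(-1)^|x| x, δ x], [0, x]]`. It is multiplicative
exactly because `δ (x y) = δ x y + (-1)^|x| x δ y`. -/
noncomputable def deltaMat : H.TΔ →ₐ[k] Matrix (Fin 2) (Fin 2) H.TΔ :=
  TensorAlg.lift
    ((TensorAlg.e_complete k (fun i j => H.dualBar 0 i j × H.dualRad i j)).map
      (Matrix.scalar (Fin 2))) fun i j =>
    Matrix.singleLinearMap k 0 0 ∘ₗ
      TensorAlg.gen k (fun i j => H.dualBar 0 i j × H.dualRad i j) i j ∘ₗ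
        LinearMap.prodMap LinearMap.id (-LinearMap.id) +
    Matrix.singleLinearMap k 0 1 ∘ₗ (deltaBar m i j).coprod (deltaRad m i j) +
    Matrix.singleLinearMap k 1 1 ∘ₗ
      TensorAlg.gen k (fun i j => H.dualBar 0 i j × H.dualRad i j) i j

/-- The differential of `T(Δ)`: the derivation of degree one which vanishes on `S` and is given by
`deltaBar` and `deltaRad` on the generators. -/
noncomputable def delta : H.TΔ →ₗ[k] H.TΔ :=
  Matrix.entryLinearMap k H.TΔ 0 1 ∘ₗ (deltaMat m).toLinearMap

/-- `β` on `e_j D̂(B_1) e_i`. -/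
noncomputable def beta (i j : P) : H.dualBar 1 i j →ₗ[k] H.AΔ :=
  dualB m H.val₀ H.dual₀ (H.barProj 1 i j).rangeRestrict

/-- The ideal `I` of `A(Δ)`, generated by the image of `β`. -/
noncomputable def idealI : TwoSidedIdeal H.AΔ :=
  TwoSidedIdeal.span {a | ∃ (i j : P) (ζ : H.dualBar 1 i j), a = beta m i j ζ}

variable (H) in
/-- The `A(Δ)`-bimodule `V = A(Δ) ⊗_S D̂(J) ⊗_S A(Δ)`, as the component of degree one of `T(Δ)`. -/
noncomputable def V : Submodule k H.TΔ :=
  Submodule.span k {v | ∃ (i j : P) (ξ : H.dualRad i j) (a a' : H.AΔ),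
    v = H.incl a * H.inclRad i j ξ * H.incl a'}

theorem incl_mul_mem (a : H.AΔ) {v : H.TΔ} (hv : v ∈ H.V) : H.incl a * v ∈ H.V := by
  induction hv using Submodule.span_induction with
  | mem v h =>
    obtain ⟨i, j, ξ, c, c', rfl⟩ := h
    exact Submodule.subset_span ⟨i, j, ξ, a * c, c', by rw [map_mul]; simp only [mul_assoc]⟩
  | zero => simp
  | add x y _ _ hx hy => rw [mul_add]; exact add_mem hx hy
  | smul c x _ hx => rw [mul_smul_comm]; exact Submodule.smul_mem _ _ hx

theorem mul_incl_mem (a : H.AΔ) {v : H.TΔ} (hv : v ∈ H.V) : v * H.incl a ∈ H.V := by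
  induction hv using Submodule.span_induction with
  | mem v h =>
    obtain ⟨i, j, ξ, c, c', rfl⟩ := h
    exact Submodule.subset_span ⟨i, j, ξ, c, c' * a, by rw [map_mul]; simp only [mul_assoc]⟩
  | zero => simp
  | add x y _ _ hx hy => rw [add_mul]; exact add_mem hx hy
  | smul c x _ hx => rw [smul_mul_assoc]; exact Submodule.smul_mem _ _ hx


theorem degProj_lof (r : ℤ) (n : ℕ) (x : Ext H.sumΔ H.sumΔ n) :
    H.degProj r (DirectSum.lof k ℕ (fun n => Ext H.sumΔ H.sumΔ n) n x) =
      if (n : ℤ) = r then DirectSum.lof k ℕ (fun n => Ext H.sumΔ H.sumΔ n) n x else 0 := by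
  unfold degProj
  split_ifs with h1 h2 h2
  · obtain rfl : n = r.toNat := by omega
    simp
  · have : n ≠ r.toNat := by omega
    simp [DirectSum.component.of, this]
  · omega
  · rfl

theorem degProj_comm (r : ℤ) (i j : P) (a : H.Yoneda) :
    H.degProj r (H.yonedaMul (H.yonedaMul (H.e j) a) (H.e i)) =
      H.yonedaMul (H.yonedaMul (H.e j) (H.degProj r a)) (H.e i) := by
  have : H.degProj r ∘ₗ H.yonedaMul.flip (H.e i) ∘ₗ H.yonedaMul (H.e j) =
      H.yonedaMul.flip (H.e i) ∘ₗ H.yonedaMul (H.e j) ∘ₗ H.degProj r := by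
    refine DirectSum.linearMap_ext k fun n => LinearMap.ext fun x => ?_
    simp only [LinearMap.comp_apply, degProj_lof]
    simp only [yonedaMul, e, ofEnd, LinearMap.comp_apply, LinearMap.flip_apply,
      DirectSum.toModule_lof, LinearMap.compr₂_apply, degProj_lof]
    by_cases h : (n : ℤ) = r
    · have h' : ((0 + (n + 0) : ℕ) : ℤ) = r := by omega
      simp only [h, h', if_true, DirectSum.toModule_lof, LinearMap.compr₂_apply, LinearMap.flip_apply]
    · have h' : ¬ ((0 + (n + 0) : ℕ) : ℤ) = r := by omega
      simp only [h, h', if_false, map_zero]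
      simp
  exact LinearMap.congr_fun this a

theorem degProj_degProj (r r' : ℤ) (a : H.Yoneda) :
    H.degProj r (H.degProj r' a) = if r' = r then H.degProj r a else 0 := by
  have : H.degProj r ∘ₗ H.degProj r' = if r' = r then H.degProj r else 0 := by
    refine DirectSum.linearMap_ext k fun n => LinearMap.ext fun x => ?_
    simp only [LinearMap.comp_apply, degProj_lof]
    by_cases h : (n : ℤ) = r'
    · subst h
      simp only [if_true, degProj_lof]
      split_ifs with h'
      · simp [degProj_lof, h']
      · rfl
    · simp only [h, if_false, map_zero]
      split_ifs with h'
      · have : ¬ (n : ℤ) = r := by omega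
        simp [degProj_lof, this]
      · rfl
  rw [← LinearMap.comp_apply, this]
  split_ifs <;> rfl

theorem incl_e (i : P) : H.incl (TensorAlg.e k _ i) = TensorAlg.e k _ i :=
  TensorAlg.lift_e _ _ _

theorem e_mul_gen {W : P → P → Type u} [∀ i j, AddCommGroup (W i j)] [∀ i j, Module k (W i j)]
    (i j : P) (x : W i j) :
    TensorAlg.e k W j * TensorAlg.gen k W i j x * TensorAlg.e k W i = TensorAlg.gen k W i j x := by
  have := TensorAlg.mk_eq k (TRel.corner (k := k) i j x)
  rw [map_mul, map_mul] at this
  exact this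

theorem incl_gen (i j : P) (α : H.dualBar 0 i j) : H.incl (TensorAlg.gen k _ i j α) =
    TensorAlg.gen k (fun i j => H.dualBar 0 i j × H.dualRad i j) i j (α, 0) := by
  refine (TensorAlg.lift_gen _ _ _ _ _).trans ?_
  exact e_mul_gen _ _ _

theorem degProj_signInv (r : ℤ) (n : ℕ) (a : H.Yoneda) (h : H.degProj r a = a) :
    H.degProj r ((H.signInv ^ n) a) = (H.signInv ^ n) a := by
  have hc : H.degProj r ∘ₗ H.signInv = H.signInv ∘ₗ H.degProj r := by
    refine DirectSum.linearMap_ext k fun n => LinearMap.ext fun x => ?_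
    simp only [LinearMap.comp_apply, degProj_lof]
    split_ifs with h <;> simp [signInv, degProj_lof, h]
  induction n with
  | zero => simpa using h
  | succ n ih =>
    rw [pow_succ', Module.End.mul_apply, ← LinearMap.comp_apply, hc, LinearMap.comp_apply, ih]

/-- The degree in `A` of a letter. -/
def letterDeg : H.Letter₀ ⊕ H.LetterJ → ℤ := Sum.elim (fun _ => 1) (fun _ => 0)

theorem degProj_letter (x : H.Letter₀ ⊕ H.LetterJ) :
    H.degProj (letterDeg x) (Sum.elim H.val₀ H.valJ x) = Sum.elim H.val₀ H.valJ x := by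
  rcases x with x | x
  · obtain ⟨y, hy⟩ := (Module.Basis.ofVectorSpace k (H.barComp 0 x.1.1 x.1.2) x.2).2
    change H.degProj 1 (H.val₀ x) = H.val₀ x
    have : H.val₀ x = H.yonedaMul (H.yonedaMul (H.e x.1.2) (H.degProj 1 y)) (H.e x.1.1) := hy.symm
    rw [this, degProj_comm, degProj_degProj, if_pos rfl]
  · obtain ⟨y, -, hy⟩ := (Module.Basis.ofVectorSpace k (H.radComp x.1.1 x.1.2) x.2).2
    change H.degProj 0 (H.valJ x) = H.valJ x
    have : H.valJ x = H.ofEnd (H.conj x.1.1 x.1.2 y) := hy.symm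
    rw [this, ofEnd, LinearMap.comp_apply, degProj_lof, if_pos Nat.cast_zero]

theorem degProj_b (n : ℕ) (x : Fin n → H.Letter₀ ⊕ H.LetterJ) :
    H.degProj ((∑ s, letterDeg (x s)) + 2 - n) (m.b n fun s => Sum.elim H.val₀ H.valJ (x s)) =
      m.b n fun s => Sum.elim H.val₀ H.valJ (x s) :=
  m.homogeneous n _ _ fun _ => degProj_signInv _ _ _ (degProj_letter _)

theorem prod_letters (l : List (H.Letter₀ ⊕ H.LetterJ)) :
    (l.map letterDeg).sum ≤ l.length ∧
    ((l.map letterDeg).sum = l.length → ∃ a : H.AΔ,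
      (l.map (Sum.elim (fun x => H.incl (H.dual₀ x)) H.dualJ)).prod = H.incl a) ∧
    ((l.map letterDeg).sum + 1 = l.length →
      (l.map (Sum.elim (fun x => H.incl (H.dual₀ x)) H.dualJ)).prod ∈ H.V) := by
  induction l with
  | nil => exact ⟨by simp, fun _ => ⟨1, by simp⟩, fun h => absurd h (by simp)⟩
  | cons x l ih =>
    obtain ⟨h0, h1, h2⟩ := ih
    simp only [List.map_cons, List.sum_cons, List.length_cons, List.prod_cons]
    rcases x with x | x
    · simp only [letterDeg, Sum.elim_inl] at h0 h1 h2 ⊢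
      refine ⟨by push_cast; omega, fun h => ?_, fun h => ?_⟩
      · obtain ⟨a, ha⟩ := h1 (by push_cast at h; omega)
        exact ⟨H.dual₀ x * a, by rw [ha, map_mul]⟩
      · exact incl_mul_mem _ (h2 (by push_cast at h; omega))
    · simp only [letterDeg, Sum.elim_inr] at h0 h1 h2 ⊢
      refine ⟨by push_cast; omega, fun h => absurd h (by push_cast; omega), fun h => ?_⟩
      obtain ⟨a, ha⟩ := h1 (by push_cast at h; omega)
      rw [ha]
      refine mul_incl_mem _ (Submodule.subset_span ⟨x.1.1, x.1.2,
        (Module.Basis.ofVectorSpace k (H.radComp x.1.1 x.1.2)).coord x.2, 1, 1, ?_⟩)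
      rw [map_one, one_mul, mul_one]
      rfl

theorem deltaBar_mem (i j : P) (α : H.dualBar 0 i j) : deltaBar m i j α ∈ H.V := by
  unfold deltaBar dualB
  revert α
  refine finsum_induction (fun f : H.dualBar 0 i j →ₗ[k] H.TΔ => ∀ α, f α ∈ H.V) ?_ ?_ ?_
  · simp
  · intro f g hf hg α
    exact add_mem (hf α) (hg α)
  intro n
  refine finsum_induction (fun f : H.dualBar 0 i j →ₗ[k] H.TΔ => ∀ α, f α ∈ H.V) ?_ ?_ ?_
  · simp
  · intro f g hf hg α
    exact add_mem (hf α) (hg α)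
  intro x α
  rw [LinearMap.comp_apply, LinearMap.toSpanSingleton_apply]
  by_cases hd : (∑ s, letterDeg (x s)) = n + 1
  · refine Submodule.smul_mem _ _ ?_
    have := (prod_letters (List.ofFn x)).2.2
    rw [List.map_ofFn, List.map_ofFn, List.sum_ofFn, List.length_ofFn] at this
    refine this ?_
    simp only [Function.comp_apply, hd]
    push_cast
    ring
  · have h0 : (H.barProj 0 i j).rangeRestrict
        (m.b (n + 2) fun s => Sum.elim H.val₀ H.valJ (x s)) = 0 := by
      apply Subtype.ext
      rw [← degProj_b m]
      change H.yonedaMul.flip (H.e i) (H.yonedaMul (H.e j) (H.degProj 1 (H.degProj _ _))) = 0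
      rw [degProj_degProj, if_neg, map_zero, map_zero]
      intro h
      apply hd
      push_cast at h
      omega
    rw [h0, map_zero, LinearMap.zero_apply, zero_smul]
    exact zero_mem _

theorem deltaMat_incl (a : H.AΔ) : deltaMat m (H.incl a) 0 0 = H.incl a ∧
    deltaMat m (H.incl a) 1 0 = 0 ∧ deltaMat m (H.incl a) 1 1 = H.incl a ∧
    deltaMat m (H.incl a) 0 1 ∈ H.V := by
  induction a using TensorAlg.induction with
  | he i =>
    rw [incl_e, deltaMat, TensorAlg.lift_e]
    simp
  | hg i j α =>
    rw [incl_gen, deltaMat, TensorAlg.lift_gen]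
    have hc := e_mul_gen (k := k) (W := fun i j => H.dualBar 0 i j × H.dualRad i j) i j (α, 0)
    simp [hc]
    rw [← incl_e, ← incl_e]
    exact mul_incl_mem _ (incl_mul_mem _ (deltaBar_mem m i j α))
  | hs c =>
    rw [AlgHom.commutes, AlgHom.commutes]
    simp [Matrix.algebraMap_matrix_apply]
  | ha x y hx hy =>
    simp only [map_add, Matrix.add_apply, hx.1, hx.2.1, hx.2.2.1, hy.1, hy.2.1, hy.2.2.1, add_zero,
      true_and]
    exact add_mem hx.2.2.2 hy.2.2.2
  | hm x y hx hy =>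
    simp only [map_mul, Matrix.mul_apply, Fin.sum_univ_two, hx.1, hx.2.1, hx.2.2.1, hy.1, hy.2.1,
      hy.2.2.1, mul_zero, zero_mul, add_zero, zero_add, true_and]
    exact add_mem (incl_mul_mem _ hy.2.2.2) (mul_incl_mem _ hx.2.2.2)

theorem delta_incl_mem (a : H.AΔ) : delta m (H.incl a) ∈ H.V := (deltaMat_incl m a).2.2.2

section blocks
variable {M N L : Type w} [AddCommGroup M] [Module k M] [AddCommGroup N] [Module k N]
  [AddCommGroup L] [Module k L] (ρM : H.AΔ →ₐ[k] Module.End k M)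
  (ρN : H.AΔ →ₐ[k] Module.End k N) (ρL : H.AΔ →ₐ[k] Module.End k L)

/-- The diagonal action of `A(Δ)` on `M × N`. -/
noncomputable def diagRep : H.AΔ →ₐ[k] Module.End k (M × N) :=
  (LinearMap.prodMapAlgHom k M N).comp (ρM.prod ρN)

/-- The representation of `T(Δ)` on `U` extending `ρ` and sending `ξ ∈ D̂(J)` to `g ξ`
(cut to its corner). -/
noncomputable def repT {U : Type w} [AddCommGroup U] [Module k U] (ρ : H.AΔ →ₐ[k] Module.End k U)
    (g : ∀ i j, H.dualRad i j →ₗ[k] Module.End k U) : H.TΔ →ₐ[k] Module.End k U :=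
  TensorAlg.lift ((TensorAlg.e_complete k (H.dualBar 0)).map ρ.toRingHom) fun i j =>
    (ρ.toLinearMap ∘ₗ TensorAlg.gen k (H.dualBar 0) i j).coprod (g i j)

/-- `h : M ⟶ N` as an endomorphism of `M × N`. -/
noncomputable def lower : (M →ₗ[k] N) →ₗ[k] Module.End k (M × N) :=
  LinearMap.llcomp k (M × N) N (M × N) (LinearMap.inr k M N) ∘ₗ
    LinearMap.lcomp k N (LinearMap.fst k M N)

/-- The block `M ⟶ N` of an endomorphism of `M × N`. -/
noncomputable def lowerBlock : Module.End k (M × N) →ₗ[k] (M →ₗ[k] N) :=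
  LinearMap.llcomp k M (M × N) N (LinearMap.snd k M N) ∘ₗ
    LinearMap.lcomp k (M × N) (LinearMap.inl k M N)

/-- The bimodule map `V ⟶ Hom_k(M, N)` with given values `g` on `D̂(J)`. -/
noncomputable def extV (g : ∀ i j, H.dualRad i j →ₗ[k] (M →ₗ[k] N)) : H.V →ₗ[k] (M →ₗ[k] N) :=
  lowerBlock ∘ₗ (repT (diagRep ρM ρN) fun i j => lower ∘ₗ g i j).toLinearMap ∘ₗ H.V.subtype

variable (H) in
/-- The inclusion of `D̂(J)` into `V`. -/
noncomputable def inclRadV (i j : P) : H.dualRad i j →ₗ[k] H.V :=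
  (H.inclRad i j).codRestrict H.V fun ξ =>
    Submodule.subset_span ⟨i, j, ξ, 1, 1, by rw [map_one, one_mul, mul_one]⟩

/-- A linear map on `T(Δ)` whose restriction to `V V = V ⊗ V` (tensor product over `A(Δ)`) is
`u v ↦ g u ∘ f v`: the block `M ⟶ L` of the representation of `T(Δ)` on `M × N × L` in which
`v ∈ V` acts by `(m, n, l) ↦ (0, f v m, g v n)`. -/
noncomputable def starMap (g : H.V →ₗ[k] (N →ₗ[k] L)) (f : H.V →ₗ[k] (M →ₗ[k] N)) :
    H.TΔ →ₗ[k] (M →ₗ[k] L) :=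
  (LinearMap.llcomp k M (N × L) L (LinearMap.snd k N L)) ∘ₗ lowerBlock ∘ₗ
    (repT (diagRep ρM (diagRep ρN ρL)) fun i j =>
      lower ∘ₗ LinearMap.llcomp k M N (N × L) (LinearMap.inl k N L) ∘ₗ f ∘ₗ H.inclRadV i j +
      LinearMap.llcomp k (M × N × L) (N × L) (M × N × L) (LinearMap.inr k M (N × L)) ∘ₗ
        LinearMap.lcomp k (N × L) (LinearMap.snd k M (N × L)) ∘ₗ lower ∘ₗ g ∘ₗ
          H.inclRadV i j).toLinearMap

variable (H M N) in
/-- Pairs `(f⁰, f¹)`. -/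
abbrev RawHom : Type _ := (M →ₗ[k] N) × (H.V →ₗ[k] (M →ₗ[k] N))

/-- `(f⁰, f¹)` is a morphism from `M` to `N` in `(A(Δ), I)-Mod`: `f¹` is a bimodule map, and
`a f⁰ = f⁰ a + f¹(δ a)` for all `a ∈ A(Δ)`. -/
structure IsModHom (f : RawHom H M N) : Prop where
  left : ∀ (a : H.AΔ) (v : H.V), f.2 ⟨H.incl a * v, incl_mul_mem a v.2⟩ = ρN a ∘ₗ f.2 v
  right : ∀ (a : H.AΔ) (v : H.V), f.2 ⟨v * H.incl a, mul_incl_mem a v.2⟩ = f.2 v ∘ₗ ρM a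
  compat : ∀ a : H.AΔ,
    ρN a ∘ₗ f.1 = f.1 ∘ₗ ρM a + f.2 ⟨delta m (H.incl a), delta_incl_mem m a⟩

variable (H M) in
/-- The identity `(id, 0)`. -/
noncomputable def rawId : RawHom H M M := (LinearMap.id, 0)

/-- The composite `(g⁰ f⁰, v ↦ g⁰ f¹(v) + g¹(v) f⁰ + (g¹ * f¹)(δ v))`. -/
noncomputable def rawComp (g : RawHom H N L) (f : RawHom H M N) : RawHom H M L :=
  (g.1 ∘ₗ f.1,
    LinearMap.llcomp k M N L g.1 ∘ₗ f.2 + LinearMap.lcomp k L f.1 ∘ₗ g.2 +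
      starMap ρM ρN ρL g.2 f.2 ∘ₗ delta m ∘ₗ H.V.subtype)

theorem repT_incl {U : Type w} [AddCommGroup U] [Module k U] (ρ : H.AΔ →ₐ[k] Module.End k U)
    (g : ∀ i j, H.dualRad i j →ₗ[k] Module.End k U) (a : H.AΔ) : repT ρ g (H.incl a) = ρ a := by
  induction a using TensorAlg.induction with
  | he i => rw [incl_e, repT, TensorAlg.lift_e]; rfl
  | hg i j α =>
    rw [incl_gen, repT, TensorAlg.lift_gen]
    simp only [LinearMap.coprod_apply, map_zero, add_zero]
    change ρ _ * ρ _ * ρ _ = _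
    rw [← map_mul, ← map_mul, e_mul_gen]
  | hs c => rw [AlgHom.commutes, AlgHom.commutes, AlgHom.commutes]
  | ha x y hx hy => rw [map_add, map_add, map_add, hx, hy]
  | hm x y hx hy => rw [map_mul, map_mul, map_mul, hx, hy]

theorem repT_inclRad {U : Type w} [AddCommGroup U] [Module k U] (ρ : H.AΔ →ₐ[k] Module.End k U)
    (g : ∀ i j, H.dualRad i j →ₗ[k] Module.End k U) (i j : P) (ξ : H.dualRad i j) :
    repT ρ g (H.inclRad i j ξ) =
      ρ (TensorAlg.e k _ j) * g i j ξ * ρ (TensorAlg.e k _ i) := by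
  refine (TensorAlg.lift_gen _ _ _ _ _).trans ?_
  simp

theorem V_ext {U : Type w} [AddCommGroup U] [Module k U] (F G : H.V →ₗ[k] U)
    (h : ∀ i j (ξ : H.dualRad i j) (a a' : H.AΔ) (hv : H.incl a * H.inclRad i j ξ * H.incl a' ∈ H.V),
      F ⟨_, hv⟩ = G ⟨_, hv⟩) : F = G := by
  refine LinearMap.ext fun ⟨v, hv⟩ => ?_
  refine Submodule.span_induction (p := fun v hv => F ⟨v, hv⟩ = G ⟨v, hv⟩) ?_ ?_ ?_ ?_ hv
  · rintro _ ⟨i, j, ξ, a, a', rfl⟩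
    exact h i j ξ a a' _
  · exact (map_zero F).trans (map_zero G).symm
  · intro x y hx hy hFx hFy
    exact (map_add F ⟨x, hx⟩ ⟨y, hy⟩).trans
      ((congrArg₂ (· + ·) hFx hFy).trans (map_add G ⟨x, hx⟩ ⟨y, hy⟩).symm)
  · intro c x hx hFx
    exact (map_smul F c ⟨x, hx⟩).trans
      ((congrArg (c • ·) hFx).trans (map_smul G c ⟨x, hx⟩).symm)

theorem bimod_gen (f : H.V →ₗ[k] (M →ₗ[k] N))
    (hf : ∀ (a : H.AΔ) (v : H.V), f ⟨H.incl a * v, incl_mul_mem a v.2⟩ = ρN a ∘ₗ f v)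
    (hf' : ∀ (a : H.AΔ) (v : H.V), f ⟨v * H.incl a, mul_incl_mem a v.2⟩ = f v ∘ₗ ρM a)
    (i j : P) (ξ : H.dualRad i j) (a a' : H.AΔ)
    (hv : H.incl a * H.inclRad i j ξ * H.incl a' ∈ H.V) :
    f ⟨_, hv⟩ = ρN a ∘ₗ f (H.inclRadV i j ξ) ∘ₗ ρM a' := by
  rw [← LinearMap.comp_assoc, ← hf, ← hf']
  rfl

theorem bimod_corner (f : H.V →ₗ[k] (M →ₗ[k] N))
    (hf : ∀ (a : H.AΔ) (v : H.V), f ⟨H.incl a * v, incl_mul_mem a v.2⟩ = ρN a ∘ₗ f v)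
    (hf' : ∀ (a : H.AΔ) (v : H.V), f ⟨v * H.incl a, mul_incl_mem a v.2⟩ = f v ∘ₗ ρM a)
    (i j : P) (ξ : H.dualRad i j) :
    ρN (TensorAlg.e k _ j) ∘ₗ f (H.inclRadV i j ξ) ∘ₗ ρM (TensorAlg.e k _ i) =
      f (H.inclRadV i j ξ) := by
  rw [← LinearMap.comp_assoc, ← hf, ← hf']
  congr 1
  apply Subtype.ext
  change H.incl _ * H.inclRad i j ξ * H.incl _ = H.inclRad i j ξ
  rw [incl_e, incl_e]
  exact e_mul_gen _ _ _

theorem starMap_mul (g : H.V →ₗ[k] (N →ₗ[k] L)) (f : H.V →ₗ[k] (M →ₗ[k] N))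
    (hg : ∀ (a : H.AΔ) (v : H.V), g ⟨H.incl a * v, incl_mul_mem a v.2⟩ = ρL a ∘ₗ g v)
    (hg' : ∀ (a : H.AΔ) (v : H.V), g ⟨v * H.incl a, mul_incl_mem a v.2⟩ = g v ∘ₗ ρN a)
    (hf : ∀ (a : H.AΔ) (v : H.V), f ⟨H.incl a * v, incl_mul_mem a v.2⟩ = ρN a ∘ₗ f v)
    (hf' : ∀ (a : H.AΔ) (v : H.V), f ⟨v * H.incl a, mul_incl_mem a v.2⟩ = f v ∘ₗ ρM a)
    (u v : H.V) : starMap ρM ρN ρL g f (u * v : H.TΔ) = g u ∘ₗ f v := by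
  let rep := repT (diagRep ρM (diagRep ρN ρL)) (fun i j =>
      lower ∘ₗ LinearMap.llcomp k M N (N × L) (LinearMap.inl k N L) ∘ₗ f ∘ₗ H.inclRadV i j +
      LinearMap.llcomp k (M × N × L) (N × L) (M × N × L) (LinearMap.inr k M (N × L)) ∘ₗ
        LinearMap.lcomp k (N × L) (LinearMap.snd k M (N × L)) ∘ₗ lower ∘ₗ g ∘ₗ H.inclRadV i j)
  have key : rep.toLinearMap ∘ₗ H.V.subtype =
      lower ∘ₗ LinearMap.llcomp k M N (N × L) (LinearMap.inl k N L) ∘ₗ f +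
      LinearMap.llcomp k (M × N × L) (N × L) (M × N × L) (LinearMap.inr k M (N × L)) ∘ₗ
        LinearMap.lcomp k (N × L) (LinearMap.snd k M (N × L)) ∘ₗ lower ∘ₗ g := by
    refine V_ext _ _ fun i j ξ a a' hv => ?_
    simp only [LinearMap.comp_apply, LinearMap.add_apply, Submodule.subtype_apply,
      AlgHom.toLinearMap_apply]
    rw [bimod_gen ρM ρN f hf hf', bimod_gen ρN ρL g hg hg', map_mul, map_mul, repT_incl, repT_incl,
      repT_inclRad, ← bimod_corner ρM ρN f hf hf', ← bimod_corner ρN ρL g hg hg']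
    refine LinearMap.ext fun x => ?_
    simp only [LinearMap.comp_apply, LinearMap.add_apply]
    rw [bimod_corner ρM ρN f hf hf', bimod_corner ρN ρL g hg hg']
    have h1 := LinearMap.congr_fun (bimod_corner ρM ρN f hf hf' i j ξ) (ρM a' x.1)
    have h2 := LinearMap.congr_fun (bimod_corner ρN ρL g hg hg' i j ξ) (ρN a' x.2.1)
    simp only [LinearMap.comp_apply] at h1 h2
    simp [lower, diagRep, h1, h2]
  have key' : ∀ (v : H.V) (x : M × N × L), rep v x = (0, f v x.1, g v x.2.1) := by
    intro v x
    have := LinearMap.congr_fun (LinearMap.congr_fun key v) x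
    simpa [lower] using this
  refine LinearMap.ext fun x => ?_
  change (rep (u * v) (x, 0)).2.2 = _
  rw [map_mul, Module.End.mul_apply, key', key']
  rfl

theorem extV_inclRad (g : ∀ i j, H.dualRad i j →ₗ[k] (M →ₗ[k] N)) (i j : P) (ξ : H.dualRad i j)
    (a a' : H.AΔ) (hv) : extV ρM ρN g ⟨H.incl a * H.inclRad i j ξ * H.incl a', hv⟩ =
      ρN a ∘ₗ ρN (TensorAlg.e k _ j) ∘ₗ g i j ξ ∘ₗ ρM (TensorAlg.e k _ i) ∘ₗ ρM a' := by
  ext x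
  simp [extV, repT_incl, repT_inclRad, lowerBlock, diagRep, lower]

end blocks

/-- The objects of `(A(Δ), I)-Mod`: a left `A(Δ)`-module, given as a vector space with an algebra map
`ρ` from `A(Δ)` to its endomorphisms, which is annihilated by `I`. -/
structure IMod where
  carrier : Type w
  [addCommGroup : AddCommGroup carrier]
  [module : Module k carrier]
  ρ : H.AΔ →ₐ[k] Module.End k carrier
  ann : ∀ a ∈ idealI m, ρ a = 0

attribute [instance] IMod.addCommGroup IMod.module

/-- The composition of `(A(Δ), I)-Mod` is well defined, unital and associative. -/
structure ModIsCategory : Prop where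
  id_mem : ∀ M : IMod.{u, w} m, IsModHom m M.ρ M.ρ (rawId H M.carrier)
  comp_mem : ∀ (M N L : IMod.{u, w} m) (f : RawHom H M.carrier N.carrier)
    (g : RawHom H N.carrier L.carrier), IsModHom m M.ρ N.ρ f → IsModHom m N.ρ L.ρ g →
      IsModHom m M.ρ L.ρ (rawComp m M.ρ N.ρ L.ρ g f)
  id_comp : ∀ (M N : IMod.{u, w} m) (f : RawHom H M.carrier N.carrier), IsModHom m M.ρ N.ρ f →
    rawComp m M.ρ M.ρ N.ρ f (rawId H M.carrier) = f
  comp_id : ∀ (M N : IMod.{u, w} m) (f : RawHom H M.carrier N.carrier), IsModHom m M.ρ N.ρ f →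
    rawComp m M.ρ N.ρ N.ρ (rawId H N.carrier) f = f
  assoc : ∀ (M N L K : IMod.{u, w} m) (f : RawHom H M.carrier N.carrier)
    (g : RawHom H N.carrier L.carrier) (h : RawHom H L.carrier K.carrier),
    IsModHom m M.ρ N.ρ f → IsModHom m N.ρ L.ρ g → IsModHom m L.ρ K.ρ h →
      rawComp m M.ρ N.ρ K.ρ (rawComp m N.ρ L.ρ K.ρ h g) f =
        rawComp m M.ρ L.ρ K.ρ h (rawComp m M.ρ N.ρ L.ρ g f)

variable {m} in
/-- The objects of `(A(Δ), I)-Mod`, as a type to carry the category structure. -/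
structure IModCat (hM : ModIsCategory.{u, w} m) where
  obj : IMod.{u, w} m

variable {m} in
noncomputable instance (hM : ModIsCategory.{u, w} m) : Category (IModCat hM) where
  Hom M N := {f : RawHom H M.obj.carrier N.obj.carrier // IsModHom m M.obj.ρ N.obj.ρ f}
  id M := ⟨rawId H M.obj.carrier, hM.id_mem M.obj⟩
  comp {M N L} f g := ⟨rawComp m M.obj.ρ N.obj.ρ L.obj.ρ g.1 f.1,
    hM.comp_mem M.obj N.obj L.obj _ _ f.2 g.2⟩
  id_comp f := Subtype.ext (hM.id_comp _ _ _ f.2)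
  comp_id f := Subtype.ext (hM.comp_id _ _ _ f.2)
  assoc f g h := Subtype.ext (hM.assoc _ _ _ _ _ _ _ f.2 g.2 h.2).symm

end Bocs

section Twisted

variable (X Y Z : SMod.{u, w} k P)

/-- `Hom_k(X, Y) ⊗ A`. -/
abbrev HomA : Type _ := (X.carrier →ₗ[k] Y.carrier) ⊗[k] H.Yoneda

/-- `Hom_k(X, Y) ⊗ T_k(A)`. -/
abbrev HomT : Type _ := (X.carrier →ₗ[k] Y.carrier) ⊗[k] TensorAlgebra k H.Yoneda

/-- `ad(B)(X, Y)_n = ⨁_{i, j} Hom_k(X e_i, Y e_j) ⊗ e_j B_n e_i`. -/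
noncomputable def ad (n : ℤ) : Submodule k (H.HomA X Y) :=
  Submodule.span k {t | ∃ (i j : P) (f : X.carrier →ₗ[k] Y.carrier) (x : H.Yoneda),
    Y.proj j ∘ₗ f ∘ₗ X.proj i = f ∧ x ∈ H.barComp n i j ∧ t = f ⊗ₜ[k] x}

/-- `id ⊗ (A ⟶ T_k(A))`. -/
noncomputable def toHomT : H.HomA X Y →ₗ[k] H.HomT X Y :=
  LinearMap.lTensor _ (TensorAlgebra.ι k)

/-- `(f ⊗ u) (g ⊗ v) = f g ⊗ u v`. -/
noncomputable def compT : H.HomT Y Z →ₗ[k] H.HomT X Y →ₗ[k] H.HomT X Z :=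
  TensorProduct.map₂ (LinearMap.llcomp k X.carrier Y.carrier Z.carrier)
    (LinearMap.mul k (TensorAlgebra k H.Yoneda))

variable {X Y Z}

variable {H} (m : StrictAInfinity H)

/-- All `b_n^{ad}` at once: `b_n^{ad} (u_n ⊗ ⋯ ⊗ u_1)` is `bad` of the product `u_n ⋯ u_1`, so
`b_n^{ad} ((f_n ⊗ x_n) ⊗ ⋯ ⊗ (f_1 ⊗ x_1)) = f_n ⋯ f_1 ⊗ b_n (x_n, …, x_1)`. -/
noncomputable def bad : H.HomT X Y →ₗ[k] H.HomA X Y :=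
  LinearMap.lTensor _ m.bTotal

/-- `δ` as an element of the algebra `End_k(X) ⊗ T_k(A)`. -/
noncomputable def deltaT (δ : H.HomA X X) :
    Module.End k X.carrier ⊗[k] TensorAlgebra k H.Yoneda := H.toHomT X X δ

/-- `∑_{s ≥ 0} δ^{⊗ s}`; the sum is finite for the objects of `tw(B)`. -/
noncomputable def geom (δ : H.HomA X X) : H.HomT X X := ∑ᶠ s : ℕ, deltaT δ ^ s

/-- The evaluation `f ⊗ x ↦ ζ(x) f`. -/
noncomputable def evalA (X Y : SMod.{u, w} k P) :
    Module.Dual k H.Yoneda →ₗ[k] H.HomA X Y →ₗ[k] (X.carrier →ₗ[k] Y.carrier) :=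
  LinearMap.llcomp k _ _ _ (TensorProduct.rid k (X.carrier →ₗ[k] Y.carrier)).toLinearMap ∘ₗ
    LinearMap.lTensorHom _

/-- The objects `(X, δ)` of `tw(B)`: an element `δ ∈ ad(B)(X, X)_0`, strictly triangular with respect to
a finite filtration of `X` by `S`-submodules, such that `∑_{s ≥ 1} b_s^{ad}(δ^{⊗ s}) = 0`. If
`δ = ∑ f_x ⊗ x` with linearly independent `x`, then the maps `evalA ζ δ` are the linear combinations
of the `f_x`. -/
structure TwObj where
  X : SMod.{u, w} k P
  δ : H.HomA X X
  δ_mem : δ ∈ H.ad X X 0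
  filtration : ∃ (l : ℕ) (F : ℕ → Submodule (P → k) X.carrier), Monotone F ∧ F 0 = ⊥ ∧ F l = ⊤ ∧
    ∀ (ζ : Module.Dual k H.Yoneda) (r : ℕ), ∀ x ∈ F (r + 1), evalA X X ζ δ x ∈ F r
  maurerCartan : ∑ᶠ s : ℕ, bad m (X := X) (Y := X) (deltaT δ ^ (s + 1)) = 0

variable {m}

/-- `b_1^{tw}(t) = ∑_{i₀, i₁} b^{ad}(δ_Y^{⊗ i₁} ⊗ t ⊗ δ_X^{⊗ i₀})`. -/
noncomputable def b1tw (X Y : TwObj.{u, w} m) : H.HomA X.X Y.X →ₗ[k] H.HomA X.X Y.X :=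
  bad m ∘ₗ (H.compT X.X X.X Y.X).flip (geom X.δ) ∘ₗ H.compT X.X Y.X Y.X (geom Y.δ) ∘ₗ H.toHomT X.X Y.X

/-- `b_2^{tw}(t₂ ⊗ t₁) = ∑_{i₀, i₁, i₂} b^{ad}(δ_Z^{⊗ i₂} ⊗ t₂ ⊗ δ_Y^{⊗ i₁} ⊗ t₁ ⊗ δ_X^{⊗ i₀})`. -/
noncomputable def b2tw (X Y Z : TwObj.{u, w} m) (t₂ : H.HomA Y.X Z.X) (t₁ : H.HomA X.X Y.X) :
    H.HomA X.X Z.X :=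
  bad m (H.compT _ _ _ (geom Z.δ) (H.compT _ _ _ (H.toHomT _ _ t₂)
    (H.compT _ _ _ (geom Y.δ) (H.compT _ _ _ (H.toHomT _ _ t₁) (geom X.δ)))))

/-- `Z_{-1}(tw(B))(X, Y)`: the cycles of degree `-1`. -/
noncomputable def cyc (X Y : TwObj.{u, w} m) : Submodule k (H.HomA X.X Y.X) :=
  H.ad X.X Y.X (-1) ⊓ LinearMap.ker (b1tw X Y)

/-- The boundaries of degree `-1`. -/
noncomputable def bdry (X Y : TwObj.{u, w} m) : Submodule k (H.HomA X.X Y.X) :=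
  (H.ad X.X Y.X (-2)).map (b1tw X Y)

/-- `∑_j id_{X e_j} ⊗ e_j`. -/
noncomputable def unit (X : TwObj.{u, w} m) : H.HomA X.X X.X :=
  ∑ j, X.X.proj j ⊗ₜ[k] H.e j

/-- Congruence of cycles modulo boundaries. -/
def homSetoid (X Y : TwObj.{u, w} m) : Setoid (cyc X Y) where
  r t t' := (t : H.HomA X.X Y.X) - t' ∈ bdry X Y
  iseqv :=
    ⟨fun t => by rw [sub_self]; exact zero_mem _,
      fun {t t'} h => by rw [← neg_sub]; exact neg_mem h,
      fun {t t' t''} h h' => by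
        rw [← sub_add_sub_cancel (t : H.HomA X.X Y.X) t' t'']; exact add_mem h h'⟩

/-- `H^{-1}(tw(B))(X, Y)`: cycles of degree `-1` modulo boundaries. -/
def HomH (X Y : TwObj.{u, w} m) : Type _ := Quotient (homSetoid X Y)

variable (m) in
/-- The composition induced by `b_2^{tw}` on `H^{-1}(tw(B))` is well defined, unital and associative. -/
structure TwIsCategory : Prop where
  unit_mem : ∀ X : TwObj.{u, w} m, unit X ∈ cyc X X
  comp_mem : ∀ (X Y Z : TwObj.{u, w} m), ∀ t₁ ∈ cyc X Y, ∀ t₂ ∈ cyc Y Z,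
    b2tw X Y Z t₂ t₁ ∈ cyc X Z
  comp_congr : ∀ (X Y Z : TwObj.{u, w} m), ∀ t₁ ∈ cyc X Y, ∀ t₁' ∈ cyc X Y, ∀ t₂ ∈ cyc Y Z,
    ∀ t₂' ∈ cyc Y Z, t₁ - t₁' ∈ bdry X Y → t₂ - t₂' ∈ bdry Y Z →
      b2tw X Y Z t₂ t₁ - b2tw X Y Z t₂' t₁' ∈ bdry X Z
  comp_unit : ∀ (X Y : TwObj.{u, w} m), ∀ t ∈ cyc X Y, b2tw X X Y t (unit X) - t ∈ bdry X Y
  unit_comp : ∀ (X Y : TwObj.{u, w} m), ∀ t ∈ cyc X Y, b2tw X Y Y (unit Y) t - t ∈ bdry X Y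
  assoc : ∀ (X Y Z U : TwObj.{u, w} m), ∀ t₁ ∈ cyc X Y, ∀ t₂ ∈ cyc Y Z, ∀ t₃ ∈ cyc Z U,
    b2tw X Z U t₃ (b2tw X Y Z t₂ t₁) - b2tw X Y U (b2tw Y Z U t₃ t₂) t₁ ∈ bdry X U

/-- The objects of `H^{-1}(tw(B))`, as a type to carry the category structure. -/
structure HTwCat (hT : TwIsCategory.{u, w} m) where
  obj : TwObj.{u, w} m

/-- The composition of `H^{-1}(tw(B))`. -/
noncomputable def compH (hT : TwIsCategory.{u, w} m) {X Y Z : TwObj.{u, w} m} :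
    HomH X Y → HomH Y Z → HomH X Z :=
  Quotient.map₂ (fun t₁ t₂ => ⟨b2tw X Y Z t₂ t₁, hT.comp_mem X Y Z _ t₁.2 _ t₂.2⟩)
    fun t₁ t₁' h₁ t₂ t₂' h₂ => hT.comp_congr X Y Z _ t₁.2 _ t₁'.2 _ t₂.2 _ t₂'.2 h₁ h₂

noncomputable instance (hT : TwIsCategory.{u, w} m) : Category (HTwCat hT) where
  Hom X Y := HomH X.obj Y.obj
  id X := Quotient.mk _ ⟨unit X.obj, hT.unit_mem X.obj⟩
  comp f g := compH hT f g
  id_comp := by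
    rintro X Y ⟨t⟩
    exact Quotient.sound (hT.comp_unit _ _ _ t.2)
  comp_id := by
    rintro X Y ⟨t⟩
    exact Quotient.sound (hT.unit_comp _ _ _ t.2)
  assoc := by
    rintro X Y Z U ⟨t₁⟩ ⟨t₂⟩ ⟨t₃⟩
    exact Quotient.sound (hT.assoc _ _ _ _ _ t₁.2 _ t₂.2 _ t₃.2)

variable [IsAlgClosed k] [Module.Finite k Λ]

/-- `Ψ(t)(α)` for `α` in the dual of `e_j B_n e_i`. -/
noncomputable def psiBar {X Y : SMod.{u, w} k P} (t : H.HomA X Y) (n : ℤ) (i j : P) :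
    H.dualBar n i j →ₗ[k] (X.carrier →ₗ[k] Y.carrier) :=
  (evalA X Y).flip t ∘ₗ LinearMap.lcomp k k (H.barProj n i j).rangeRestrict

/-- `Ψ(t)(ξ)` for `ξ ∈ D̂(J)`. -/
noncomputable def psiRad {X Y : SMod.{u, w} k P} (t : H.HomA X Y) (i j : P) :
    H.dualRad i j →ₗ[k] (X.carrier →ₗ[k] Y.carrier) :=
  (evalA X Y).flip t ∘ₗ LinearMap.lcomp k k (H.radProj i j)

/-- The `A(Δ)`-module `(X^op, Ψ(δ_X))`. -/
noncomputable def rhoM (X : TwObj.{u, w} m) : H.AΔ →ₐ[k] Module.End k X.X.carrier :=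
  TensorAlg.lift X.X.proj_complete fun i j => psiBar X.δ 0 i j

/-- `M(t) = (Ψ(t)(∑_j e_j^*), ξ ↦ Ψ(t)(ξ))`. -/
noncomputable def mapM (X Y : TwObj.{u, w} m) (t : H.HomA X.X Y.X) :
    RawHom H X.X.carrier Y.X.carrier :=
  (evalA X.X Y.X (∑ j, H.star j) t, extV (rhoM X) (rhoM Y) (psiRad t))

variable (m) in
/-- The assignments `X ↦ (X^op, Ψ(δ_X))` and `t ↦ M(t)` are well defined and functorial. -/
structure MIsFunctor : Prop where
  ann : ∀ X : TwObj.{u, w} m, ∀ a ∈ idealI m, rhoM X a = 0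
  isModHom : ∀ (X Y : TwObj.{u, w} m), ∀ t ∈ cyc X Y,
    IsModHom m (rhoM X) (rhoM Y) (mapM X Y t)
  congr : ∀ (X Y : TwObj.{u, w} m), ∀ t ∈ cyc X Y, ∀ t' ∈ cyc X Y, t - t' ∈ bdry X Y →
    mapM X Y t = mapM X Y t'
  map_unit : ∀ X : TwObj.{u, w} m, mapM X X (unit X) = rawId H X.X.carrier
  map_comp : ∀ (X Y Z : TwObj.{u, w} m), ∀ t₁ ∈ cyc X Y, ∀ t₂ ∈ cyc Y Z,
    mapM X Z (b2tw X Y Z t₂ t₁) =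
      rawComp m (rhoM X) (rhoM Y) (rhoM Z) (mapM Y Z t₂) (mapM X Y t₁)

/-- The functor `M : H^{-1}(tw(B)) ⥤ (A(Δ), I)-Mod`. -/
noncomputable def functorM (hT : TwIsCategory.{u, w} m) (hM : ModIsCategory.{u, w} m)
    (hF : MIsFunctor.{u, w} m) : HTwCat hT ⥤ IModCat hM where
  obj X := ⟨⟨X.obj.X.carrier, rhoM X.obj, hF.ann X.obj⟩⟩
  map {X Y} := Quotient.lift
    (fun t => ⟨mapM X.obj Y.obj t, hF.isModHom _ _ _ t.2⟩)
    fun t t' h => Subtype.ext <|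
      hF.congr _ _ _ t.2 _ t'.2 h
  map_id X := Subtype.ext (hF.map_unit X.obj)
  map_comp := by
    rintro X Y Z ⟨t₁⟩ ⟨t₂⟩
    exact Subtype.ext (hF.map_comp _ _ _ _ t₁.2 _ t₂.2)

end Twisted

end
end HomologicalSystem

/-!
The proof takes place in the tensor algebra `T_k(A)` with coefficients: the elements of
`Hom_k(X, Y) ⊗ T_k(A)` are composed by `(f ⊗ u) (g ⊗ v) = f g ⊗ u v`, and all operations `b_n^{ad}`
together form one linear map `b` on them. For an object `(X, δ)` of `tw(B)` let `G = ∑_s δ^{⊗ s}`. Every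
letter of `B_0` goes from some `i` to a strictly larger index, since `Ext¹(Δ_i, Δ_j) ≠ 0` only for `i < j`;
as `P` is finite, `δ` is nilpotent (`deltaT_pow_eq_zero`) and `G` is a finite sum. The Maurer–Cartan
equation reads `b(G) = 0`, and `b_1^{tw}(t) = b(G t G)`, `b_2^{tw}(t₂ ⊗ t₁) = b(G t₂ G t₁ G)`.

*The category `H^{-1}(tw(B))`.* The Stasheff identities say that `b` vanishes on the image of the
codifferential `D` of the bar construction (`bTotal_codiff`). If `t₁`, `t₂`, `t₃` are cycles, then
`D(G t₂ G t₁ G) = G b_2^{tw}(t₂ ⊗ t₁) G`, so `b_2^{tw}` preserves cycles, and `b ∘ D = 0` on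
`G t₃ G t₂ G t₁ G` gives associativity up to a term which contains `b(G t₃ G t₂ G t₁ G)`. The latter has
degree `-2`, hence is zero: `A` starts in degree zero, so `B` starts in degree `-1`. For the same reason
there are no boundaries of degree `-1`. The identities are units as the `e_i` are strict units.

*The functor.* An element `t` of degree `-1` is the sum of `∑_j t⁰|_{X e_j} ⊗ e_j`, where
`t⁰ = Ψ(t)(∑_j e_j^*)`, and of a part with coefficients in `J` (`unitEl_starPart_add_radPart`). An algebra
map `φ` from `T(Δ)` to the endomorphisms of some space sends the element
`∑ α(b_n(x_n ⊗ ⋯ ⊗ x_1)) x_n^* ⋯ x_1^*` to the value of `α` on `b(∑_s Θ^{⊗ s})`, with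
`Θ = ∑_x φ(x^*) ⊗ x` (`map_dualB`). For the action of `A(Δ)` on `X` this shows that the ideal `I` acts by
zero if and only if the Maurer–Cartan equation holds (`map_beta`). The triangular representations of
`T(Δ)` on `X × Y` and on `X × Y × Z` given by the parts of morphisms in `J` have the corner entries
`G t G` and `G t₂ G t₁ G` in `∑_s Θ^{⊗ s}`, which expresses the values of `M(t)¹` and of the convolution
product of `M(t₂)¹` and `M(t₁)¹` on the differential of the generators by `b_1^{tw}` and `b_2^{tw}`
(`extT_deltaBar`, `starMap_deltaRad`). Thus
`Ψ(b_1^{tw}(t))(α) = t⁰ Ψ(δ_X)(α) - Ψ(δ_Y)(α) t⁰ + M(t)¹(δ α)` (`psiBar_b1tw`): being a cycle is the same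
as giving a morphism of `A(Δ)`-modules. Likewise `b_2^{tw}` becomes the composition (`mapM_b2tw`).

*The equivalence.* As `B_0` and `J` are finite-dimensional, an element of `ad(B)(X, Y)` of degree `0` or
`-1` is determined by, and can be prescribed through, its values on dual bases. So every `A(Δ)`-module
annihilated by `I` is of the form `M(X)` (`exists_eq_toIMod`), with a filtration by the position of the
`e_i` in the order, every morphism is of the form `M(t)` (`exists_mapM_eq`), and `M` is injective on
morphisms (`mapM_injective`). Consequently the laws of a category for `(A(Δ), I)-Mod`, including
associativity, are inherited from `H^{-1}(tw(B))`, without a separate proof that `δ² = 0` modulo `I`.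
-/

namespace HomologicalSystem


/-! ### The Yoneda algebra -/

section YonedaAlgebra

variable {k : Type u} [Field k] {Λ : Type u} [Ring Λ] [Algebra k Λ]
  {P : Type u} [Preorder P] [DecidableEq P] [Fintype P] (H : HomologicalSystem k Λ P)
  [IsAlgClosed k] [Module.Finite k Λ]

/-- The inclusion of `Ext^n(Δ, Δ)` into the Yoneda algebra. -/
noncomputable abbrev extIncl (n : ℕ) : Ext H.sumΔ H.sumΔ n →ₗ[k] H.Yoneda :=
  DirectSum.lof k ℕ (fun n => Ext H.sumΔ H.sumΔ n) n

theorem yonedaMul_extIncl {p q n : ℕ} (h : q + p = n) (a : Ext H.sumΔ H.sumΔ p)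
    (b : Ext H.sumΔ H.sumΔ q) :
    H.yonedaMul (H.extIncl p a) (H.extIncl q b) = H.extIncl n (b.comp a h) := by
  subst h
  simp [yonedaMul, DirectSum.toModule_lof]

/-- Homogeneous elements span the Yoneda algebra. -/
theorem yoneda_induction {C : H.Yoneda → Prop} (hn : ∀ n x, C (H.extIncl n x))
    (ha : ∀ x y, C x → C y → C (x + y)) (x : H.Yoneda) : C x :=
  DirectSum.induction_on x (by simpa using hn 0 0) hn ha

theorem yonedaMul_assoc (a b c : H.Yoneda) :
    H.yonedaMul (H.yonedaMul a b) c = H.yonedaMul a (H.yonedaMul b c) := by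
  induction a using H.yoneda_induction with
  | ha x y hx hy => simp only [map_add, LinearMap.add_apply, hx, hy]
  | hn p a =>
  induction b using H.yoneda_induction with
  | ha x y hx hy => simp only [map_add, LinearMap.add_apply, hx, hy]
  | hn q b =>
  induction c using H.yoneda_induction with
  | ha x y hx hy => simp only [map_add, hx, hy]
  | hn r c =>
  rw [H.yonedaMul_extIncl rfl, H.yonedaMul_extIncl rfl, H.yonedaMul_extIncl rfl,
    H.yonedaMul_extIncl (n := r + (q + p)) (by omega)]
  congr 1
  exact (Ext.comp_assoc c b a rfl rfl (by omega)).symm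

theorem ofEnd_apply (f : H.EndΔ) : H.ofEnd f = H.extIncl 0 (Ext.mk₀ f) := rfl

theorem toEnd_ofEnd (f : H.EndΔ) : H.toEnd (H.ofEnd f) = f := by
  simp [toEnd, ofEnd]

theorem toEnd_extIncl_of_ne {n : ℕ} (hn : n ≠ 0) (x : Ext H.sumΔ H.sumΔ n) :
    H.toEnd (H.extIncl n x) = 0 := by
  simp [toEnd, DirectSum.component.of, hn]

theorem ofEnd_mul (f g : H.EndΔ) : H.ofEnd (f * g) = H.yonedaMul (H.ofEnd f) (H.ofEnd g) := by
  rw [ofEnd_apply, ofEnd_apply, ofEnd_apply, H.yonedaMul_extIncl rfl, Ext.mk₀_comp_mk₀]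
  rfl

theorem ofEnd_toEnd (a : H.Yoneda) : H.ofEnd (H.toEnd a) = H.degProj 0 a := by
  induction a using H.yoneda_induction with
  | ha x y hx hy => simp only [map_add, hx, hy]
  | hn n x =>
    rw [degProj_lof]
    rcases Nat.eq_zero_or_pos n with rfl | hn
    · simp [toEnd, ofEnd]
    · rw [H.toEnd_extIncl_of_ne hn.ne', if_neg (by omega), map_zero]

theorem e_mul_e (i j : P) : H.yonedaMul (H.e j) (H.e i) = if i = j then H.e i else 0 := by
  rw [e, e, ← ofEnd_mul, idem_mul_idem]
  split_ifs <;> simp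

theorem e_mul_e_self (i : P) : H.yonedaMul (H.e i) (H.e i) = H.e i := by simp [e_mul_e]

theorem degProj_zero_ofEnd (f : H.EndΔ) : H.degProj 0 (H.ofEnd f) = H.ofEnd f := by
  rw [← ofEnd_toEnd, toEnd_ofEnd]

theorem barProj_apply (n : ℤ) (i j : P) (a : H.Yoneda) :
    H.barProj n i j a = H.yonedaMul (H.yonedaMul (H.e j) (H.degProj (n + 1) a)) (H.e i) := rfl

theorem barProj_barProj (n n' : ℤ) (i j i' j' : P) (a : H.Yoneda) :
    H.barProj n i j (H.barProj n' i' j' a) =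
      if n' = n ∧ i' = i ∧ j' = j then H.barProj n i j a else 0 := by
  simp only [barProj_apply, degProj_comm, degProj_degProj]
  have h : ∀ x : H.Yoneda, H.yonedaMul (H.yonedaMul (H.e j) (H.yonedaMul (H.yonedaMul (H.e j') x) (H.e i')))
      (H.e i) = if i' = i ∧ j' = j then H.yonedaMul (H.yonedaMul (H.e j) x) (H.e i) else 0 := by
    intro x
    rw [← H.yonedaMul_assoc (H.e j), ← H.yonedaMul_assoc (H.e j), e_mul_e, H.yonedaMul_assoc _ (H.e i'),
      e_mul_e]
    by_cases h1 : j' = j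
    · by_cases h2 : i' = i
      · subst h1 h2; simp
      · simp [h2, Ne.symm h2]
    · simp [h1]
  rw [h]
  by_cases h1 : n' = n
  · subst h1; simp
  · have : ¬ (n' + 1 = n + 1) := by omega
    simp [h1, this]

theorem mem_barComp {n : ℤ} {i j : P} {x : H.Yoneda} :
    x ∈ H.barComp n i j ↔ H.barProj n i j x = x := by
  constructor
  · rintro ⟨y, rfl⟩
    rw [barProj_barProj, if_pos ⟨rfl, rfl, rfl⟩]
  · intro h
    exact ⟨x, h⟩

theorem mem_barComp' {n : ℤ} {i j : P} {x : H.Yoneda} :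
    x ∈ H.barComp n i j ↔ H.yonedaMul (H.e j) x = x ∧ H.yonedaMul x (H.e i) = x ∧
      H.degProj (n + 1) x = x := by
  constructor
  · rintro ⟨y, rfl⟩
    refine ⟨?_, ?_, ?_⟩
    · rw [barProj_apply, ← H.yonedaMul_assoc, ← H.yonedaMul_assoc, e_mul_e_self]
    · rw [barProj_apply, H.yonedaMul_assoc, e_mul_e_self]
    · rw [barProj_apply, degProj_comm, degProj_degProj, if_pos rfl]
  · rintro ⟨h1, h2, h3⟩
    rw [mem_barComp, barProj_apply, h3, h1, h2]

theorem barProj_of_mem {n n' : ℤ} {i j i' j' : P} {x : H.Yoneda} (hx : x ∈ H.barComp n i j) :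
    H.barProj n' i' j' x = if n = n' ∧ i = i' ∧ j = j' then x else 0 := by
  obtain ⟨y, rfl⟩ := hx
  rw [barProj_barProj]
  split_ifs with h
  · obtain ⟨rfl, rfl, rfl⟩ := h; rfl
  · rfl

theorem e_mem_barComp (i : P) : H.e i ∈ H.barComp (-1) i i := by
  rw [mem_barComp']
  refine ⟨H.e_mul_e_self i, H.e_mul_e_self i, ?_⟩
  exact H.degProj_zero_ofEnd _

/-- `B` is concentrated in degrees `≥ -1`. -/
theorem barComp_eq_bot {n : ℤ} (hn : n < -1) (i j : P) : H.barComp n i j = ⊥ := by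
  rw [eq_bot_iff]
  rintro _ ⟨y, rfl⟩
  have : ¬ (0 ≤ n + 1) := by omega
  simp [barProj_apply, degProj, this]

theorem signInv_of_degProj {n : ℕ} {x : H.Yoneda} (hx : H.degProj n x = x) :
    H.signInv x = (-1 : k) ^ n • x := by
  rw [← hx]
  simp [degProj, signInv]

theorem signInv_extIncl (n : ℕ) (x : Ext H.sumΔ H.sumΔ n) :
    H.signInv (H.extIncl n x) = (-1 : k) ^ n • H.extIncl n x := by
  simp [signInv]

theorem signInv_signInv (x : H.Yoneda) : H.signInv (H.signInv x) = x := by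
  induction x using H.yoneda_induction with
  | ha x y hx hy => simp only [map_add, hx, hy]
  | hn n x => rw [signInv_extIncl, map_smul, signInv_extIncl, smul_smul, ← mul_pow]; simp

theorem signInv_e (i : P) : H.signInv (H.e i) = H.e i := by
  rw [e, ofEnd_apply, signInv_extIncl]; simp

/-! ### Finiteness and order -/

theorem hom_finite (M N : ModuleCat.{u} Λ) [Module.Finite Λ M] [Module.Finite Λ N] :
    Module.Finite k (M ⟶ N) := by
  have := Module.Finite.trans (R := k) Λ M
  have := Module.Finite.trans (R := k) Λ N
  let φ : (M ⟶ N) →ₗ[k] (M →ₗ[k] N) :=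
    { toFun := fun f => f.hom.restrictScalars k
      map_add' := fun f g => rfl
      map_smul' := fun c f => rfl }
  refine Module.Finite.of_injective φ fun f g h => ModuleCat.hom_ext (LinearMap.ext fun v => ?_)
  exact LinearMap.congr_fun h v

/-- Dimension shifting: `Ext¹(M, N)` is a quotient of `Hom(K, N)`, with `K` the kernel of a
surjection onto `M` from a finite free module. -/
theorem ext_one_finite (M N : ModuleCat.{u} Λ) [Module.Finite Λ M] [Module.Finite Λ N] :
    Module.Finite k (Ext M N 1) := by
  obtain ⟨n, f, hf⟩ := Module.Finite.exists_fin' Λ M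
  have hn : IsNoetherianRing Λ := IsNoetherianRing.of_finite k Λ
  have hS := LinearMap.shortExact_shortComplexKer hf
  have : Projective f.shortComplexKer.X₂ :=
    (IsProjective.iff_projective (Fin n → Λ)).1 inferInstance
  have : Module.Finite Λ f.shortComplexKer.X₁ := inferInstanceAs (Module.Finite Λ (LinearMap.ker f))
  have := hom_finite (k := k) f.shortComplexKer.X₁ N
  have : Module.Finite k (Ext f.shortComplexKer.X₁ N 0) :=
    Module.Finite.equiv (Ext.linearEquiv₀ (R := k)).symm
  refine Module.Finite.of_surjective (Ext.precompOfLinear hS.extClass k N (add_zero 1)) fun x => ?_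
  exact Ext.contravariant_sequence_exact₃ hS N x (Ext.eq_zero_of_projective _) (add_zero 1)

theorem sumΔ_finite : Module.Finite Λ H.sumΔ := by
  have := H.finite
  exact inferInstanceAs (Module.Finite Λ (∀ i, H.Δ i))

theorem endΔ_finite : Module.Finite k H.EndΔ := by
  have := H.sumΔ_finite
  exact hom_finite H.sumΔ H.sumΔ

instance radComp_finite (i j : P) : Module.Finite k (H.radComp i j) := by
  have := H.endΔ_finite
  exact inferInstanceAs (Module.Finite k (H.radical.map (H.ofEnd ∘ₗ H.conj i j)))

instance barComp_zero_finite (i j : P) : Module.Finite k (H.barComp 0 i j) := by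
  have := H.sumΔ_finite
  have := ext_one_finite (k := k) H.sumΔ H.sumΔ
  have hf : Module.Finite k (LinearMap.range (H.extIncl 1)) := Module.Finite.range _
  refine Module.Finite.of_injective
    (Submodule.inclusion (p' := LinearMap.range (H.extIncl 1)) ?_) (Submodule.inclusion_injective _)
  intro x hx
  rw [← (H.mem_barComp'.1 hx).2.2]
  exact ⟨_, rfl⟩

/-- A nonzero homomorphism `Δ_i ⟶ Δ_j` forces `i ≤ j`. -/
theorem le_of_mem_barComp {i j : P} {x : H.Yoneda} (hx : x ∈ H.barComp (-1) i j) (h0 : x ≠ 0) :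
    i ≤ j := by
  obtain ⟨h1, h2, h3⟩ := H.mem_barComp'.1 hx
  rw [neg_add_cancel, ← ofEnd_toEnd] at h3
  rw [← h3, e, ← ofEnd_mul] at h1
  rw [← h3, ← h1, e, ← ofEnd_mul, idem_mul_mul_idem] at h2
  refine H.hom_le i j ⟨ModuleCat.ofHom (LinearMap.proj j ∘ₗ (H.toEnd x).hom ∘ₗ
    LinearMap.single Λ (fun j => H.Δ j) i), fun hf => h0 ?_⟩
  have hf' : LinearMap.proj j ∘ₗ (H.toEnd x).hom ∘ₗ
    LinearMap.single Λ (fun j => H.Δ j) i = 0 := congrArg ModuleCat.Hom.hom hf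
  rw [← h3, ← h1, ← h2, hf']
  have : H.corner i j 0 = 0 := by
    refine ModuleCat.hom_ext ?_
    change LinearMap.single Λ (fun j => H.Δ j) j ∘ₗ 0 ∘ₗ LinearMap.proj i = 0
    simp
  rw [this, map_zero]

/-- A nonzero element of `Ext¹(Δ_i, Δ_j)` forces `i < j`, in the form `i ≤ j` and `¬ j ≤ i`. -/
theorem lt_of_mem_barComp {i j : P} {x : H.Yoneda} (hx : x ∈ H.barComp 0 i j) (h0 : x ≠ 0) :
    i ≤ j ∧ ¬ j ≤ i := by
  obtain ⟨h1, h2, h3⟩ := H.mem_barComp'.1 hx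
  let ι : ∀ i, H.Δ i ⟶ H.sumΔ := fun i => ModuleCat.ofHom (LinearMap.single Λ (fun j => H.Δ j) i)
  let π : ∀ i, H.sumΔ ⟶ H.Δ i := fun i => ModuleCat.ofHom (LinearMap.proj i)
  have hid : ∀ i, H.idem i = π i ≫ ι i := fun i => rfl
  obtain ⟨y, rfl⟩ : ∃ y, H.extIncl 1 y = x := ⟨_, h3⟩
  refine H.ext_lt i j ⟨((Ext.mk₀ (ι i)).comp y (zero_add 1)).comp (Ext.mk₀ (π j)) (add_zero 1),
    fun hz => h0 ?_⟩
  have hz' := congrArg (fun z => ((Ext.mk₀ (π i)).comp z (zero_add 1)).comp (Ext.mk₀ (ι j))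
    (add_zero 1)) hz
  simp only [Ext.comp_zero, Ext.zero_comp] at hz'
  rw [← h2, ← h1, e, e, ofEnd_apply, ofEnd_apply, H.yonedaMul_extIncl (add_zero 1),
    H.yonedaMul_extIncl (zero_add 1), hid, hid, ← Ext.mk₀_comp_mk₀, ← Ext.mk₀_comp_mk₀]
  refine (congrArg _ ?_).trans (map_zero (H.extIncl 1))
  rw [← hz']
  simp only [Ext.comp_assoc_of_second_deg_zero, Ext.comp_assoc_of_third_deg_zero]

/-! ### The radical -/

theorem ofEnd_conj (i j : P) (f : H.EndΔ) :
    H.ofEnd (H.conj i j f) = H.yonedaMul (H.yonedaMul (H.e j) (H.ofEnd f)) (H.e i) := by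
  change H.ofEnd (H.idem j * f * H.idem i) = _
  rw [ofEnd_mul, ofEnd_mul]
  rfl

theorem radComp_le (i j : P) : H.radComp i j ≤ H.barComp (-1) i j := by
  rintro _ ⟨f, -, rfl⟩
  refine ⟨H.ofEnd f, ?_⟩
  rw [barProj_apply, neg_add_cancel, degProj_zero_ofEnd]
  exact (H.ofEnd_conj i j f).symm

theorem starEnd_radical (i : P) {f : H.EndΔ} (hf : f ∈ H.radical) : H.starEnd i f = 0 := by
  have : H.radical.mkQ f = 0 := by rwa [← LinearMap.mem_ker, Submodule.ker_mkQ]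
  rw [starEnd, LinearMap.comp_apply, this, map_zero]

theorem starEnd_idem (i j : P) : H.starEnd i (H.idem j) = if j = i then 1 else 0 := by
  have : H.radical.mkQ (H.idem j) = H.topBasis j := by simp [topBasis]
  rw [starEnd, LinearMap.comp_apply, this, Module.Basis.coord_apply, Module.Basis.repr_self,
    Finsupp.single_apply]

theorem star_e (i j : P) : H.star i (H.e j) = if j = i then 1 else 0 := by
  rw [star, LinearMap.comp_apply, e, toEnd_ofEnd, starEnd_idem]

theorem star_radComp (l : P) {i j : P} {x : H.Yoneda} (hx : x ∈ H.radComp i j) :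
    H.star l x = 0 := by
  obtain ⟨f, hf, rfl⟩ := hx
  rw [star, LinearMap.comp_apply, LinearMap.comp_apply, toEnd_ofEnd]
  refine H.starEnd_radical l ?_
  exact Ideal.mul_mem_right _ (Ring.jacobson H.EndΔ) (Ideal.mul_mem_left (Ring.jacobson H.EndΔ) _ hf)

/-- `e_j End(Δ) e_i` lies in the radical when `i ≠ j`. -/
theorem mem_radComp_of_ne {i j : P} (hij : i ≠ j) {x : H.Yoneda} (hx : x ∈ H.barComp (-1) i j) :
    x ∈ H.radComp i j := by
  obtain ⟨h1, h2, h3⟩ := H.mem_barComp'.1 hx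
  rw [neg_add_cancel, ← ofEnd_toEnd] at h3
  refine ⟨H.toEnd x - ∑ l, H.starEnd l (H.toEnd x) • H.idem l, H.sub_starEnd_mem _, ?_⟩
  rw [LinearMap.comp_apply, map_sub, map_sub, ofEnd_conj, h3, h1, h2, map_sum, map_sum, sub_eq_self]
  refine Finset.sum_eq_zero fun l _ => ?_
  rw [map_smul, map_smul, ofEnd_conj]
  change _ • H.yonedaMul (H.yonedaMul (H.e j) (H.e l)) (H.e i) = 0
  rw [e_mul_e]
  split_ifs with h
  · subst h
    rw [e_mul_e, if_neg hij, smul_zero]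
  · simp

/-- An element of `e_i End(Δ) e_i` is a scalar modulo the radical. -/
theorem sub_star_smul_mem {i : P} {x : H.Yoneda} (hx : x ∈ H.barComp (-1) i i) :
    x - H.star i x • H.e i ∈ H.radComp i i := by
  obtain ⟨h1, h2, h3⟩ := H.mem_barComp'.1 hx
  rw [neg_add_cancel, ← ofEnd_toEnd] at h3
  refine ⟨H.toEnd x - ∑ l, H.starEnd l (H.toEnd x) • H.idem l, H.sub_starEnd_mem _, ?_⟩
  rw [LinearMap.comp_apply, map_sub, map_sub, ofEnd_conj, h3, h1, h2, map_sum, map_sum]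
  congr 1
  rw [Finset.sum_eq_single i]
  · rw [map_smul, map_smul, ofEnd_conj]
    change _ • H.yonedaMul (H.yonedaMul (H.e i) (H.e i)) (H.e i) = _
    rw [e_mul_e_self, e_mul_e_self]
    rfl
  · intro l _ hl
    rw [map_smul, map_smul, ofEnd_conj]
    change _ • H.yonedaMul (H.yonedaMul (H.e i) (H.e l)) (H.e i) = 0
    rw [e_mul_e, if_neg hl]
    simp
  · simp

theorem star_of_ne {i j : P} (hij : i ≠ j) (l : P) {x : H.Yoneda} (hx : x ∈ H.barComp (-1) i j) :
    H.star l x = 0 :=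
  H.star_radComp l (H.mem_radComp_of_ne hij hx)

theorem radProj_apply (i j : P) (x : H.Yoneda) : (H.radProj i j x : H.Yoneda) =
    H.barProj (-1) i j x - ∑ l, H.star l x • H.barProj (-1) i j (H.e l) := by
  have h : (H.radProj i j x : H.Yoneda) =
      (H.ofEnd ∘ₗ H.conj i j) (H.toEnd x - ∑ l, H.star l x • H.idem l) := by
    change (H.ofEnd ∘ₗ H.conj i j ∘ₗ
      (LinearMap.id - ∑ l, (H.starEnd l).smulRight (H.idem l)) ∘ₗ H.toEnd) x = _
    simp only [LinearMap.comp_apply, LinearMap.sub_apply,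
      LinearMap.sum_apply, LinearMap.smulRight_apply, LinearMap.id_apply, star]
  rw [h, map_sub, map_sum]
  simp only [map_smul, LinearMap.comp_apply, ofEnd_conj, barProj_apply, neg_add_cancel,
    ofEnd_toEnd, e, degProj_zero_ofEnd]

theorem radProj_of_mem {i j : P} {x : H.Yoneda} (hx : x ∈ H.radComp i j) (i' j' : P) :
    (H.radProj i' j' x : H.Yoneda) = if i = i' ∧ j = j' then x else 0 := by
  rw [radProj_apply, H.barProj_of_mem (H.radComp_le _ _ hx)]
  simp [H.star_radComp _ hx]

theorem radProj_e (i' j' l : P) : H.radProj i' j' (H.e l) = 0 := by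
  apply Subtype.ext
  rw [radProj_apply]
  simp [star_e]

end YonedaAlgebra

/-! ### Words in the tensor algebra -/

section Words

variable {k : Type u} [Field k] {Λ : Type u} [Ring Λ] [Algebra k Λ]
  {P : Type u} [Preorder P] [DecidableEq P] [Fintype P] {H : HomologicalSystem k Λ P}
  [IsAlgClosed k] [Module.Finite k Λ] (m : StrictAInfinity H)

/-- The word `a_r a_{r+1} ⋯ a_{r+n-1}` in the tensor algebra. -/
noncomputable def word (a : ℕ → H.Yoneda) (r n : ℕ) : TensorAlgebra k H.Yoneda :=
  ((List.range' r n).map fun q => TensorAlgebra.ι k (a q)).prod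

theorem word_zero (a : ℕ → H.Yoneda) (r : ℕ) : word a r 0 = 1 := rfl

theorem word_succ (a : ℕ → H.Yoneda) (r n : ℕ) :
    word a r (n + 1) = TensorAlgebra.ι k (a r) * word a (r + 1) n := by
  simp [word, List.range'_succ]

theorem word_add (a : ℕ → H.Yoneda) (r n n' : ℕ) :
    word a r (n + n') = word a r n * word a (r + n) n' := by
  simp [word, ← List.range'_append_1]

theorem word_succ' (a : ℕ → H.Yoneda) (r n : ℕ) :
    word a r (n + 1) = word a r n * TensorAlgebra.ι k (a (r + n)) := by
  rw [word_add, word_succ, word_zero, mul_one]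

theorem word_congr {a a' : ℕ → H.Yoneda} {r r' n : ℕ} (h : ∀ q < n, a (r + q) = a' (r' + q)) :
    word a r n = word a' r' n := by
  induction n generalizing r r' with
  | zero => rfl
  | succ n ih =>
    rw [word_succ, word_succ, show a r = a' r' from h 0 (by omega)]
    congr 1
    refine ih fun q hq => ?_
    have := h (q + 1) (by omega)
    rwa [show r + 1 + q = r + (q + 1) by omega, show r' + 1 + q = r' + (q + 1) by omega]

/-- Words span the tensor algebra. -/
theorem linearMap_ext_word {U : Type*} [AddCommGroup U] [Module k U]
    {F G : TensorAlgebra k H.Yoneda →ₗ[k] U} (h : ∀ a n, F (word a 0 n) = G (word a 0 n)) :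
    F = G := by
  have hs : ∀ w : TensorAlgebra k H.Yoneda, w ∈ Submodule.span k {w | ∃ a n, w = word a 0 n} := by
    intro w
    induction w using TensorAlgebra.induction with
    | algebraMap c =>
      rw [Algebra.algebraMap_eq_smul_one]
      exact Submodule.smul_mem _ _ (Submodule.subset_span ⟨0, 0, rfl⟩)
    | ι x =>
      refine Submodule.subset_span ⟨fun _ => x, 1, ?_⟩
      rw [word_succ, word_zero, mul_one]
    | mul x y hx hy =>
      have := Submodule.mul_mem_mul hx hy
      rw [Submodule.span_mul_span] at this
      refine Submodule.span_mono ?_ this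
      rintro _ ⟨_, ⟨a, n, rfl⟩, _, ⟨a', n', rfl⟩, rfl⟩
      refine ⟨fun q => if q < n then a q else a' (q - n), n + n', ?_⟩
      rw [word_add]
      refine congrArg₂ (· * ·) (word_congr fun q hq => ?_) (word_congr fun q hq => ?_)
      · simp [hq]
      · simp
    | add x y hx hy => exact add_mem hx hy
  refine LinearMap.ext fun w => ?_
  refine Submodule.span_induction ?_ ?_ ?_ ?_ (hs w)
  · rintro _ ⟨a, n, rfl⟩; exact h a n
  · rw [map_zero, map_zero]
  · intro x y _ _ hx hy; rw [map_add, map_add, hx, hy]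
  · intro c x _ hx; rw [map_smul, map_smul, hx]

theorem bTotal_ofFn (n : ℕ) (a : Fin n → H.Yoneda) :
    m.bTotal (List.ofFn fun s => TensorAlgebra.ι k (a s)).prod = m.b n a := by
  rw [← TensorAlgebra.tprod_apply, ← TensorPower.toTensorAlgebra_tprod]
  simp only [StrictAInfinity.bTotal, LinearMap.comp_apply, AlgEquiv.toLinearMap_apply]
  have h : TensorAlgebra.equivDirectSum (TensorPower.toTensorAlgebra (PiTensorProduct.tprod k a)) =
      DirectSum.lof k ℕ (fun n => TensorPower k n H.Yoneda) n (PiTensorProduct.tprod k a) := by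
    rw [TensorPower.toTensorAlgebra_tprod]
    exact TensorAlgebra.toDirectSum_tensorPower_tprod a
  rw [h]
  refine (DirectSum.toModule_lof k n _).trans ?_
  rw [PiTensorProduct.lift.tprod]

theorem bTotal_word (a : ℕ → H.Yoneda) (n : ℕ) : m.bTotal (word a 0 n) = m.b n fun q => a q := by
  rw [← bTotal_ofFn, word]
  congr 2
  refine List.ext_getElem (by simp) fun q h1 h2 => ?_
  simp

theorem b_zero : m.b 0 = 0 := by
  ext a
  simp [StrictAInfinity.b, m.m_zero]

theorem bTotal_one : m.bTotal 1 = 0 := by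
  have := bTotal_word m 0 0
  rwa [word_zero, b_zero, zero_apply] at this

theorem bTotal_ι (x : H.Yoneda) : m.bTotal (TensorAlgebra.ι k x) = 0 := by
  have := bTotal_word m (fun _ => x) 1
  rw [word_succ, word_zero, mul_one] at this
  rw [this]
  simp [StrictAInfinity.b, m.m_one]

theorem bTotal_ι_mul_ι (x y : H.Yoneda) :
    m.bTotal (TensorAlgebra.ι k x * TensorAlgebra.ι k y) = H.yonedaMul (H.signInv x) y := by
  have := bTotal_word m (fun q => if q = 0 then x else y) 2
  rw [word_succ, word_succ, word_zero, mul_one] at this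
  refine this.trans ?_
  simp [StrictAInfinity.b, m.m_two]

/-! ### The codifferential of the bar construction -/

/-- Append the letter `x` to the pair `(E w, w)`, where `E` is `prefixB`. The recursion for `E (w x)`
involves both `E w` and `w`, so `E` is obtained from an action of the tensor algebra on such pairs. -/
noncomputable def appendLetter :
    H.Yoneda →ₗ[k] Module.End k (TensorAlgebra k H.Yoneda × TensorAlgebra k H.Yoneda) :=
  LinearMap.mk₂ k (fun x p => (p.1 * TensorAlgebra.ι k x +
      TensorAlgebra.ι k (m.bTotal (p.2 * TensorAlgebra.ι k x)), p.2 * TensorAlgebra.ι k x))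
    (fun x y p => by ext <;> simp [mul_add]; abel)
    (fun c x p => by ext <;> simp)
    (fun x p q => by ext <;> simp [add_mul]; abel)
    (fun c x p => by ext <;> simp)

/-- `x_1 ⋯ x_n ↦ ∑_s b_s(x_1, …, x_s) x_{s+1} ⋯ x_n`. Letters are appended on the right, hence the
opposite algebra. -/
noncomputable def prefixB : TensorAlgebra k H.Yoneda →ₗ[k] TensorAlgebra k H.Yoneda :=
  LinearMap.fst k _ _ ∘ₗ LinearMap.applyₗ (0, 1) ∘ₗ (MulOpposite.opLinearEquiv k).symm.toLinearMap ∘ₗ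
    (TensorAlgebra.lift k ((MulOpposite.opLinearEquiv k).toLinearMap ∘ₗ appendLetter m)).toLinearMap

theorem appendLetter_snd (w : TensorAlgebra k H.Yoneda) : ∀ p,
    ((TensorAlgebra.lift k ((MulOpposite.opLinearEquiv k).toLinearMap ∘ₗ
      appendLetter m) w).unop p).2 = p.2 * w := by
  induction w using TensorAlgebra.induction with
  | algebraMap c => intro p; simp [Algebra.algebraMap_eq_smul_one]
  | ι x => intro p; simp [appendLetter]
  | mul x y hx hy => intro p; rw [map_mul, MulOpposite.unop_mul, Module.End.mul_apply, hy, hx, mul_assoc]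
  | add x y hx hy => intro p; rw [map_add, MulOpposite.unop_add, LinearMap.add_apply, Prod.snd_add, hx, hy,
      mul_add]

theorem prefixB_one : prefixB m 1 = 0 := by
  simp [prefixB]

theorem prefixB_mul_ι (w : TensorAlgebra k H.Yoneda) (x : H.Yoneda) :
    prefixB m (w * TensorAlgebra.ι k x) =
      prefixB m w * TensorAlgebra.ι k x +
        TensorAlgebra.ι k (m.bTotal (w * TensorAlgebra.ι k x)) := by
  have := appendLetter_snd m w (0, 1)
  rw [one_mul] at this
  conv_rhs => enter [2]; rw [← this]
  simp only [prefixB, LinearMap.comp_apply, AlgHom.toLinearMap_apply, map_mul,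
    TensorAlgebra.lift_ι_apply]
  rfl

/-- Prepend the letter `x` to the pair `(D w, w)`, where `D` is `codiff`. The degree of `x` in `B` is
one less than in `A`, so that moving an operation of degree one past `x` gives `-signInv x`. -/
noncomputable def prependLetter :
    H.Yoneda →ₗ[k] Module.End k (TensorAlgebra k H.Yoneda × TensorAlgebra k H.Yoneda) :=
  LinearMap.mk₂ k (fun x p => (-(TensorAlgebra.ι k (H.signInv x) * p.1) +
      prefixB m (TensorAlgebra.ι k x * p.2), TensorAlgebra.ι k x * p.2))
    (fun x y p => by ext <;> simp [add_mul]; abel)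
    (fun c x p => by ext <;> simp)
    (fun x p q => by ext <;> simp [mul_add]; abel)
    (fun c x p => by ext <;> simp)

/-- The codifferential of the bar construction,
`x_1 ⋯ x_n ↦ ∑_{r, s} (-1)^(|x_1| + ⋯ + |x_r|) x_1 ⋯ x_r b_s(x_{r+1}, …, x_{r+s}) x_{r+s+1} ⋯ x_n`, with
degrees taken in `B`. -/
noncomputable def codiff : TensorAlgebra k H.Yoneda →ₗ[k] TensorAlgebra k H.Yoneda :=
  LinearMap.fst k _ _ ∘ₗ LinearMap.applyₗ (0, 1) ∘ₗ
    (TensorAlgebra.lift k (prependLetter m)).toLinearMap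

theorem prependLetter_snd (w : TensorAlgebra k H.Yoneda) : ∀ p,
    (TensorAlgebra.lift k (prependLetter m) w p).2 = w * p.2 := by
  induction w using TensorAlgebra.induction with
  | algebraMap c => intro p; simp [Algebra.algebraMap_eq_smul_one]
  | ι x => intro p; simp [prependLetter]
  | mul x y hx hy => intro p; rw [map_mul, Module.End.mul_apply, hx, hy, mul_assoc]
  | add x y hx hy => intro p; rw [map_add, LinearMap.add_apply, Prod.snd_add, hx, hy, add_mul]

theorem codiff_one : codiff m 1 = 0 := by
  simp [codiff]

theorem codiff_ι_mul (x : H.Yoneda) (w : TensorAlgebra k H.Yoneda) :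
    codiff m (TensorAlgebra.ι k x * w) =
      -(TensorAlgebra.ι k (H.signInv x) * codiff m w) + prefixB m (TensorAlgebra.ι k x * w) := by
  have := prependLetter_snd m w (0, 1)
  rw [mul_one] at this
  conv_rhs => enter [2]; rw [← this]
  simp only [codiff, LinearMap.comp_apply, AlgHom.toLinearMap_apply, map_mul,
    TensorAlgebra.lift_ι_apply]
  rfl

theorem prefixB_word (a : ℕ → H.Yoneda) (r n : ℕ) : prefixB m (word a r n) =
    ∑ s ∈ Finset.range (n + 1),
      TensorAlgebra.ι k (m.bTotal (word a r s)) * word a (r + s) (n - s) := by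
  induction n with
  | zero => simp [word_zero, prefixB_one, bTotal_one]
  | succ n ih =>
    rw [word_succ', prefixB_mul_ι, ih, Finset.sum_range_succ _ (n + 1), ← word_succ', Finset.sum_mul,
      Nat.sub_self, word_zero, mul_one]
    congr 1
    refine Finset.sum_congr rfl fun s hs => ?_
    rw [Finset.mem_range] at hs
    rw [show n + 1 - s = (n - s) + 1 by omega, word_succ', mul_assoc,
      show r + s + (n - s) = r + n by omega]

theorem codiff_word (a : ℕ → H.Yoneda) (r n : ℕ) : codiff m (word a r n) =
    ∑ q ∈ Finset.range (n + 1),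
      word (fun i => -H.signInv (a i)) r q * prefixB m (word a (r + q) (n - q)) := by
  induction n generalizing r with
  | zero => simp [word_zero, codiff_one, prefixB_one]
  | succ n ih =>
    rw [word_succ, codiff_ι_mul, ih, Finset.sum_range_succ' _ (n + 1), ← word_succ, Finset.mul_sum,
      ← Finset.sum_neg_distrib]
    congr 1
    · refine Finset.sum_congr rfl fun q hq => ?_
      rw [word_succ, map_neg, neg_mul, neg_mul, mul_assoc, show n + 1 - (q + 1) = n - q by omega,
        show r + 1 + q = r + (q + 1) by omega]
    · simp [word_zero]

theorem signInv_pow_congr {a b : ℕ} (h : Even (a + b)) : H.signInv ^ a = H.signInv ^ b := by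
  have h2 : H.signInv ^ 2 = 1 := LinearMap.ext fun x => by
    rw [pow_two, Module.End.mul_apply, signInv_signInv]; rfl
  have he : ∀ a, H.signInv ^ a = H.signInv ^ (a % 2) := fun a => by
    conv_lhs => rw [← Nat.div_add_mod a 2, pow_add, pow_mul, h2, one_pow, one_mul]
  rw [he a, he b]
  rw [Nat.even_iff] at h
  congr 1
  omega

/-- As `m_s` has degree `2 - s`, it commutes with the parity operator up to `(-1)^s`. -/
theorem signInv_m (s : ℕ) (c : Fin s → H.Yoneda) :
    H.signInv (m.m s c) = (-1 : k) ^ s • m.m s fun p => H.signInv (c p) := by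
  have : H.signInv.compMultilinearMap (m.m s) =
      (-1 : k) ^ s • (m.m s).compLinearMap fun _ => H.signInv := by
    refine MultilinearMap.directSum_ext fun d => MultilinearMap.ext fun c => ?_
    change H.signInv (m.m s fun p => H.extIncl (d p) (c p)) =
      (-1 : k) ^ s • m.m s fun p => H.signInv (H.extIncl (d p) (c p))
    have h := m.homogeneous s (fun p => d p) (fun p => H.extIncl (d p) (c p)) fun p => by
      rw [degProj_lof, if_pos rfl]
    simp only [signInv_extIncl]
    rw [MultilinearMap.map_smul_univ, Finset.prod_pow_eq_pow_sum, smul_smul, ← pow_add]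
    -- the value of `m_s` is zero if its degree is negative, and otherwise has a degree of known parity
    rcases lt_or_ge ((∑ p, (d p : ℤ)) + 2 - s) 0 with hn | hn
    · have h0 : (m.m s fun p => H.extIncl (d p) (c p)) = 0 := by
        rw [← h, degProj, if_neg (not_le.2 hn), LinearMap.zero_apply]
      rw [h0, map_zero, smul_zero]
    · obtain ⟨N, hN⟩ := Int.eq_ofNat_of_zero_le hn
      rw [hN] at h
      rw [signInv_of_degProj H h]
      congr 1
      refine neg_one_pow_congr ?_
      rw [← Nat.cast_sum] at hN
      rw [Nat.even_iff, Nat.even_iff]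
      omega
  exact congrArg (fun f => f c) this

theorem signInv_pow_m (s t : ℕ) (c : Fin s → H.Yoneda) :
    (H.signInv ^ t) (m.m s c) = (-1 : k) ^ (s * t) • m.m s fun p => (H.signInv ^ t) (c p) := by
  induction t with
  | zero => simp
  | succ t ih =>
    simp only [pow_succ', Module.End.mul_apply]
    rw [ih, map_smul, signInv_m, smul_smul, ← pow_add]
    rfl

/-- A summand of the Stasheff identity, with the signs of the shift in its arguments, is a summand of
`b ∘ codiff`. -/
theorem b_insert (n r s : ℕ) (hr : r ≤ n) (hs : s ≤ n - r) (a : ℕ → H.Yoneda) :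
    m.b (r + 1 + (n - r - s)) (fun q => if (q : ℕ) < r then -H.signInv (a q)
      else if (q : ℕ) = r then m.b s (fun p => a (r + p)) else a (q + s - 1)) =
    (-1 : k) ^ (r + s * (n - r - s)) •
        m.m (r + 1 + (n - r - s)) (fun q =>
          if (q : ℕ) < r then (H.signInv ^ s) ((H.signInv ^ (n - 1 - q)) (a q))
          else if (q : ℕ) = r then m.m s (fun p => (H.signInv ^ (n - 1 - (r + p))) (a (r + p)))
          else (H.signInv ^ (n - 1 - (q + s - 1))) (a (q + s - 1))) := by
  rcases Nat.eq_zero_or_pos s with rfl | hs0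
  · rw [MultilinearMap.map_coord_zero _ ⟨r, by omega⟩, MultilinearMap.map_coord_zero _ ⟨r, by omega⟩,
      smul_zero]
    · simp [m.m_zero]
    · simp [b_zero]
  -- the sign `(-1)^(r + s t)`, where `t = n - r - s`, distributed over the arguments:
  -- `-1` for each of the first `r`, and `(-1)^(s t)` for the inner operation
  have hc : (∏ q : Fin (r + 1 + (n - r - s)), if (q : ℕ) < r then (-1 : k) else
      if (q : ℕ) = r then (-1) ^ (s * (n - r - s)) else 1) = (-1 : k) ^ (r + s * (n - r - s)) := by
    rw [Fin.prod_univ_eq_prod_range (fun q => if q < r then (-1 : k) else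
      if q = r then (-1) ^ (s * (n - r - s)) else 1), Finset.prod_range_add, Finset.prod_range_succ,
      pow_add]
    rw [Finset.prod_congr (g := fun _ => (-1 : k)) rfl,
      Finset.prod_congr (s₁ := Finset.range (n - r - s)) (g := fun _ => (1 : k)) rfl]
    · simp
    · intro q _
      rw [if_neg (by omega), if_neg (by omega)]
    · intro q hq
      rw [if_pos (Finset.mem_range.1 hq)]
  rw [← hc, ← MultilinearMap.map_smul_univ]
  change m.m _ _ = m.m _ _
  congr 1
  funext q
  have hq := q.2
  dsimp only
  split_ifs with h1 h2
  · rw [map_neg, neg_smul, one_smul, ← Module.End.mul_apply, ← Module.End.mul_apply, ← pow_succ,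
      ← pow_add]
    congr 2
    refine signInv_pow_congr ?_
    rw [Nat.even_iff]; omega
  · change (H.signInv ^ _) (m.m s fun p => (H.signInv ^ (s - 1 - (p : ℕ))) _) = _
    rw [signInv_pow_m]
    rw [show r + 1 + (n - r - s) - 1 - (q : ℕ) = n - r - s by omega]
    congr 2
    funext p
    have hp := p.2
    rw [← Module.End.mul_apply, ← pow_add]
    congr 2
    omega
  · rw [one_smul]
    congr 2
    omega

/-- The Stasheff identities: the codifferential squares to zero, in the form `b ∘ codiff = 0`. -/
theorem bTotal_codiff (x : TensorAlgebra k H.Yoneda) : m.bTotal (codiff m x) = 0 := by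
  suffices m.bTotal ∘ₗ codiff m = 0 from LinearMap.congr_fun this x
  refine linearMap_ext_word fun a n => ?_
  rw [LinearMap.comp_apply, codiff_word, LinearMap.zero_apply,
    ← m.stasheff n fun q => (H.signInv ^ (n - 1 - q)) (a q), map_sum]
  refine Finset.sum_congr rfl fun r hr => ?_
  rw [Finset.mem_range] at hr
  rw [prefixB_word, Finset.mul_sum, map_sum, show n + 1 - r = n - r + 1 by omega]
  refine Finset.sum_congr rfl fun s hs => ?_
  rw [Finset.mem_range] at hs
  rw [← b_insert m n r s (by omega) (by omega) a]
  rw [← bTotal_word m (fun q => if q < r then -H.signInv (a q)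
      else if q = r then m.b s (fun p => a (r + p)) else a (q + s - 1)), word_add, word_add, word_succ,
    word_zero, mul_one, ← mul_assoc]
  refine congrArg m.bTotal (congrArg₂ (· * ·) (congrArg₂ (· * ·) ?_ ?_) ?_)
  · exact word_congr (H := H) fun q hq => by simp [hq]
  · congr 1
    simp only [zero_add, lt_irrefl, if_false, if_true]
    rw [← bTotal_word m fun p => a (r + p)]
    congr 1
    exact word_congr (H := H) fun q hq => by simp
  · refine word_congr fun q hq => ?_
    rw [if_neg (by omega), if_neg (by omega)]
    congr 1
    omega

end Words

/-! ### Bimodule properties of the operations -/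

section Paths

variable {k : Type u} [Field k] {Λ : Type u} [Ring Λ] [Algebra k Λ]
  {P : Type u} [Preorder P] [DecidableEq P] [Fintype P] {H : HomologicalSystem k Λ P}
  [IsAlgClosed k] [Module.Finite k Λ] (m : StrictAInfinity H)

theorem signInv_pow_e (n : ℕ) (i : P) : (H.signInv ^ n) (H.e i) = H.e i := by
  induction n with
  | zero => rfl
  | succ n ih => rw [pow_succ, Module.End.mul_apply, signInv_e, ih]

theorem signInv_mul (a b : H.Yoneda) :
    H.signInv (H.yonedaMul a b) = H.yonedaMul (H.signInv a) (H.signInv b) := by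
  induction a using H.yoneda_induction with
  | ha x y hx hy => simp only [map_add, LinearMap.add_apply, hx, hy]
  | hn p a =>
  induction b using H.yoneda_induction with
  | ha x y hx hy => simp only [map_add, hx, hy]
  | hn q b =>
    rw [H.yonedaMul_extIncl rfl, signInv_extIncl, signInv_extIncl, signInv_extIncl, map_smul, map_smul,
      LinearMap.smul_apply, H.yonedaMul_extIncl rfl, smul_smul, pow_add]

theorem signInv_pow_mul (n : ℕ) (a b : H.Yoneda) :
    (H.signInv ^ n) (H.yonedaMul a b) = H.yonedaMul ((H.signInv ^ n) a) ((H.signInv ^ n) b) := by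
  induction n with
  | zero => rfl
  | succ n ih => simp only [pow_succ', Module.End.mul_apply, ih, signInv_mul]

theorem b_e_mul (n : ℕ) (j : P) (a : Fin (n + 1) → H.Yoneda) (h : H.yonedaMul (H.e j) (a 0) = a 0) :
    H.yonedaMul (H.e j) (m.b (n + 1) a) = m.b (n + 1) a := by
  refine (m.left_linear n j _).symm.trans ?_
  change m.m (n + 1) _ = m.m (n + 1) _
  congr 1
  rw [Function.update_eq_self_iff]
  dsimp only
  conv_lhs => rw [← H.signInv_pow_e (n + 1 - 1 - ((0 : Fin (n + 1)) : ℕ)) j, ← signInv_pow_mul, h]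

theorem b_mul_e (n : ℕ) (i : P) (a : Fin (n + 1) → H.Yoneda)
    (h : H.yonedaMul (a (Fin.last n)) (H.e i) = a (Fin.last n)) :
    H.yonedaMul (m.b (n + 1) a) (H.e i) = m.b (n + 1) a := by
  refine (m.right_linear n i _).symm.trans ?_
  change m.m (n + 1) _ = m.m (n + 1) _
  congr 1
  rw [Function.update_eq_self_iff]
  dsimp only
  conv_lhs => rw [← H.signInv_pow_e (n + 1 - 1 - ((Fin.last n : Fin (n + 1)) : ℕ)) i, ← signInv_pow_mul, h]

/-- `b_n` vanishes on words which are not composable. -/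
theorem b_eq_zero_of_ne (n q : ℕ) (hq : q + 1 < n) {i j : P} (hij : i ≠ j) (a : Fin n → H.Yoneda)
    (h : H.yonedaMul (a ⟨q, by omega⟩) (H.e i) = a ⟨q, by omega⟩)
    (h' : H.yonedaMul (H.e j) (a ⟨q + 1, hq⟩) = a ⟨q + 1, hq⟩) : m.b n a = 0 := by
  have := m.balanced n q hq i fun s => (H.signInv ^ (n - 1 - (s : ℕ))) (a s)
  rw [Function.update_eq_self_iff.2] at this
  · refine this.trans (MultilinearMap.map_coord_zero _ ⟨q + 1, hq⟩ ?_)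
    rw [Function.update_self, ← h', signInv_pow_mul, signInv_pow_e, ← yonedaMul_assoc, e_mul_e,
      if_neg hij.symm, map_zero, LinearMap.zero_apply]
  · conv_lhs => rw [← H.signInv_pow_e (n - 1 - q) i, ← signInv_pow_mul, h]

theorem degProj_b_of_degProj (n : ℕ) (d : Fin n → ℤ) (a : Fin n → H.Yoneda)
    (h : ∀ s, H.degProj (d s) (a s) = a s) :
    H.degProj ((∑ s, d s) + 2 - n) (m.b n a) = m.b n a :=
  m.homogeneous n d _ fun s => degProj_signInv _ _ _ (h s)

/-- The `e_i` are strict units: `b_n` with `n ≥ 3` vanishes on words which contain one of them. -/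
theorem bTotal_word_e {a : ℕ → H.Yoneda} {n q : ℕ} (hn : 3 ≤ n) (hq : q < n) {i : P}
    (ha : a q = H.e i) : m.bTotal (word a 0 n) = 0 := by
  rw [bTotal_word]
  refine m.strict_unit n hn _ ⟨q, hq⟩ i ?_
  change (H.signInv ^ _) (a q) = _
  rw [ha, signInv_pow_e]

theorem bTotal_word_mul_e_mul_word (a a' : ℕ → H.Yoneda) (n n' : ℕ) (hn : 2 ≤ n + n') (i : P) :
    m.bTotal (word a 0 n * TensorAlgebra.ι k (H.e i) * word a' 0 n') = 0 := by
  rw [← bTotal_word_e m (a := fun q => if q < n then a q else if q = n then H.e i else a' (q - (n + 1)))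
    (n := n + 1 + n') (q := n) (i := i) (by omega) (by omega) (by simp), word_add, word_succ']
  congr 1
  refine congrArg₂ (· * ·) (congrArg₂ (· * ·) ?_ ?_) ?_
  · exact word_congr (H := H) fun q hq => by simp [hq]
  · simp
  · refine word_congr fun q hq => ?_
    rw [if_neg (by omega), if_neg (by omega)]
    congr 1
    omega

/-! ### Composable words -/

/-- Composable words from `i` to `j`, of total degree `n`, in elements of degree `-1` and `0` of `B`. -/
inductive IsPath (H : HomologicalSystem k Λ P) : ℤ → P → P → TensorAlgebra k H.Yoneda → Prop
  | nil (i : P) : IsPath H 0 i i 1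
  | cons {n d : ℤ} {i l j : P} {x : H.Yoneda} {w : TensorAlgebra k H.Yoneda}
    (hd : d = -1 ∨ d = 0) (hx : x ∈ H.barComp d l j) (hw : IsPath H n i l w) :
    IsPath H (d + n) i j (TensorAlgebra.ι k x * w)

theorem IsPath.mul {n n' : ℤ} {i l j : P} {w w' : TensorAlgebra k H.Yoneda} (hw : H.IsPath n l j w)
    (hw' : H.IsPath n' i l w') : H.IsPath (n + n') i j (w * w') := by
  induction hw with
  | nil i => rwa [zero_add, one_mul]
  | cons hd hx _ ih =>
    rw [mul_assoc, add_assoc]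
    exact .cons hd hx (ih hw')

/-- Nonzero letters of degree `-1` and `0` do not decrease the index. -/
theorem IsPath.eq_zero_or_le {n : ℤ} {i j : P} {w : TensorAlgebra k H.Yoneda}
    (hw : H.IsPath n i j w) : w = 0 ∨ i ≤ j := by
  induction hw with
  | nil i => exact .inr le_rfl
  | @cons n d i l j x w hd hx _ ih =>
    rcases ih with rfl | h
    · exact .inl (mul_zero _)
    by_cases h0 : x = 0
    · exact .inl (by rw [h0, map_zero, zero_mul])
    right
    rcases hd with rfl | rfl
    · exact h.trans (H.le_of_mem_barComp hx h0)
    · exact h.trans (H.lt_of_mem_barComp hx h0).1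

/-- A path as a word in homogeneous letters. Degrees of letters are taken in `A`, hence the summand `N`
in their sum. -/
theorem IsPath.exists_word {n : ℤ} {i j : P} {w : TensorAlgebra k H.Yoneda} (hw : H.IsPath n i j w) :
    ∃ (a : ℕ → H.Yoneda) (N : ℕ) (d : ℕ → ℤ), w = word a 0 N ∧ (∀ q, H.degProj (d q) (a q) = a q) ∧
      ∑ q ∈ Finset.range N, d q = n + N ∧ (N = 0 → i = j) ∧
      (N ≠ 0 → H.yonedaMul (H.e j) (a 0) = a 0 ∧ H.yonedaMul (a (N - 1)) (H.e i) = a (N - 1)) := by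
  induction hw with
  | nil i => exact ⟨0, 0, 0, rfl, by simp, by simp, by simp, by simp⟩
  | @cons n d i l j x w hd hx _ ih =>
    obtain ⟨a, N, d', rfl, h1, h2, h3, h4⟩ := ih
    obtain ⟨hx1, hx2, hx3⟩ := H.mem_barComp'.1 hx
    refine ⟨fun q => if q = 0 then x else a (q - 1), N + 1, fun q => if q = 0 then d + 1 else d' (q - 1),
      ?_, ?_, ?_, ?_, ?_⟩
    · rw [word_succ]
      exact congrArg₂ (· * ·) rfl (word_congr fun q _ => by simp)
    · intro q
      dsimp only
      split_ifs
      · exact hx3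
      · exact h1 _
    · rw [Finset.sum_range_succ']
      simp [h2]
      ring
    · simp
    · intro _
      refine ⟨by simpa using hx1, ?_⟩
      rcases Nat.eq_zero_or_pos N with rfl | hN
      · obtain rfl := h3 rfl
        simpa using hx2
      · simpa [hN.ne'] using (h4 hN.ne').2

theorem IsPath.bTotal_mem {n : ℤ} {i j : P} {w : TensorAlgebra k H.Yoneda} (hw : H.IsPath n i j w) :
    m.bTotal w ∈ H.barComp (n + 1) i j := by
  obtain ⟨a, N, d, rfl, h1, h2, h3, h4⟩ := hw.exists_word
  rcases N with _ | N
  · rw [word_zero, bTotal_one]; exact zero_mem _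
  obtain ⟨h5, h6⟩ := h4 (by omega)
  rw [bTotal_word, mem_barComp']
  refine ⟨b_e_mul m _ _ _ h5, b_mul_e m _ _ _ h6, ?_⟩
  have := degProj_b_of_degProj m (N + 1) (fun q => d q) (fun q => a q) fun q => h1 q
  rw [Fin.sum_univ_eq_sum_range d, h2] at this
  rwa [show n + 1 + 1 = n + ((N + 1 : ℕ) : ℤ) + 2 - ((N + 1 : ℕ) : ℤ) by ring]

/-! ### Words in the letters -/

/-- The number of elements strictly below `i`; a strictly monotone function on the preorder `P`. -/
noncomputable def height (i : P) : ℕ := by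
  classical exact (Finset.univ.filter fun l : P => l < i).card

theorem height_lt_card (i : P) : height i < Fintype.card P := by
  classical
  refine Finset.card_lt_univ_of_notMem (x := i) ?_
  simp

theorem height_mono {i j : P} (h : i ≤ j) : height i ≤ height j := by
  classical
  refine Finset.card_le_card fun l hl => ?_
  simp only [Finset.mem_filter, Finset.mem_univ, true_and] at hl ⊢
  exact hl.trans_le h

theorem height_strictMono {i j : P} (h : i < j) : height i < height j := by
  classical
  refine Finset.card_lt_card (Finset.ssubset_iff_subset_ne.2 ⟨fun l hl => ?_, fun he => ?_⟩)
  · simp only [Finset.mem_filter, Finset.mem_univ, true_and] at hl ⊢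
    exact hl.trans h
  · have : i ∈ Finset.univ.filter fun l : P => l < j := by simpa using h
    rw [← he] at this
    simp at this

noncomputable instance : Fintype H.Letter₀ := by
  have (p : P × P) : Finite (Module.Basis.ofVectorSpaceIndex k (H.barComp 0 p.1 p.2)) :=
    Module.Finite.finite_basis (Module.Basis.ofVectorSpace k _)
  exact Fintype.ofFinite _

noncomputable instance : Fintype H.LetterJ := by
  have (p : P × P) : Finite (Module.Basis.ofVectorSpaceIndex k (H.radComp p.1 p.2)) :=
    Module.Finite.finite_basis (Module.Basis.ofVectorSpace k _)
  exact Fintype.ofFinite _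

/-- The source `i` and the target `j` of a letter in `e_j B e_i`. -/
def ends : H.Letter₀ ⊕ H.LetterJ → P × P := Sum.elim Sigma.fst Sigma.fst

theorem val₀_mem (x : H.Letter₀) : H.val₀ x ∈ H.barComp 0 x.1.1 x.1.2 := Subtype.property _

theorem valJ_mem (x : H.LetterJ) : H.valJ x ∈ H.radComp x.1.1 x.1.2 := Subtype.property _

theorem val₀_ne_zero (x : H.Letter₀) : H.val₀ x ≠ 0 := fun h =>
  (Module.Basis.ofVectorSpace k (H.barComp 0 x.1.1 x.1.2)).ne_zero x.2 (Subtype.ext h)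

theorem valJ_ne_zero (x : H.LetterJ) : H.valJ x ≠ 0 := fun h =>
  (Module.Basis.ofVectorSpace k (H.radComp x.1.1 x.1.2)).ne_zero x.2 (Subtype.ext h)

theorem letter_mem (x : H.Letter₀ ⊕ H.LetterJ) :
    Sum.elim H.val₀ H.valJ x ∈ H.barComp (letterDeg x - 1) (ends x).1 (ends x).2 := by
  rcases x with x | x
  · exact H.val₀_mem x
  · exact H.radComp_le _ _ (H.valJ_mem x)

theorem height_add_letterDeg_le (x : H.Letter₀ ⊕ H.LetterJ) :
    (height (ends x).1 : ℤ) + letterDeg x ≤ height (ends x).2 := by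
  rcases x with x | x
  · have h := H.lt_of_mem_barComp (H.val₀_mem x) (H.val₀_ne_zero x)
    have := height_strictMono (lt_of_le_not_ge h.1 h.2)
    simp only [ends, letterDeg, Sum.elim_inl]
    omega
  · have h := H.le_of_mem_barComp (H.radComp_le _ _ (H.valJ_mem x)) (H.valJ_ne_zero x)
    have := height_mono h
    simp only [ends, letterDeg, Sum.elim_inr]
    omega

theorem sum_letterDeg_le (n : ℕ) (x : Fin (n + 1) → H.Letter₀ ⊕ H.LetterJ)
    (hx : ∀ q : Fin n, (ends (x q.castSucc)).1 = (ends (x q.succ)).2) :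
    ∑ q, letterDeg (x q) ≤ height (ends (x 0)).2 - (height (ends (x (Fin.last n))).1 : ℤ) := by
  induction n with
  | zero =>
    have := height_add_letterDeg_le (x 0)
    simp only [Fin.sum_univ_succ, Fin.sum_univ_zero, Fin.last_zero]
    omega
  | succ n ih =>
    rw [Fin.sum_univ_succ]
    have h1 := ih (fun q => x q.succ) fun q => by simpa using hx q.succ
    have h2 := height_add_letterDeg_le (x 0)
    have h3 := hx 0
    rw [Fin.succ_last] at h1
    change _ ≤ _ - (height (ends (x (Fin.last (n + 1)))).1 : ℤ) at h1
    rw [Fin.castSucc_zero] at h3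
    rw [← h3] at h1
    omega

/-- A nonzero value of `b_n` on letters has a composable argument, in which the letters from `B_0`
raise the height; as these are fewer than `|P|` and the value has degree at least `-1` in `B`, the
number of letters is bounded. -/
theorem b_letters_eq_zero {n : ℕ} (hn : Fintype.card P + 2 ≤ n) (x : Fin n → H.Letter₀ ⊕ H.LetterJ) :
    m.b n (fun s => Sum.elim H.val₀ H.valJ (x s)) = 0 := by
  obtain ⟨n, rfl⟩ : ∃ n', n = n' + 1 := ⟨n - 1, by omega⟩
  by_cases hx : ∀ q : Fin n, (ends (x q.castSucc)).1 = (ends (x q.succ)).2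
  · rw [← degProj_b, degProj, if_neg, LinearMap.zero_apply]
    have h1 := sum_letterDeg_le n x hx
    have h2 := height_lt_card (ends (x 0)).2
    push_cast
    omega
  · push Not at hx
    obtain ⟨q, hq⟩ := hx
    refine b_eq_zero_of_ne m (n + 1) q (by omega) hq _ ?_ ?_
    · exact (H.mem_barComp'.1 (letter_mem (x q.castSucc))).2.1
    · exact (H.mem_barComp'.1 (letter_mem (x q.succ))).1

end Paths

/-! ### Words with coefficients in `Hom_k(X, Y)` -/

section Calculus

variable {k : Type u} [Field k] {Λ : Type u} [Ring Λ] [Algebra k Λ]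
  {P : Type u} [Preorder P] [DecidableEq P] [Fintype P] {H : HomologicalSystem k Λ P}
  [IsAlgClosed k] [Module.Finite k Λ] (m : StrictAInfinity H)
  {X Y Z U : SMod.{u, w} k P}

local notation:70 F:71 " ⊙ " G:70 => HomologicalSystem.compT _ _ _ _ F G

theorem compT_tmul (f : Y.carrier →ₗ[k] Z.carrier) (g : X.carrier →ₗ[k] Y.carrier)
    (v w : TensorAlgebra k H.Yoneda) :
    H.compT X Y Z (f ⊗ₜ[k] v) (g ⊗ₜ[k] w) = (f ∘ₗ g) ⊗ₜ[k] (v * w) := rfl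

theorem toHomT_tmul (f : X.carrier →ₗ[k] Y.carrier) (x : H.Yoneda) :
    H.toHomT X Y (f ⊗ₜ[k] x) = f ⊗ₜ[k] TensorAlgebra.ι k x := rfl

theorem bad_tmul (f : X.carrier →ₗ[k] Y.carrier) (w : TensorAlgebra k H.Yoneda) :
    bad m (X := X) (Y := Y) (f ⊗ₜ[k] w) = f ⊗ₜ[k] m.bTotal w := rfl

theorem compT_assoc (F : H.HomT Z U) (G : H.HomT Y Z) (K : H.HomT X Y) :
    (F ⊙ G) ⊙ K = F ⊙ (G ⊙ K) := by
  induction F using TensorProduct.induction_on with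
  | zero => simp only [map_zero, LinearMap.zero_apply]
  | add F F' hF hF' => simp only [map_add, LinearMap.add_apply, hF, hF']
  | tmul f u =>
  induction G using TensorProduct.induction_on with
  | zero => simp only [map_zero, LinearMap.zero_apply]
  | add F F' hF hF' => simp only [map_add, LinearMap.add_apply, hF, hF']
  | tmul g v =>
  induction K using TensorProduct.induction_on with
  | zero => simp only [map_zero]
  | add F F' hF hF' => simp only [map_add, hF, hF']
  | tmul h w => simp only [compT_tmul, mul_assoc, LinearMap.comp_assoc]

variable (H X) in
/-- The identity of `X` in `Hom_k(X, X) ⊗ T_k(A)`. -/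
noncomputable def oneT : H.HomT X X := LinearMap.id ⊗ₜ[k] 1

theorem oneT_compT (F : H.HomT X Y) : oneT H Y ⊙ F = F := by
  induction F using TensorProduct.induction_on with
  | zero => simp only [map_zero]
  | add F F' hF hF' => simp only [map_add, hF, hF']
  | tmul f u => rw [oneT, compT_tmul, one_mul, LinearMap.id_comp]

theorem compT_oneT (F : H.HomT X Y) : F ⊙ oneT H X = F := by
  induction F using TensorProduct.induction_on with
  | zero => simp only [map_zero, LinearMap.zero_apply]
  | add F F' hF hF' => simp only [map_add, LinearMap.add_apply, hF, hF']
  | tmul f u => rw [oneT, compT_tmul, mul_one, LinearMap.comp_id]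

theorem mul_eq_compT (F G : Module.End k X.carrier ⊗[k] TensorAlgebra k H.Yoneda) :
    F * G = H.compT X X X F G := by
  induction F using TensorProduct.induction_on with
  | zero => rw [zero_mul]; exact (LinearMap.map_zero₂ (H.compT X X X) G).symm
  | add F F' hF hF' => rw [add_mul, hF, hF']; exact (LinearMap.map_add₂ (H.compT X X X) F F' G).symm
  | tmul f u =>
  induction G using TensorProduct.induction_on with
  | zero => rw [mul_zero]; exact (map_zero (H.compT X X X _)).symm
  | add F F' hF hF' => rw [mul_add, hF, hF']; exact (map_add (H.compT X X X _) F F').symm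
  | tmul g v => rw [Algebra.TensorProduct.tmul_mul_tmul]; rfl

theorem one_eq_oneT : (1 : Module.End k X.carrier ⊗[k] TensorAlgebra k H.Yoneda) = oneT H X := rfl

/-! ### Degrees -/

variable (H X Y) in
/-- The elements of `Hom_k(X, Y) ⊗ T_k(A)` which are sums of composable words of total degree `n`. -/
noncomputable def adT (n : ℤ) : Submodule k (H.HomT X Y) :=
  Submodule.span k {F | ∃ (i j : P) (f : X.carrier →ₗ[k] Y.carrier) (v : TensorAlgebra k H.Yoneda),
    Y.proj j ∘ₗ f ∘ₗ X.proj i = f ∧ H.IsPath n i j v ∧ F = f ⊗ₜ[k] v}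

variable (H X Y) in
/-- The part of `adT` spanned by the words from some `i` to some `j` strictly above `i`. -/
noncomputable def adS (n : ℤ) : Submodule k (H.HomT X Y) :=
  Submodule.span k {F | ∃ (i j : P) (f : X.carrier →ₗ[k] Y.carrier) (v : TensorAlgebra k H.Yoneda),
    Y.proj j ∘ₗ f ∘ₗ X.proj i = f ∧ H.IsPath n i j v ∧ (i ≤ j ∧ ¬ j ≤ i) ∧ F = f ⊗ₜ[k] v}

theorem proj_comp_proj (i j : P) :
    X.proj j ∘ₗ X.proj i = if i = j then X.proj i else 0 := by
  split_ifs with h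
  · subst h
    exact X.proj_complete.idem i
  · exact X.proj_complete.ortho (Ne.symm h)

theorem sum_proj : ∑ i, X.proj i = LinearMap.id := X.proj_complete.complete

theorem proj_comp_corner {i j : P} {f : X.carrier →ₗ[k] Y.carrier}
    (hf : Y.proj j ∘ₗ f ∘ₗ X.proj i = f) (l : P) :
    Y.proj l ∘ₗ f = if j = l then f else 0 := by
  rw [← hf, ← LinearMap.comp_assoc, proj_comp_proj]
  split_ifs <;> simp

theorem corner_comp_proj {i j : P} {f : X.carrier →ₗ[k] Y.carrier}
    (hf : Y.proj j ∘ₗ f ∘ₗ X.proj i = f) (l : P) :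
    f ∘ₗ X.proj l = if l = i then f else 0 := by
  rw [← hf, LinearMap.comp_assoc, LinearMap.comp_assoc, proj_comp_proj]
  split_ifs with h
  · subst h; rfl
  · simp

theorem corner_comp_corner {i j i' j' : P} {f : Y.carrier →ₗ[k] Z.carrier}
    {g : X.carrier →ₗ[k] Y.carrier} (hf : Z.proj j ∘ₗ f ∘ₗ Y.proj i = f)
    (hg : Y.proj j' ∘ₗ g ∘ₗ X.proj i' = g) (h : j' ≠ i) : f ∘ₗ g = 0 := by
  rw [← hf, ← hg, LinearMap.comp_assoc, LinearMap.comp_assoc, ← LinearMap.comp_assoc _ (Y.proj j'),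
    proj_comp_proj, if_neg h]
  simp

theorem corner_comp {i j l : P} {f : Y.carrier →ₗ[k] Z.carrier}
    {g : X.carrier →ₗ[k] Y.carrier} (hf : Z.proj j ∘ₗ f ∘ₗ Y.proj l = f)
    (hg : Y.proj l ∘ₗ g ∘ₗ X.proj i = g) : Z.proj j ∘ₗ (f ∘ₗ g) ∘ₗ X.proj i = f ∘ₗ g := by
  have h1 := proj_comp_corner hf j
  have h2 := corner_comp_proj hg i
  rw [if_pos rfl] at h1 h2
  rw [LinearMap.comp_assoc, h2, ← LinearMap.comp_assoc, h1]

theorem compT_mem_span {r : Set (H.HomT X Z)} {s : Set (H.HomT Y Z)} {t : Set (H.HomT X Y)}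
    (h : ∀ F ∈ s, ∀ G ∈ t, F ⊙ G ∈ Submodule.span k r) {F : H.HomT Y Z} {G : H.HomT X Y}
    (hF : F ∈ Submodule.span k s) (hG : G ∈ Submodule.span k t) : F ⊙ G ∈ Submodule.span k r := by
  induction hF using Submodule.span_induction with
  | zero => rw [map_zero]; exact zero_mem _
  | add F F' _ _ hF hF' => rw [map_add]; exact add_mem hF hF'
  | smul c F _ hF => rw [map_smul]; exact Submodule.smul_mem _ _ hF
  | mem F hF =>
  induction hG using Submodule.span_induction with
  | zero => rw [map_zero]; exact zero_mem _
  | add F F' _ _ hF hF' => rw [map_add]; exact add_mem hF hF'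
  | smul c F _ hF => rw [map_smul]; exact Submodule.smul_mem _ _ hF
  | mem G hG => exact h F hF G hG

theorem compT_mem_adT {n n' : ℤ} {F : H.HomT Y Z} {G : H.HomT X Y} (hF : F ∈ adT H Y Z n)
    (hG : G ∈ adT H X Y n') : F ⊙ G ∈ adT H X Z (n + n') := by
  refine compT_mem_span ?_ hF hG
  rintro _ ⟨i, j, f, v, hf, hv, rfl⟩ _ ⟨i', j', f', v', hf', hv', rfl⟩
  rw [compT_tmul]
  by_cases h : j' = i
  · subst h
    exact Submodule.subset_span ⟨_, _, _, _, corner_comp hf hf', hv.mul hv', rfl⟩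
  · rw [corner_comp_corner hf hf' h, TensorProduct.zero_tmul]
    exact zero_mem _

theorem compT_mem_adS {n n' : ℤ} {F : H.HomT Y Z} {G : H.HomT X Y} (hF : F ∈ adT H Y Z n)
    (hG : G ∈ adS H X Y n') : F ⊙ G ∈ adS H X Z (n + n') := by
  refine compT_mem_span ?_ hF hG
  rintro _ ⟨i, j, f, v, hf, hv, rfl⟩ _ ⟨i', j', f', v', hf', hv', hlt, rfl⟩
  rw [compT_tmul]
  by_cases h : j' = i
  · subst h
    rcases hv.eq_zero_or_le with rfl | hle
    · rw [zero_mul, TensorProduct.tmul_zero]; exact zero_mem _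
    · exact Submodule.subset_span ⟨_, _, _, _, corner_comp hf hf', hv.mul hv',
        ⟨hlt.1.trans hle, fun h => hlt.2 (hle.trans h)⟩, rfl⟩
  · rw [corner_comp_corner hf hf' h, TensorProduct.zero_tmul]
    exact zero_mem _

theorem compT_mem_adS' {n n' : ℤ} {F : H.HomT Y Z} {G : H.HomT X Y} (hF : F ∈ adS H Y Z n)
    (hG : G ∈ adT H X Y n') : F ⊙ G ∈ adS H X Z (n + n') := by
  refine compT_mem_span ?_ hF hG
  rintro _ ⟨i, j, f, v, hf, hv, hlt, rfl⟩ _ ⟨i', j', f', v', hf', hv', rfl⟩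
  rw [compT_tmul]
  by_cases h : j' = i
  · subst h
    rcases hv'.eq_zero_or_le with rfl | hle
    · rw [mul_zero, TensorProduct.tmul_zero]; exact zero_mem _
    · exact Submodule.subset_span ⟨_, _, _, _, corner_comp hf hf', hv.mul hv',
        ⟨hle.trans hlt.1, fun h => hlt.2 (h.trans hle)⟩, rfl⟩
  · rw [corner_comp_corner hf hf' h, TensorProduct.zero_tmul]
    exact zero_mem _

theorem oneT_mem : oneT H X ∈ adT H X X 0 := by
  rw [oneT, ← sum_proj, TensorProduct.sum_tmul]
  refine Submodule.sum_mem _ fun i _ => Submodule.subset_span ⟨i, i, _, _, ?_, .nil i, rfl⟩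
  rw [proj_comp_proj, if_pos rfl, proj_comp_proj, if_pos rfl]

theorem toHomT_mem {n : ℤ} (hn : n = -1 ∨ n = 0) {t : H.HomA X Y} (ht : t ∈ H.ad X Y n) :
    H.toHomT X Y t ∈ adT H X Y n := by
  induction ht using Submodule.span_induction with
  | zero => rw [map_zero]; exact zero_mem _
  | add F F' _ _ hF hF' => rw [map_add]; exact add_mem hF hF'
  | smul c F _ hF => rw [map_smul]; exact Submodule.smul_mem _ _ hF
  | mem F hF =>
    obtain ⟨i, j, f, x, hf, hx, rfl⟩ := hF
    refine Submodule.subset_span ⟨i, j, f, _, hf, ?_, toHomT_tmul f x⟩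
    have := IsPath.cons hn hx (.nil i)
    rwa [mul_one, add_zero] at this

theorem toHomT_mem_adS {t : H.HomA X Y} (ht : t ∈ H.ad X Y 0) : H.toHomT X Y t ∈ adS H X Y 0 := by
  induction ht using Submodule.span_induction with
  | zero => rw [map_zero]; exact zero_mem _
  | add F F' _ _ hF hF' => rw [map_add]; exact add_mem hF hF'
  | smul c F _ hF => rw [map_smul]; exact Submodule.smul_mem _ _ hF
  | mem F hF =>
    obtain ⟨i, j, f, x, hf, hx, rfl⟩ := hF
    by_cases h0 : x = 0
    · rw [h0, TensorProduct.tmul_zero, map_zero]; exact zero_mem _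
    refine Submodule.subset_span ⟨i, j, f, _, hf, ?_, H.lt_of_mem_barComp hx h0, toHomT_tmul f x⟩
    have := IsPath.cons (.inr rfl) hx (.nil i)
    rwa [mul_one, add_zero] at this

theorem bad_mem {n : ℤ} {F : H.HomT X Y} (hF : F ∈ adT H X Y n) : bad m F ∈ H.ad X Y (n + 1) := by
  induction hF using Submodule.span_induction with
  | zero => rw [map_zero]; exact zero_mem _
  | add F F' _ _ hF hF' => rw [map_add]; exact add_mem hF hF'
  | smul c F _ hF => rw [map_smul]; exact Submodule.smul_mem _ _ hF
  | mem F hF =>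
    obtain ⟨i, j, f, v, hf, hv, rfl⟩ := hF
    exact Submodule.subset_span ⟨i, j, f, _, hf, hv.bTotal_mem m, bad_tmul m f v⟩

/-- `ad(B)(X, Y)_n = 0` for `n < -1`. -/
theorem ad_eq_bot {n : ℤ} (hn : n < -1) : H.ad X Y n = ⊥ := by
  rw [ad, Submodule.span_eq_bot]
  rintro _ ⟨i, j, f, x, -, hx, rfl⟩
  rw [H.barComp_eq_bot hn, Submodule.mem_bot] at hx
  rw [hx, TensorProduct.tmul_zero]

/-! ### The codifferential with coefficients -/

variable (X Y) in
/-- `id ⊗ signInv`. -/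
noncomputable def hatSign : H.HomA X Y →ₗ[k] H.HomA X Y := LinearMap.lTensor _ H.signInv

/-- `id ⊗ prefixB`, written `E` below. -/
noncomputable def hatE : H.HomT X Y →ₗ[k] H.HomT X Y := LinearMap.lTensor _ (prefixB m)

/-- `id ⊗ codiff`, written `D` below. -/
noncomputable def hatD : H.HomT X Y →ₗ[k] H.HomT X Y := LinearMap.lTensor _ (codiff m)

theorem hatSign_of_mem {n : ℕ} {t : H.HomA X Y} (ht : t ∈ H.ad X Y ((n : ℤ) - 1)) :
    hatSign X Y t = (-1 : k) ^ n • t := by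
  induction ht using Submodule.span_induction with
  | zero => rw [map_zero, smul_zero]
  | add F F' _ _ hF hF' => rw [map_add, smul_add, hF, hF']
  | smul c F _ hF => rw [map_smul, hF, smul_comm]
  | mem F hF =>
    obtain ⟨i, j, f, x, hf, hx, rfl⟩ := hF
    have := (H.mem_barComp'.1 hx).2.2
    rw [sub_add_cancel] at this
    rw [hatSign, LinearMap.lTensor_tmul, H.signInv_of_degProj this, TensorProduct.tmul_smul]

/-- The Stasheff identities with coefficients. -/
theorem bad_hatD (F : H.HomT X Y) : bad m (hatD m F) = 0 := by
  induction F using TensorProduct.induction_on with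
  | zero => simp only [map_zero]
  | add F F' hF hF' => simp only [map_add, hF, hF', add_zero]
  | tmul f u => rw [hatD, LinearMap.lTensor_tmul, bad_tmul, bTotal_codiff, TensorProduct.tmul_zero]

theorem hatE_oneT : hatE m (oneT H X) = 0 := by
  rw [hatE, oneT, LinearMap.lTensor_tmul, prefixB_one, TensorProduct.tmul_zero]

theorem hatD_oneT : hatD m (oneT H X) = 0 := by
  rw [hatD, oneT, LinearMap.lTensor_tmul, codiff_one, TensorProduct.tmul_zero]

theorem bad_oneT : bad m (oneT H X) = 0 := by
  rw [oneT, bad_tmul, bTotal_one, TensorProduct.tmul_zero]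

theorem bad_toHomT (t : H.HomA X Y) : bad m (H.toHomT X Y t) = 0 := by
  induction t using TensorProduct.induction_on with
  | zero => simp only [map_zero]
  | add F F' hF hF' => simp only [map_add, hF, hF', add_zero]
  | tmul f u => rw [toHomT_tmul, bad_tmul, bTotal_ι, TensorProduct.tmul_zero]

theorem hatE_compT_toHomT (F : H.HomT Y Z) (t : H.HomA X Y) :
    hatE m (F ⊙ H.toHomT X Y t) =
      hatE m F ⊙ H.toHomT X Y t + H.toHomT X Z (bad m (F ⊙ H.toHomT X Y t)) := by
  induction F using TensorProduct.induction_on with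
  | zero => simp only [map_zero, LinearMap.zero_apply, add_zero]
  | add F F' hF hF' => simp only [map_add, LinearMap.add_apply, hF, hF']; abel
  | tmul f u =>
  induction t using TensorProduct.induction_on with
  | zero => simp only [map_zero, add_zero]
  | add F F' hF hF' => simp only [map_add, hF, hF']; abel
  | tmul g x =>
    rw [toHomT_tmul, hatE, hatE, LinearMap.lTensor_tmul, compT_tmul, compT_tmul, LinearMap.lTensor_tmul,
      bad_tmul, toHomT_tmul, prefixB_mul_ι, TensorProduct.tmul_add]

theorem hatD_toHomT_compT (t : H.HomA Y Z) (F : H.HomT X Y) :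
    hatD m (H.toHomT Y Z t ⊙ F) =
      -(H.toHomT Y Z (hatSign Y Z t) ⊙ hatD m F) + hatE m (H.toHomT Y Z t ⊙ F) := by
  induction F using TensorProduct.induction_on with
  | zero => simp only [map_zero, neg_zero, add_zero]
  | add F F' hF hF' => simp only [map_add, hF, hF']; abel
  | tmul f u =>
  induction t using TensorProduct.induction_on with
  | zero => simp only [map_zero, LinearMap.zero_apply, neg_zero, add_zero]
  | add F F' hF hF' => simp only [map_add, LinearMap.add_apply, hF, hF']; abel
  | tmul g x =>
    rw [toHomT_tmul, hatD, hatE, hatD, hatSign, LinearMap.lTensor_tmul, LinearMap.lTensor_tmul, compT_tmul,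
      toHomT_tmul, compT_tmul, LinearMap.lTensor_tmul, LinearMap.lTensor_tmul,
      codiff_ι_mul, TensorProduct.tmul_add, TensorProduct.tmul_neg]

/-! ### Nilpotency and the geometric series -/

/-- A product of `n + 1` factors `δ` raises the height by more than `n`. -/
theorem exists_span_of_pow {δ : H.HomA X X} (hδ : δ ∈ H.ad X X 0) (n : ℕ) :
    (deltaT δ ^ (n + 1) : H.HomT X X) ∈ Submodule.span k {F : H.HomT X X |
      ∃ (i j : P) (f : X.carrier →ₗ[k] X.carrier) (v : TensorAlgebra k H.Yoneda),
        X.proj j ∘ₗ f ∘ₗ X.proj i = f ∧ height i + n < height j ∧ F = f ⊗ₜ[k] v} := by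
  induction n with
  | zero =>
    rw [zero_add, pow_one]
    refine Submodule.span_mono ?_ (toHomT_mem_adS hδ)
    rintro _ ⟨i, j, f, v, hf, -, hlt, rfl⟩
    exact ⟨i, j, f, v, hf, height_strictMono (lt_of_le_not_ge hlt.1 hlt.2), rfl⟩
  | succ n ih =>
    rw [pow_succ', mul_eq_compT]
    refine compT_mem_span ?_ (toHomT_mem_adS hδ) ih
    rintro _ ⟨i, j, f, v, hf, -, hlt, rfl⟩ _ ⟨i', j', f', v', hf', hh, rfl⟩
    rw [compT_tmul]
    by_cases h : j' = i
    · subst h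
      have := height_strictMono (lt_of_le_not_ge hlt.1 hlt.2)
      exact Submodule.subset_span ⟨_, _, _, _, corner_comp hf hf', by omega, rfl⟩
    · rw [corner_comp_corner hf hf' h, TensorProduct.zero_tmul]
      exact zero_mem _

/-- The letters of `B_0` raise the height, so `δ` is nilpotent. -/
theorem deltaT_pow_eq_zero {δ : H.HomA X X} (hδ : δ ∈ H.ad X X 0) {n : ℕ}
    (hn : Fintype.card P + 1 ≤ n) : deltaT δ ^ n = 0 := by
  obtain ⟨n, rfl⟩ : ∃ n', n = n' + 1 := ⟨n - 1, by omega⟩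
  have := exists_span_of_pow hδ n
  have h0 : Submodule.span k {F : H.HomT X X |
      ∃ (i j : P) (f : X.carrier →ₗ[k] X.carrier) (v : TensorAlgebra k H.Yoneda),
        X.proj j ∘ₗ f ∘ₗ X.proj i = f ∧ height i + n < height j ∧ F = f ⊗ₜ[k] v} = ⊥ := by
    rw [Submodule.span_eq_bot]
    rintro _ ⟨i, j, f, v, -, hh, -⟩
    have := height_lt_card j
    omega
  rwa [h0, Submodule.mem_bot] at this

theorem geom_eq_sum {δ : H.HomA X X} (hδ : δ ∈ H.ad X X 0) {N : ℕ} (hN : Fintype.card P + 1 ≤ N) :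
    geom δ = (∑ s ∈ Finset.range N, deltaT δ ^ s : Module.End k X.carrier ⊗[k] TensorAlgebra k H.Yoneda) := by
  refine finsum_eq_sum_of_support_subset _ fun s hs => ?_
  by_contra h
  simp only [Finset.coe_range, Set.mem_Iio, not_lt] at h
  exact hs (deltaT_pow_eq_zero hδ (hN.trans h))

theorem geom_eq_one_add {δ : H.HomA X X} (hδ : δ ∈ H.ad X X 0) :
    geom δ = oneT H X + H.toHomT X X δ ⊙ geom δ := by
  have h1 := geom_eq_sum hδ (N := Fintype.card P + 1 + 1) (by omega)
  have h2 := geom_eq_sum hδ le_rfl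
  rw [Finset.sum_range_succ', pow_zero, Finset.sum_congr rfl fun s _ => pow_succ' (deltaT δ) s,
    ← Finset.mul_sum, ← h2, mul_eq_compT, add_comm] at h1
  exact h1

theorem geom_eq_one_add' {δ : H.HomA X X} (hδ : δ ∈ H.ad X X 0) :
    geom δ = oneT H X + geom δ ⊙ H.toHomT X X δ := by
  have h1 := geom_eq_sum hδ (N := Fintype.card P + 1 + 1) (by omega)
  have h2 := geom_eq_sum hδ le_rfl
  rw [Finset.sum_range_succ', pow_zero, Finset.sum_congr rfl fun s _ => pow_succ (deltaT δ) s,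
    ← Finset.sum_mul, ← h2, mul_eq_compT, add_comm] at h1
  exact h1

/-- The equation `F = A + F δ` has the solution `F = A (∑ δ^s)` only. -/
theorem eq_compT_geom {δ : H.HomA X X} (hδ : δ ∈ H.ad X X 0) {F A : H.HomT X Y}
    (h : F = A + F ⊙ H.toHomT X X δ) : F = A ⊙ geom δ := by
  have h1 : F ⊙ geom δ = A ⊙ geom δ + F ⊙ (H.toHomT X X δ ⊙ geom δ) := by
    conv_lhs => rw [h]
    rw [map_add, LinearMap.add_apply, compT_assoc]
  have h2 : F ⊙ geom δ = F + F ⊙ (H.toHomT X X δ ⊙ geom δ) := by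
    conv_lhs => rw [geom_eq_one_add hδ]
    rw [map_add, compT_oneT]
  rw [h1] at h2
  exact (add_right_cancel h2).symm

/-- The equation `F = A + δ F` has the solution `F = (∑ δ^s) A` only. -/
theorem eq_geom_compT {δ : H.HomA Y Y} (hδ : δ ∈ H.ad Y Y 0) {F A : H.HomT X Y}
    (h : F = A + H.toHomT Y Y δ ⊙ F) : F = geom δ ⊙ A := by
  have h1 : geom δ ⊙ F = geom δ ⊙ A + geom δ ⊙ (H.toHomT Y Y δ ⊙ F) := by
    conv_lhs => rw [h]
    rw [map_add]
  have h2 : geom δ ⊙ F = F + geom δ ⊙ (H.toHomT Y Y δ ⊙ F) := by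
    conv_lhs => rw [geom_eq_one_add' hδ]
    rw [map_add, LinearMap.add_apply, oneT_compT, compT_assoc]
  rw [h1] at h2
  exact (add_right_cancel h2).symm

theorem deltaT_pow_mem {δ : H.HomA X X} (hδ : δ ∈ H.ad X X 0) (n : ℕ) :
    (deltaT δ ^ n : H.HomT X X) ∈ adT H X X 0 := by
  induction n with
  | zero => exact oneT_mem
  | succ n ih =>
    rw [pow_succ', mul_eq_compT]
    have := compT_mem_adT (toHomT_mem (.inr rfl) hδ) ih
    rwa [add_zero] at this

theorem geom_mem {δ : H.HomA X X} (hδ : δ ∈ H.ad X X 0) : geom δ ∈ adT H X X 0 := by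
  rw [geom_eq_sum hδ le_rfl]
  generalize Fintype.card P + 1 = N
  induction N with
  | zero => exact (adT H X X 0).zero_mem
  | succ N ih =>
    rw [Finset.sum_range_succ]
    exact (adT H X X 0).add_mem ih (deltaT_pow_mem hδ N)

end Calculus

/-! ### Long words -/

section TwistedCategory

variable {k : Type u} [Field k] {Λ : Type u} [Ring Λ] [Algebra k Λ]
  {P : Type u} [Preorder P] [DecidableEq P] [Fintype P] {H : HomologicalSystem k Λ P}
  [IsAlgClosed k] [Module.Finite k Λ] (m : StrictAInfinity H)
  {X Y Z U : SMod.{u, w} k P}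

local notation:70 F:71 " ⊙ " G:70 => HomologicalSystem.compT _ _ _ _ F G

variable (H X Y) in
/-- The elements of `Hom_k(X, Y) ⊗ T_k(A)` which are sums of words of length at least `d`. -/
noncomputable def longT (d : ℕ) : Submodule k (H.HomT X Y) :=
  Submodule.span k {F | ∃ (f : X.carrier →ₗ[k] Y.carrier) (a : ℕ → H.Yoneda) (n : ℕ), d ≤ n ∧
    F = f ⊗ₜ[k] word a 0 n}

theorem compT_mem_longT {d d' : ℕ} {F : H.HomT Y Z} {G : H.HomT X Y} (hF : F ∈ longT H Y Z d)
    (hG : G ∈ longT H X Y d') : F ⊙ G ∈ longT H X Z (d + d') := by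
  refine compT_mem_span ?_ hF hG
  rintro _ ⟨f, a, n, hn, rfl⟩ _ ⟨f', a', n', hn', rfl⟩
  rw [compT_tmul]
  refine Submodule.subset_span
    ⟨f ∘ₗ f', fun q => if q < n then a q else a' (q - n), n + n', by omega, ?_⟩
  rw [word_add]
  refine congrArg (_ ⊗ₜ[k] ·) (congrArg₂ (· * ·) ?_ ?_)
  · exact word_congr fun q hq => by simp [hq]
  · exact word_congr fun q hq => by simp

theorem toHomT_mem_longT (t : H.HomA X Y) : H.toHomT X Y t ∈ longT H X Y 1 := by
  induction t using TensorProduct.induction_on with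
  | zero => rw [map_zero]; exact zero_mem _
  | add F F' hF hF' => rw [map_add]; exact add_mem hF hF'
  | tmul f x => exact Submodule.subset_span ⟨f, fun _ => x, 1, le_rfl, by
      rw [toHomT_tmul, word_succ, word_zero, mul_one]⟩

theorem mem_longT_zero (F : H.HomT X Y) : F ∈ longT H X Y 0 := by
  induction F using TensorProduct.induction_on with
  | zero => exact zero_mem _
  | add F F' hF hF' => exact add_mem hF hF'
  | tmul f v =>
    suffices (longT H X Y 0).mkQ ∘ₗ TensorProduct.mk k _ _ f = 0 by
      have := LinearMap.congr_fun this v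
      rwa [LinearMap.comp_apply, LinearMap.zero_apply, ← LinearMap.mem_ker, Submodule.ker_mkQ] at this
    refine linearMap_ext_word fun a n => ?_
    rw [LinearMap.comp_apply, LinearMap.zero_apply, ← LinearMap.mem_ker, Submodule.ker_mkQ]
    exact Submodule.subset_span ⟨f, a, n, by omega, rfl⟩

theorem geom_sub_oneT_mem {δ : H.HomA X X} (hδ : δ ∈ H.ad X X 0) :
    geom δ - oneT H X ∈ longT H X X 1 := by
  rw [geom_eq_one_add hδ, add_sub_cancel_left]
  exact compT_mem_longT (d := 1) (d' := 0) (toHomT_mem_longT δ) (mem_longT_zero _)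

theorem geom_sub_mem {δ : H.HomA X X} (hδ : δ ∈ H.ad X X 0) :
    geom δ - (oneT H X + H.toHomT X X δ) ∈ longT H X X 2 := by
  have : geom δ - (oneT H X + H.toHomT X X δ) = H.toHomT X X δ ⊙ (geom δ - oneT H X) := by
    conv_lhs => rw [geom_eq_one_add hδ]
    rw [map_sub, compT_oneT]
    abel
  rw [this]
  exact compT_mem_longT (d := 1) (d' := 1) (toHomT_mem_longT δ) (geom_sub_oneT_mem hδ)

theorem geom_toHomT_geom_sub_mem {δ : H.HomA X X} (hδ : δ ∈ H.ad X X 0) {δ' : H.HomA Y Y}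
    (hδ' : δ' ∈ H.ad Y Y 0) (t : H.HomA X Y) :
    geom δ' ⊙ (H.toHomT X Y t ⊙ geom δ) - H.toHomT X Y t ∈ longT H X Y 2 := by
  have : geom δ' ⊙ (H.toHomT X Y t ⊙ geom δ) - H.toHomT X Y t =
      (geom δ' - oneT H Y) ⊙ (H.toHomT X Y t ⊙ geom δ) +
        H.toHomT X Y t ⊙ (geom δ - oneT H X) := by
    rw [map_sub, LinearMap.sub_apply, map_sub, oneT_compT, compT_oneT]
    abel
  rw [this]
  exact add_mem
    (compT_mem_longT (d := 1) (d' := 1) (geom_sub_oneT_mem hδ')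
      (compT_mem_longT (d := 1) (d' := 0) (toHomT_mem_longT t) (mem_longT_zero _)))
    (compT_mem_longT (d := 1) (d' := 1) (toHomT_mem_longT t) (geom_sub_oneT_mem hδ))

/-! ### Units -/

variable (H) in
/-- `∑_j h|_{X e_j} ⊗ e_j`. -/
noncomputable def unitEl (h : X.carrier →ₗ[k] Y.carrier) : H.HomA X Y :=
  ∑ j, (h ∘ₗ X.proj j) ⊗ₜ[k] H.e j

/-- Strict unitality with coefficients: an entry `∑_j h|_{X e_j} ⊗ e_j` surrounded by words with at
least two letters is annihilated. -/
theorem bad_unitEl_eq_zero {d d' : ℕ} (hd : 2 ≤ d + d') {F : H.HomT Y Z} (hF : F ∈ longT H Y Z d)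
    {G : H.HomT U X} (hG : G ∈ longT H U X d') (h : X.carrier →ₗ[k] Y.carrier) :
    bad m (F ⊙ (H.toHomT X Y (unitEl H h) ⊙ G)) = 0 := by
  induction hF using Submodule.span_induction with
  | zero => simp only [map_zero, LinearMap.zero_apply]
  | add F F' _ _ hF hF' => simp only [map_add, LinearMap.add_apply, hF, hF', add_zero]
  | smul c F _ hF => simp only [map_smul, LinearMap.smul_apply, hF, smul_zero]
  | mem F hF =>
  induction hG using Submodule.span_induction with
  | zero => simp only [map_zero]
  | add F F' _ _ hF hF' => simp only [map_add, hF, hF', add_zero]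
  | smul c F _ hF => simp only [map_smul, hF, smul_zero]
  | mem G hG =>
  obtain ⟨f, a, n, hn, rfl⟩ := hF
  obtain ⟨f', a', n', hn', rfl⟩ := hG
  rw [unitEl, map_sum, map_sum, LinearMap.sum_apply, map_sum, map_sum]
  refine Finset.sum_eq_zero fun j _ => ?_
  rw [toHomT_tmul, compT_tmul, compT_tmul, bad_tmul, ← mul_assoc, bTotal_word_mul_e_mul_word,
    TensorProduct.tmul_zero]
  omega

theorem bad_unitEl_toHomT (h : Y.carrier →ₗ[k] Z.carrier) {n : ℤ} {t : H.HomA X Y}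
    (ht : t ∈ H.ad X Y n) : bad m (H.toHomT Y Z (unitEl H h) ⊙ H.toHomT X Y t) =
      LinearMap.rTensor _ (LinearMap.llcomp k X.carrier Y.carrier Z.carrier h) t := by
  induction ht using Submodule.span_induction with
  | zero => simp only [map_zero]
  | add F F' _ _ hF hF' => simp only [map_add, hF, hF']
  | smul c F _ hF => simp only [map_smul, hF]
  | mem F hF =>
    obtain ⟨i, j, f, x, hf, hx, rfl⟩ := hF
    rw [unitEl, map_sum, map_sum, LinearMap.sum_apply, map_sum, Finset.sum_eq_single j]
    · rw [toHomT_tmul, toHomT_tmul, compT_tmul, bad_tmul, bTotal_ι_mul_ι, signInv_e,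
        (H.mem_barComp'.1 hx).1, LinearMap.comp_assoc, proj_comp_corner hf, if_pos rfl]
      rfl
    · intro l _ hl
      rw [toHomT_tmul, toHomT_tmul, compT_tmul, LinearMap.comp_assoc, proj_comp_corner hf,
        if_neg hl.symm, LinearMap.comp_zero, TensorProduct.zero_tmul, map_zero]
    · simp

theorem bad_toHomT_unitEl {h : X.carrier →ₗ[k] Y.carrier} (hh : ∀ j, h ∘ₗ X.proj j = Y.proj j ∘ₗ h)
    {n : ℤ} {t : H.HomA Y Z} (ht : t ∈ H.ad Y Z n) :
    bad m (H.toHomT Y Z t ⊙ H.toHomT X Y (unitEl H h)) =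
      LinearMap.rTensor _ (LinearMap.lcomp k Z.carrier h) (hatSign Y Z t) := by
  induction ht using Submodule.span_induction with
  | zero => simp only [map_zero, LinearMap.zero_apply]
  | add F F' _ _ hF hF' => simp only [map_add, LinearMap.add_apply, hF, hF']
  | smul c F _ hF => simp only [map_smul, LinearMap.smul_apply, hF]
  | mem F hF =>
    obtain ⟨i, j, f, x, hf, hx, rfl⟩ := hF
    rw [unitEl, map_sum, map_sum, map_sum, Finset.sum_eq_single i]
    · rw [toHomT_tmul, toHomT_tmul, compT_tmul, bad_tmul, bTotal_ι_mul_ι, hh, ← LinearMap.comp_assoc,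
        corner_comp_proj hf, if_pos rfl, ← H.signInv_e i, ← signInv_mul, (H.mem_barComp'.1 hx).2.1]
      rfl
    · intro l _ hl
      rw [toHomT_tmul, toHomT_tmul, compT_tmul, hh, ← LinearMap.comp_assoc, corner_comp_proj hf,
        if_neg hl, LinearMap.zero_comp, TensorProduct.zero_tmul, map_zero]
    · simp

theorem unitEl_mem {h : X.carrier →ₗ[k] Y.carrier} (hh : ∀ j, h ∘ₗ X.proj j = Y.proj j ∘ₗ h) :
    unitEl H h ∈ H.ad X Y (-1) := by
  refine Submodule.sum_mem _ fun j _ => Submodule.subset_span ⟨j, j, _, _, ?_, H.e_mem_barComp j, rfl⟩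
  rw [LinearMap.comp_assoc, proj_comp_proj, if_pos rfl, ← LinearMap.comp_assoc, ← hh,
    LinearMap.comp_assoc, proj_comp_proj, if_pos rfl]

theorem hatSign_of_mem_neg_one {t : H.HomA X Y} (ht : t ∈ H.ad X Y (-1)) : hatSign X Y t = t := by
  have := hatSign_of_mem (n := 0) (by simpa using ht)
  simpa using this

theorem hatSign_of_mem_zero {t : H.HomA X Y} (ht : t ∈ H.ad X Y 0) : hatSign X Y t = -t := by
  have := hatSign_of_mem (n := 1) (by simpa using ht)
  rw [pow_one] at this
  exact this.trans (neg_one_smul k t)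

end TwistedCategory

/-! ### The category of twisted objects -/

section TwistedObjects

variable {k : Type u} [Field k] {Λ : Type u} [Ring Λ] [Algebra k Λ]
  {P : Type u} [Preorder P] [DecidableEq P] [Fintype P] {H : HomologicalSystem k Λ P}
  [IsAlgClosed k] [Module.Finite k Λ] {m : StrictAInfinity H}
  {X Y Z U : TwObj.{u, w} m}

local notation:70 F:71 " ⊙ " G:70 => HomologicalSystem.compT _ _ _ _ F G

theorem finsum_bad_pow {V : SMod.{u, w} k P} {δ : H.HomA V V} (hδ : δ ∈ H.ad V V 0) :
    ∑ᶠ s : ℕ, bad m (X := V) (Y := V) (deltaT δ ^ (s + 1)) = bad m (geom δ) := by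
  rw [finsum_eq_sum_of_support_subset (s := Finset.range (Fintype.card P + 1)), ← map_sum]
  · have h2 := geom_eq_sum hδ (N := Fintype.card P + 1 + 1) (by omega)
    rw [Finset.sum_range_succ', pow_zero] at h2
    rw [h2]
    refine Eq.trans ?_ (map_add (bad m) _ _).symm
    rw [one_eq_oneT, bad_oneT, add_zero]
  · intro s hs
    by_contra hn
    simp only [Finset.coe_range, Set.mem_Iio, not_lt] at hn
    apply hs
    dsimp only
    rw [deltaT_pow_eq_zero hδ (by omega)]
    exact map_zero _

/-- The Maurer–Cartan equation in the form `b(G) = 0`, with `G = ∑_s δ^{⊗ s}`. -/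
theorem bad_geom (X : TwObj.{u, w} m) : bad m (geom X.δ) = 0 := by
  rw [← finsum_bad_pow X.δ_mem, X.maurerCartan]

theorem b1tw_apply (t : H.HomA X.X Y.X) :
    b1tw X Y t = bad m (geom Y.δ ⊙ (H.toHomT _ _ t ⊙ geom X.δ)) := by
  rw [← compT_assoc]; rfl

/-- `E(G) = 0`: the initial segments to which `b` is applied again run through all words of `G`. -/
theorem hatE_geom (X : TwObj.{u, w} m) : hatE m (geom X.δ) = 0 := by
  have h0 : bad m (geom X.δ ⊙ H.toHomT _ _ X.δ) = 0 := by
    have := bad_geom X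
    rwa [geom_eq_one_add' X.δ_mem, map_add, bad_oneT, zero_add] at this
  have h1 : hatE m (geom X.δ) = 0 + hatE m (geom X.δ) ⊙ H.toHomT _ _ X.δ := by
    conv_lhs => rw [geom_eq_one_add' X.δ_mem]
    rw [map_add, hatE_oneT, hatE_compT_toHomT, h0, map_zero, add_zero]
  rw [eq_compT_geom X.δ_mem h1, map_zero, LinearMap.zero_apply]

/-- `D(G) = 0`, a consequence of the Maurer–Cartan equation. -/
theorem hatD_geom (X : TwObj.{u, w} m) : hatD m (geom X.δ) = 0 := by
  have h0 : hatE m (H.toHomT _ _ X.δ ⊙ geom X.δ) = 0 := by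
    have := hatE_geom X
    rwa [geom_eq_one_add X.δ_mem, map_add, hatE_oneT, zero_add] at this
  have h1 : hatD m (geom X.δ) = 0 + H.toHomT _ _ X.δ ⊙ hatD m (geom X.δ) := by
    conv_lhs => rw [geom_eq_one_add X.δ_mem]
    rw [map_add, hatD_oneT, hatD_toHomT_compT, h0, hatSign_of_mem_zero X.δ_mem, map_neg, map_neg,
      LinearMap.neg_apply]
    abel
  rw [eq_geom_compT X.δ_mem h1, map_zero]

/-- `E(F t G) = b(F t G) G + E(F) t G`: the initial segment ends either after the letter `t` or in `F`. -/
theorem hatE_compT_geom {V : SMod.{u, w} k P} (F : H.HomT V Z.X) (t : H.HomA X.X V) :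
    hatE m (F ⊙ (H.toHomT _ _ t ⊙ geom X.δ)) =
      H.toHomT _ _ (bad m (F ⊙ (H.toHomT _ _ t ⊙ geom X.δ))) ⊙ geom X.δ +
        hatE m F ⊙ (H.toHomT _ _ t ⊙ geom X.δ) := by
  rw [← compT_assoc, ← compT_assoc, ← LinearMap.add_apply, ← map_add]
  set F' := F ⊙ H.toHomT _ _ t with hF'
  have hG : F' ⊙ geom X.δ = F' + (F' ⊙ geom X.δ) ⊙ H.toHomT _ _ X.δ := by
    conv_lhs => rw [geom_eq_one_add' X.δ_mem]
    rw [map_add, compT_oneT, ← compT_assoc]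
  refine eq_compT_geom X.δ_mem ?_
  conv_lhs => rw [hG]
  rw [map_add, hatE_compT_toHomT, hF', hatE_compT_toHomT, ← hF']
  conv_rhs => enter [1, 1]; rw [hG]
  simp only [map_add]
  abel

/-- `D(G t F) = G (E(G t F) ± t D(F))`: the operation starts either in `G t` or in `F`. -/
theorem hatD_geom_compT {V W : SMod.{u, w} k P} (t : H.HomA W Z.X) (F : H.HomT V W) :
    hatD m (geom Z.δ ⊙ (H.toHomT _ _ t ⊙ F)) =
      geom Z.δ ⊙ (-(H.toHomT _ _ (hatSign _ _ t) ⊙ hatD m F) +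
        hatE m (geom Z.δ ⊙ (H.toHomT _ _ t ⊙ F))) := by
  set F' := H.toHomT _ _ t ⊙ F with hF'
  have hG : geom Z.δ ⊙ F' = F' + H.toHomT _ _ Z.δ ⊙ (geom Z.δ ⊙ F') := by
    conv_lhs => rw [geom_eq_one_add Z.δ_mem]
    rw [map_add, LinearMap.add_apply, oneT_compT, compT_assoc]
  refine eq_geom_compT Z.δ_mem ?_
  conv_lhs => rw [hG]
  rw [map_add, hatD_toHomT_compT, hF', hatD_toHomT_compT, ← hF', hatSign_of_mem_zero Z.δ_mem]
  conv_rhs => enter [1, 2]; rw [hG]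
  simp only [map_add, map_neg, LinearMap.neg_apply]
  abel

/-- `E(G t G) = 0` for a cycle `t`. -/
theorem hatE_of_mem_cyc {t : H.HomA X.X Y.X} (ht : t ∈ cyc X Y) :
    hatE m (geom Y.δ ⊙ (H.toHomT _ _ t ⊙ geom X.δ)) = 0 := by
  have h0 : bad m (geom Y.δ ⊙ (H.toHomT _ _ t ⊙ geom X.δ)) = 0 := by
    rw [← b1tw_apply]; exact ht.2
  rw [hatE_compT_geom, h0, hatE_geom]
  simp only [map_zero, LinearMap.zero_apply, add_zero]

/-- `D(G t G) = 0` for a cycle `t`. -/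
theorem hatD_of_mem_cyc {t : H.HomA X.X Y.X} (ht : t ∈ cyc X Y) :
    hatD m (geom Y.δ ⊙ (H.toHomT _ _ t ⊙ geom X.δ)) = 0 := by
  rw [hatD_geom_compT, hatD_geom, hatE_of_mem_cyc ht]
  simp only [map_zero, neg_zero, add_zero]

/-- `E(G t₂ G t₁ G) = b_2^{tw}(t₂ ⊗ t₁) G` if `t₂` is a cycle. -/
theorem hatE_comp {t₁ : H.HomA X.X Y.X} {t₂ : H.HomA Y.X Z.X} (h₂ : t₂ ∈ cyc Y Z) :
    hatE m (geom Z.δ ⊙ (H.toHomT _ _ t₂ ⊙ (geom Y.δ ⊙ (H.toHomT _ _ t₁ ⊙ geom X.δ)))) =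
      H.toHomT _ _ (b2tw X Y Z t₂ t₁) ⊙ geom X.δ := by
  have hF : geom Z.δ ⊙ (H.toHomT _ _ t₂ ⊙ (geom Y.δ ⊙ (H.toHomT _ _ t₁ ⊙ geom X.δ))) =
      (geom Z.δ ⊙ (H.toHomT _ _ t₂ ⊙ geom Y.δ)) ⊙ (H.toHomT _ _ t₁ ⊙ geom X.δ) := by
    simp only [compT_assoc]
  rw [hF, hatE_compT_geom, hatE_of_mem_cyc h₂, ← hF, map_zero, LinearMap.zero_apply, add_zero]
  rfl

/-- `D(G t₂ G t₁ G) = G b_2^{tw}(t₂ ⊗ t₁) G` for cycles `t₁` and `t₂`. -/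
theorem hatD_comp {t₁ : H.HomA X.X Y.X} {t₂ : H.HomA Y.X Z.X} (h₁ : t₁ ∈ cyc X Y)
    (h₂ : t₂ ∈ cyc Y Z) :
    hatD m (geom Z.δ ⊙ (H.toHomT _ _ t₂ ⊙ (geom Y.δ ⊙ (H.toHomT _ _ t₁ ⊙ geom X.δ)))) =
      geom Z.δ ⊙ (H.toHomT _ _ (b2tw X Y Z t₂ t₁) ⊙ geom X.δ) := by
  rw [hatD_geom_compT, hatD_of_mem_cyc h₁, hatE_comp h₂, map_zero, neg_zero, zero_add]

theorem chain_mem {n : ℤ} {F : H.HomT X.X Y.X} (hF : F ∈ adT H X.X Y.X n) {t : H.HomA Y.X Z.X}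
    (ht : t ∈ H.ad Y.X Z.X (-1)) : geom Z.δ ⊙ (H.toHomT _ _ t ⊙ F) ∈ adT H X.X Z.X (n - 1) := by
  have := compT_mem_adT (geom_mem Z.δ_mem) (compT_mem_adT (toHomT_mem (.inl rfl) ht) hF)
  rwa [show (0 : ℤ) + (-1 + n) = n - 1 by ring] at this

theorem b2tw_mem {t₁ : H.HomA X.X Y.X} {t₂ : H.HomA Y.X Z.X} (h₁ : t₁ ∈ H.ad X.X Y.X (-1))
    (h₂ : t₂ ∈ H.ad Y.X Z.X (-1)) : b2tw X Y Z t₂ t₁ ∈ H.ad X.X Z.X (-1) := by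
  have := bad_mem m (chain_mem (chain_mem (geom_mem X.δ_mem) h₁) h₂)
  rwa [show (0 : ℤ) - 1 - 1 + 1 = -1 by norm_num] at this

theorem b2tw_mem_cyc {t₁ : H.HomA X.X Y.X} {t₂ : H.HomA Y.X Z.X} (h₁ : t₁ ∈ cyc X Y)
    (h₂ : t₂ ∈ cyc Y Z) : b2tw X Y Z t₂ t₁ ∈ cyc X Z := by
  refine ⟨b2tw_mem h₁.1 h₂.1, LinearMap.mem_ker.2 ?_⟩
  rw [b1tw_apply, ← hatD_comp h₁ h₂, bad_hatD]

/-- Associativity, from `b ∘ D = 0` on `G t₃ G t₂ G t₁ G`. -/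
theorem b2tw_assoc {t₁ : H.HomA X.X Y.X} {t₂ : H.HomA Y.X Z.X} {t₃ : H.HomA Z.X U.X}
    (h₁ : t₁ ∈ cyc X Y) (h₂ : t₂ ∈ cyc Y Z) (h₃ : t₃ ∈ cyc Z U) :
    b2tw X Z U t₃ (b2tw X Y Z t₂ t₁) = b2tw X Y U (b2tw Y Z U t₃ t₂) t₁ := by
  set G := geom Z.δ ⊙ (H.toHomT _ _ t₂ ⊙ (geom Y.δ ⊙ (H.toHomT _ _ t₁ ⊙ geom X.δ))) with hG
  set F := geom U.δ ⊙ (H.toHomT _ _ t₃ ⊙ (geom Z.δ ⊙ (H.toHomT _ _ t₂ ⊙ geom Y.δ))) with hF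
  have hFG : geom U.δ ⊙ (H.toHomT _ _ t₃ ⊙ G) = F ⊙ (H.toHomT _ _ t₁ ⊙ geom X.δ) := by
    simp only [hF, hG, compT_assoc]
  -- the ternary operation vanishes, as its value has degree `-2`
  have h3 : bad m (geom U.δ ⊙ (H.toHomT _ _ t₃ ⊙ G)) = 0 := by
    have := bad_mem m (chain_mem (chain_mem (chain_mem (geom_mem X.δ_mem) h₁.1) h₂.1) h₃.1)
    rwa [ad_eq_bot (by norm_num), Submodule.mem_bot] at this
  have h := bad_hatD m (geom U.δ ⊙ (H.toHomT _ _ t₃ ⊙ G))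
  rw [hatD_geom_compT, hatD_comp h₁ h₂, hatSign_of_mem_neg_one h₃.1, hFG, hatE_compT_geom, ← hFG, h3,
    map_zero, map_zero, LinearMap.zero_apply, zero_add, hF, hatE_comp h₃, map_add, map_add, map_neg, map_neg,
    compT_assoc] at h
  exact (neg_add_eq_zero.1 h)

theorem bad_geom_unitEl_of_mem {h : X.X.carrier →ₗ[k] Y.X.carrier} {W : SMod.{u, w} k P}
    {F : H.HomT Y.X W}
    (hF : F ∈ longT H Y.X W 1) :
    bad m (F ⊙ (H.toHomT _ _ (unitEl H h) ⊙ geom X.δ)) = bad m (F ⊙ H.toHomT _ _ (unitEl H h)) := by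
  have := bad_unitEl_eq_zero m (by norm_num) hF (geom_sub_oneT_mem X.δ_mem) h
  rw [map_sub, map_sub, compT_oneT, map_sub, sub_eq_zero] at this
  exact this

theorem bad_unitEl_geom_of_mem {h : X.X.carrier →ₗ[k] Y.X.carrier} {W : SMod.{u, w} k P}
    {F : H.HomT W X.X} (hF : F ∈ longT H W X.X 1) :
    bad m (geom Y.δ ⊙ (H.toHomT _ _ (unitEl H h) ⊙ F)) = bad m (H.toHomT _ _ (unitEl H h) ⊙ F) := by
  have := bad_unitEl_eq_zero m (by norm_num) (geom_sub_oneT_mem Y.δ_mem) hF h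
  rw [map_sub, LinearMap.sub_apply, oneT_compT, map_sub, sub_eq_zero] at this
  exact this

/-- Composition with `∑_j h|_{X e_j} ⊗ e_j` on the right is composition of the coefficients with `h`. -/
theorem b2tw_unitEl_right {h : X.X.carrier →ₗ[k] Y.X.carrier}
    (hh : ∀ j, h ∘ₗ X.X.proj j = Y.X.proj j ∘ₗ h) {t : H.HomA Y.X Z.X} (ht : t ∈ H.ad Y.X Z.X (-1)) :
    b2tw X Y Z t (unitEl H h) = LinearMap.rTensor _ (LinearMap.lcomp k Z.X.carrier h) t := by
  have h1 : b2tw X Y Z t (unitEl H h) = bad m ((geom Z.δ ⊙ (H.toHomT _ _ t ⊙ geom Y.δ)) ⊙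
      (H.toHomT _ _ (unitEl H h) ⊙ geom X.δ)) := by
    simp only [compT_assoc]; rfl
  have h2 := bad_unitEl_eq_zero m (d' := 0) (by norm_num)
    (geom_toHomT_geom_sub_mem Y.δ_mem Z.δ_mem t) (mem_longT_zero (oneT H X.X)) h
  rw [compT_oneT, map_sub, LinearMap.sub_apply, map_sub, sub_eq_zero] at h2
  rw [h1, bad_geom_unitEl_of_mem, h2, bad_toHomT_unitEl m hh ht, hatSign_of_mem_neg_one ht]
  exact compT_mem_longT (d := 0) (d' := 1) (mem_longT_zero _)
    (compT_mem_longT (d := 1) (d' := 0) (toHomT_mem_longT t) (mem_longT_zero _))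

/-- Composition with `∑_j h|_{Y e_j} ⊗ e_j` on the left is composition of the coefficients with `h`. -/
theorem b2tw_unitEl_left {h : Y.X.carrier →ₗ[k] Z.X.carrier} {t : H.HomA X.X Y.X}
    (ht : t ∈ H.ad X.X Y.X (-1)) : b2tw X Y Z (unitEl H h) t =
      LinearMap.rTensor _ (LinearMap.llcomp k X.X.carrier Y.X.carrier Z.X.carrier h) t := by
  have h2 := bad_unitEl_eq_zero m (d := 0) (by norm_num) (mem_longT_zero (oneT H Z.X))
    (geom_toHomT_geom_sub_mem X.δ_mem Y.δ_mem t) h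
  rw [oneT_compT, map_sub, map_sub, sub_eq_zero] at h2
  rw [b2tw, bad_unitEl_geom_of_mem, h2, bad_unitEl_toHomT m h ht]
  exact compT_mem_longT (d := 0) (d' := 1) (mem_longT_zero _)
    (compT_mem_longT (d := 1) (d' := 0) (toHomT_mem_longT t) (mem_longT_zero _))

/-- `b_1^{tw}` of `∑_j h|_{X e_j} ⊗ e_j` is `h δ_X - δ_Y h`: by strict unitality only `b_2` contributes.
-/
theorem b1tw_unitEl {h : X.X.carrier →ₗ[k] Y.X.carrier}
    (hh : ∀ j, h ∘ₗ X.X.proj j = Y.X.proj j ∘ₗ h) : b1tw X Y (unitEl H h) =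
      LinearMap.rTensor _ (LinearMap.llcomp k X.X.carrier X.X.carrier Y.X.carrier h) X.δ -
        LinearMap.rTensor _ (LinearMap.lcomp k Y.X.carrier h) Y.δ := by
  have hg : H.toHomT _ _ (unitEl H h) ⊙ geom X.δ = H.toHomT _ _ (unitEl H h) ⊙ (geom X.δ - oneT H X.X) +
      H.toHomT _ _ (unitEl H h) := by
    rw [map_sub, compT_oneT]; abel
  have h1 := bad_unitEl_eq_zero m (d := 0) (by norm_num) (mem_longT_zero (oneT H Y.X))
    (geom_sub_mem X.δ_mem) h
  have h2 := bad_unitEl_eq_zero m (d' := 0) (by norm_num) (geom_sub_mem Y.δ_mem)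
    (mem_longT_zero (oneT H X.X)) h
  rw [oneT_compT, map_sub, map_sub, sub_eq_zero, map_add, map_add, bad_unitEl_toHomT m h X.δ_mem,
    compT_oneT, bad_toHomT, zero_add] at h1
  rw [compT_oneT, map_sub, LinearMap.sub_apply, map_sub, sub_eq_zero, map_add, LinearMap.add_apply,
    map_add, bad_toHomT_unitEl m hh Y.δ_mem, oneT_compT, bad_toHomT, zero_add,
    hatSign_of_mem_zero Y.δ_mem, map_neg] at h2
  rw [b1tw_apply, hg, map_add, map_add, h2, bad_unitEl_geom_of_mem (geom_sub_oneT_mem X.δ_mem), map_sub,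
    compT_oneT, map_sub, bad_toHomT, h1, sub_zero, sub_eq_add_neg]

theorem unit_eq_unitEl (X : TwObj.{u, w} m) : unit X = unitEl H LinearMap.id := by
  simp only [unit, unitEl, LinearMap.id_comp]

/-- There are no boundaries of degree `-1`, as `ad(B)(X, Y)_{-2} = 0`. -/
theorem bdry_eq_bot (X Y : TwObj.{u, w} m) : bdry X Y = ⊥ := by
  rw [bdry, ad_eq_bot (by norm_num), Submodule.map_bot]

variable (m) in
theorem twIsCategory : TwIsCategory.{u, w} m where
  unit_mem X := by
    rw [unit_eq_unitEl]
    refine ⟨unitEl_mem fun j => rfl, LinearMap.mem_ker.2 ?_⟩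
    rw [b1tw_unitEl fun j => rfl, sub_eq_zero]
    rfl
  comp_mem X Y Z t₁ h₁ t₂ h₂ := b2tw_mem_cyc h₁ h₂
  comp_congr X Y Z t₁ _ t₁' _ t₂ _ t₂' _ h h' := by
    rw [bdry_eq_bot, Submodule.mem_bot, sub_eq_zero] at h h'
    rw [h, h', sub_self]
    exact zero_mem _
  comp_unit X Y t ht := by
    rw [unit_eq_unitEl, b2tw_unitEl_right (fun j => rfl) ht.1, bdry_eq_bot, Submodule.mem_bot, sub_eq_zero]
    exact LinearMap.rTensor_id_apply _ _ t
  unit_comp X Y t ht := by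
    rw [unit_eq_unitEl, b2tw_unitEl_left ht.1, bdry_eq_bot, Submodule.mem_bot, sub_eq_zero]
    exact LinearMap.rTensor_id_apply _ _ t
  assoc X Y Z U t₁ h₁ t₂ h₂ t₃ h₃ := by
    rw [b2tw_assoc h₁ h₂ h₃, sub_self]
    exact zero_mem _

end TwistedObjects

/-! ### Components of morphisms -/

section Evaluation

variable {k : Type u} [Field k] {Λ : Type u} [Ring Λ] [Algebra k Λ]
  {P : Type u} [Preorder P] [DecidableEq P] [Fintype P] {H : HomologicalSystem k Λ P}
  [IsAlgClosed k] [Module.Finite k Λ] (m : StrictAInfinity H)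
  {X Y Z U : SMod.{u, w} k P}

local notation:70 F:71 " ⊙ " G:70 => HomologicalSystem.compT _ _ _ _ F G

theorem evalA_tmul (ζ : Module.Dual k H.Yoneda) (f : X.carrier →ₗ[k] Y.carrier) (x : H.Yoneda) :
    evalA X Y ζ (f ⊗ₜ[k] x) = ζ x • f := by
  simp [evalA]

/-- Functionals on `A` separate the elements of `Hom_k(X, Y) ⊗ A`. -/
theorem eq_zero_of_evalA {s : H.HomA X Y} (h : ∀ ζ, evalA X Y ζ s = 0) : s = 0 := by
  classical
  obtain ⟨c, rfl⟩ := TensorProduct.eq_repr_basis_right (Module.Basis.ofVectorSpace k H.Yoneda) s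
  refine Finset.sum_eq_zero fun i _ => ?_
  have := h ((Module.Basis.ofVectorSpace k H.Yoneda).coord i)
  rw [Finsupp.sum, map_sum, Finset.sum_congr rfl fun j _ => evalA_tmul _ (c j) _] at this
  simp only [Module.Basis.coord_apply, Module.Basis.repr_self, Finsupp.single_apply, ite_smul, one_smul,
    zero_smul, Finset.sum_ite_eq'] at this
  dsimp only
  by_cases hi : i ∈ c.support
  · rw [if_pos hi] at this
    rw [this, TensorProduct.zero_tmul]
  · rw [Finsupp.notMem_support_iff.1 hi, TensorProduct.zero_tmul]

theorem psiBar_tmul (f : X.carrier →ₗ[k] Y.carrier) (x : H.Yoneda) (n : ℤ) (i j : P)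
    (α : H.dualBar n i j) :
    psiBar (f ⊗ₜ[k] x) n i j α = α ((H.barProj n i j).rangeRestrict x) • f :=
  evalA_tmul _ _ _

theorem psiBar_apply (t : H.HomA X Y) (n : ℤ) (i j : P) (α : H.dualBar n i j) :
    psiBar t n i j α = evalA X Y (α ∘ₗ (H.barProj n i j).rangeRestrict) t := rfl

theorem psiRad_apply (t : H.HomA X Y) (i j : P) (ξ : H.dualRad i j) :
    psiRad t i j ξ = evalA X Y (ξ ∘ₗ H.radProj i j) t := rfl

theorem psiRad_tmul (f : X.carrier →ₗ[k] Y.carrier) (x : H.Yoneda) (i j : P)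
    (ξ : H.dualRad i j) : psiRad (f ⊗ₜ[k] x) i j ξ = ξ (H.radProj i j x) • f :=
  evalA_tmul _ _ _

theorem rangeRestrict_of_mem {n : ℤ} {i j : P} {x : H.Yoneda} (hx : x ∈ H.barComp n i j) :
    (H.barProj n i j).rangeRestrict x = ⟨x, hx⟩ :=
  Subtype.ext (H.mem_barComp.1 hx)

theorem rangeRestrict_of_ne {n : ℤ} {i j i' j' : P} {x : H.Yoneda} (hx : x ∈ H.barComp n i j)
    (h : ¬ (i = i' ∧ j = j')) : (H.barProj n i' j').rangeRestrict x = 0 := by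
  apply Subtype.ext
  change H.barProj n i' j' x = 0
  rw [H.barProj_of_mem hx, if_neg fun h' => h h'.2]

theorem radProj_self {i j : P} {x : H.Yoneda} (hx : x ∈ H.radComp i j) : H.radProj i j x = ⟨x, hx⟩ :=
  Subtype.ext (by rw [H.radProj_of_mem hx, if_pos ⟨rfl, rfl⟩])

theorem radProj_of_ne {i j i' j' : P} {x : H.Yoneda} (hx : x ∈ H.radComp i j)
    (h : ¬ (i = i' ∧ j = j')) : H.radProj i' j' x = 0 :=
  Subtype.ext (by rw [H.radProj_of_mem hx, if_neg h]; rfl)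

/-- The components of an element of `ad(B)(X, Y)_n` determine it. -/
theorem eq_zero_of_psiBar {n : ℤ} {s : H.HomA X Y} (hs : s ∈ H.ad X Y n)
    (h : ∀ i j α, psiBar s n i j α = 0) : s = 0 := by
  refine eq_zero_of_evalA fun ζ => ?_
  have key : evalA X Y ζ s =
      ∑ i, ∑ j, psiBar s n i j (ζ ∘ₗ (H.barComp n i j).subtype) := by
    clear h
    induction hs using Submodule.span_induction with
    | zero => simp [psiBar_apply]
    | add F F' _ _ hF hF' =>
      simp only [psiBar_apply, map_add, Finset.sum_add_distrib] at hF hF' ⊢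
      rw [hF, hF']
    | smul c F _ hF => simp only [psiBar_apply, map_smul, ← Finset.smul_sum] at hF ⊢; rw [hF]
    | mem F hF =>
      obtain ⟨i, j, f, x, hf, hx, rfl⟩ := hF
      rw [evalA_tmul, Finset.sum_eq_single i, Finset.sum_eq_single j, psiBar_tmul,
        rangeRestrict_of_mem hx]
      · rfl
      · intro l _ hl
        rw [psiBar_tmul, rangeRestrict_of_ne hx (by tauto), map_zero, zero_smul]
      · simp
      · intro l _ hl
        refine Finset.sum_eq_zero fun l' _ => ?_
        rw [psiBar_tmul, rangeRestrict_of_ne hx (by tauto), map_zero, zero_smul]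
      · simp
  rw [key]
  exact Finset.sum_eq_zero fun i _ => Finset.sum_eq_zero fun j _ => h i j _

/-- `Ψ(s)` is a map of `S`-bimodules. -/
theorem psiBar_corner {n : ℤ} {s : H.HomA X Y} (hs : s ∈ H.ad X Y n) (i j : P) (α : H.dualBar n i j) :
    Y.proj j ∘ₗ psiBar s n i j α ∘ₗ X.proj i = psiBar s n i j α := by
  induction hs using Submodule.span_induction with
  | zero => simp [psiBar_apply]
  | add F F' _ _ hF hF' =>
    simp only [psiBar_apply, map_add] at hF hF' ⊢
    rw [LinearMap.add_comp, LinearMap.comp_add, hF, hF']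
  | smul c F _ hF =>
    simp only [psiBar_apply, map_smul] at hF ⊢
    rw [LinearMap.smul_comp, LinearMap.comp_smul, hF]
  | mem F hF =>
    obtain ⟨i', j', f, x, hf, hx, rfl⟩ := hF
    rw [psiBar_tmul]
    by_cases h : i' = i ∧ j' = j
    · obtain ⟨rfl, rfl⟩ := h
      rw [LinearMap.smul_comp, LinearMap.comp_smul, hf]
    · rw [rangeRestrict_of_ne hx h, map_zero, zero_smul]
      simp

/-- `Ψ(t)(∑_j e_j^*)`. -/
noncomputable def starPart (t : H.HomA X Y) : X.carrier →ₗ[k] Y.carrier :=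
  evalA X Y (∑ j, H.star j) t

theorem starPart_tmul (f : X.carrier →ₗ[k] Y.carrier) (x : H.Yoneda) :
    starPart (f ⊗ₜ[k] x) = (∑ j, H.star j x) • f := by
  rw [starPart, evalA_tmul, LinearMap.sum_apply]

/-- `ad(B)(X, Y)_{-1}` is spanned by the `f ⊗ e_i` and the `f ⊗ y` with `y ∈ J`. -/
theorem ad_neg_one_induction {C : H.HomA X Y → Prop} (h0 : C 0) (hadd : ∀ s t, C s → C t → C (s + t))
    (he : ∀ i (f : X.carrier →ₗ[k] Y.carrier), Y.proj i ∘ₗ f ∘ₗ X.proj i = f → C (f ⊗ₜ[k] H.e i))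
    (hr : ∀ i j (f : X.carrier →ₗ[k] Y.carrier) y, Y.proj j ∘ₗ f ∘ₗ X.proj i = f → y ∈ H.radComp i j →
      C (f ⊗ₜ[k] y))
    {t : H.HomA X Y} (ht : t ∈ H.ad X Y (-1)) : C t := by
  have hgen : ∀ (c : k) i j (f : X.carrier →ₗ[k] Y.carrier) x, Y.proj j ∘ₗ f ∘ₗ X.proj i = f →
      x ∈ H.barComp (-1) i j → C (c • f ⊗ₜ[k] x) := by
    intro c i j f x hf hx
    have hf' : ∀ c : k, Y.proj j ∘ₗ (c • f) ∘ₗ X.proj i = c • f := fun c => by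
      rw [LinearMap.smul_comp, LinearMap.comp_smul, hf]
    rw [TensorProduct.smul_tmul']
    by_cases hij : i = j
    · subst hij
      have := H.sub_star_smul_mem hx
      rw [← sub_add_cancel x (H.star i x • H.e i), TensorProduct.tmul_add, TensorProduct.tmul_smul,
        TensorProduct.smul_tmul', smul_smul]
      exact hadd _ _ (hr _ _ _ _ (hf' _) this) (he _ _ (hf' _))
    · exact hr _ _ _ _ (hf' _) (H.mem_radComp_of_ne hij hx)
  refine Submodule.span_induction (p := fun t _ => ∀ c : k, C (c • t)) ?_ ?_ ?_ ?_ ht 1 |> fun h => by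
    rwa [one_smul] at h
  · rintro _ ⟨i, j, f, x, hf, hx, rfl⟩ c
    exact hgen c i j f x hf hx
  · intro c; rwa [smul_zero]
  · intro s t _ _ hs ht c
    rw [smul_add]; exact hadd _ _ (hs c) (ht c)
  · intro c t _ ht c'
    rw [smul_smul]; exact ht _

theorem psiRad_unit (f : X.carrier →ₗ[k] Y.carrier) (i' i j : P) (ξ : H.dualRad i j) :
    psiRad (f ⊗ₜ[k] H.e i') i j ξ = 0 := by
  rw [psiRad_tmul, radProj_e, map_zero, zero_smul]

theorem starPart_unit (f : X.carrier →ₗ[k] Y.carrier) (i : P) :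
    starPart (f ⊗ₜ[k] H.e i) = f := by
  simp [starPart_tmul, star_e]

theorem starPart_rad (f : X.carrier →ₗ[k] Y.carrier) {i j : P} {y : H.Yoneda} (hy : y ∈ H.radComp i j) :
    starPart (f ⊗ₜ[k] y) = 0 := by
  simp [starPart_tmul, H.star_radComp _ hy]

theorem starPart_add (s t : H.HomA X Y) : starPart (s + t) = starPart s + starPart t := map_add _ _ _

theorem starPart_zero : starPart (0 : H.HomA X Y) = 0 := map_zero _

theorem psiRad_add (s t : H.HomA X Y) (i j : P) (ξ : H.dualRad i j) :
    psiRad (s + t) i j ξ = psiRad s i j ξ + psiRad t i j ξ := by simp only [psiRad_apply, map_add]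

theorem psiRad_zero (i j : P) (ξ : H.dualRad i j) : psiRad (0 : H.HomA X Y) i j ξ = 0 := by
  simp only [psiRad_apply, map_zero]

/-- `Ψ(s)` is a map of `S`-bimodules on `D̂(J)`. -/
theorem psiRad_corner {s : H.HomA X Y} (hs : s ∈ H.ad X Y (-1)) (i j : P) (ξ : H.dualRad i j) :
    Y.proj j ∘ₗ psiRad s i j ξ ∘ₗ X.proj i = psiRad s i j ξ := by
  refine ad_neg_one_induction (C := fun s =>
    Y.proj j ∘ₗ psiRad s i j ξ ∘ₗ X.proj i = psiRad s i j ξ) ?_ ?_ ?_ ?_ hs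
  · simp [psiRad_zero]
  · intro s t hs ht
    rw [psiRad_add, LinearMap.add_comp, LinearMap.comp_add, hs, ht]
  · intro l f _
    simp [psiRad_unit]
  · intro i' j' f y hf hy
    rw [psiRad_tmul]
    by_cases h : i' = i ∧ j' = j
    · obtain ⟨rfl, rfl⟩ := h
      rw [LinearMap.smul_comp, LinearMap.comp_smul, hf]
    · rw [radProj_of_ne hy h, map_zero, zero_smul]
      simp

/-- `Ψ(t)(∑_j e_j^*)` is a map of `S`-modules. -/
theorem starPart_comp_proj {t : H.HomA X Y} (ht : t ∈ H.ad X Y (-1)) (j : P) :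
    starPart t ∘ₗ X.proj j = Y.proj j ∘ₗ starPart t := by
  refine ad_neg_one_induction (C := fun t => starPart t ∘ₗ X.proj j = Y.proj j ∘ₗ starPart t)
    ?_ ?_ ?_ ?_ ht
  · simp [starPart_zero]
  · intro s t hs ht
    rw [starPart_add, LinearMap.add_comp, LinearMap.comp_add, hs, ht]
  · intro l f hf
    rw [starPart_unit, corner_comp_proj hf, proj_comp_corner hf]
    simp [eq_comm]
  · intro i' j' f y _ hy
    simp [starPart_rad f hy]

theorem starPart_unitEl (h : X.carrier →ₗ[k] Y.carrier) : starPart (unitEl H h) = h := by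
  rw [starPart, unitEl, map_sum]
  change ∑ j, starPart _ = _
  rw [Finset.sum_congr rfl fun j _ => starPart_unit _ j]
  refine LinearMap.ext fun v => ?_
  simp only [LinearMap.sum_apply, LinearMap.comp_apply]
  rw [← map_sum, ← LinearMap.sum_apply, sum_proj, LinearMap.id_apply]

theorem psiRad_unitEl (h : X.carrier →ₗ[k] Y.carrier) (i j : P) (ξ : H.dualRad i j) :
    psiRad (unitEl H h) i j ξ = 0 := by
  rw [psiRad_apply, unitEl, map_sum]
  exact Finset.sum_eq_zero fun l _ => psiRad_unit _ l i j ξ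

/-- The expansion of an element of `B_0` in the basis. It is a finite sum since `B_0` is
finite-dimensional. -/
theorem sum_coord_val₀ {i j : P} {x : H.Yoneda} (hx : x ∈ H.barComp 0 i j) :
    ∑ y : H.Letter₀, (Module.Basis.ofVectorSpace k (H.barComp 0 y.1.1 y.1.2)).coord y.2
      ((H.barProj 0 y.1.1 y.1.2).rangeRestrict x) • H.val₀ y = x := by
  have := FiniteDimensional.fintypeBasisIndex (Module.Basis.ofVectorSpace k (H.barComp 0 i j))
  have h := congrArg Subtype.val ((Module.Basis.ofVectorSpace k (H.barComp 0 i j)).sum_repr ⟨x, hx⟩)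
  rw [Submodule.coe_sum] at h
  refine Eq.trans ?_ h
  symm
  refine Fintype.sum_of_injective (fun q => (⟨(i, j), q⟩ : H.Letter₀))
    (fun a b h => eq_of_heq (Sigma.mk.inj h).2) _ _ ?_ ?_
  · rintro ⟨⟨i', j'⟩, q⟩ hq
    dsimp only
    rw [rangeRestrict_of_ne hx, map_zero, zero_smul]
    rintro ⟨rfl, rfl⟩
    exact hq ⟨q, rfl⟩
  · intro q
    dsimp only
    rw [rangeRestrict_of_mem hx]
    rfl

/-- The expansion of an element of `J` in the basis. It is a finite sum since `J` is finite-dimensional.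
-/
theorem sum_coord_valJ {i j : P} {x : H.Yoneda} (hx : x ∈ H.radComp i j) :
    ∑ y : H.LetterJ, (Module.Basis.ofVectorSpace k (H.radComp y.1.1 y.1.2)).coord y.2
      (H.radProj y.1.1 y.1.2 x) • H.valJ y = x := by
  have := FiniteDimensional.fintypeBasisIndex (Module.Basis.ofVectorSpace k (H.radComp i j))
  have h := congrArg Subtype.val ((Module.Basis.ofVectorSpace k (H.radComp i j)).sum_repr ⟨x, hx⟩)
  rw [Submodule.coe_sum] at h
  refine Eq.trans ?_ h
  symm
  refine Fintype.sum_of_injective (fun q => (⟨(i, j), q⟩ : H.LetterJ))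
    (fun a b h => eq_of_heq (Sigma.mk.inj h).2) _ _ ?_ ?_
  · rintro ⟨⟨i', j'⟩, q⟩ hq
    dsimp only
    rw [radProj_of_ne hx, map_zero, zero_smul]
    rintro ⟨rfl, rfl⟩
    exact hq ⟨q, rfl⟩
  · intro q
    dsimp only
    rw [radProj_self hx]
    rfl

/-- `Ψ` on a letter of `B_0`. -/
noncomputable def psiLetter₀ (s : H.HomA X Y) (x : H.Letter₀) : X.carrier →ₗ[k] Y.carrier :=
  psiBar s 0 x.1.1 x.1.2 ((Module.Basis.ofVectorSpace k (H.barComp 0 x.1.1 x.1.2)).coord x.2)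

/-- `Ψ` on a letter of `J`. -/
noncomputable def psiLetterJ (t : H.HomA X Y) (x : H.LetterJ) : X.carrier →ₗ[k] Y.carrier :=
  psiRad t x.1.1 x.1.2 ((Module.Basis.ofVectorSpace k (H.radComp x.1.1 x.1.2)).coord x.2)

/-- The part of `t` with coefficients in `J`. -/
noncomputable def radPart (t : H.HomA X Y) : H.HomA X Y :=
  ∑ x : H.LetterJ, psiLetterJ t x ⊗ₜ[k] H.valJ x

/-- An element `s` of degree zero is `∑_x Ψ(s)(x^*) ⊗ x`, the sum over the basis of `B_0`. -/
theorem sum_psiLetter₀ {s : H.HomA X Y} (hs : s ∈ H.ad X Y 0) :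
    ∑ x : H.Letter₀, psiLetter₀ s x ⊗ₜ[k] H.val₀ x = s := by
  induction hs using Submodule.span_induction with
  | zero =>
    refine Finset.sum_eq_zero fun x _ => ?_
    rw [psiLetter₀, psiBar_apply, map_zero, TensorProduct.zero_tmul]
  | add F F' _ _ hF hF' =>
    conv_rhs => rw [← hF, ← hF', ← Finset.sum_add_distrib]
    exact Finset.sum_congr rfl fun x _ => by
      simp only [psiLetter₀, psiBar_apply, map_add, TensorProduct.add_tmul]
  | smul c F _ hF =>
    conv_rhs => rw [← hF, Finset.smul_sum]
    exact Finset.sum_congr rfl fun x _ => by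
      simp only [psiLetter₀, psiBar_apply, map_smul, TensorProduct.smul_tmul']
  | mem F hF =>
    obtain ⟨i, j, f, x, hf, hx, rfl⟩ := hF
    conv_rhs => rw [← sum_coord_val₀ hx, TensorProduct.tmul_sum]
    exact Finset.sum_congr rfl fun y _ => by
      rw [psiLetter₀, psiBar_tmul, TensorProduct.smul_tmul]

theorem radPart_add (s t : H.HomA X Y) : radPart (s + t) = radPart s + radPart t := by
  simp only [radPart, psiLetterJ, psiRad_add, TensorProduct.add_tmul, Finset.sum_add_distrib]

theorem radPart_zero : radPart (0 : H.HomA X Y) = 0 := by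
  simp only [radPart, psiLetterJ, psiRad_zero, TensorProduct.zero_tmul, Finset.sum_const_zero]

theorem unitEl_add (f g : X.carrier →ₗ[k] Y.carrier) : unitEl H (f + g) = unitEl H f + unitEl H g := by
  simp only [unitEl, LinearMap.add_comp, TensorProduct.add_tmul, Finset.sum_add_distrib]

theorem unitEl_zero : unitEl H (0 : X.carrier →ₗ[k] Y.carrier) = 0 := by
  simp only [unitEl, LinearMap.zero_comp, TensorProduct.zero_tmul, Finset.sum_const_zero]

/-- An element `t` of degree `-1` is the sum of `∑_j t⁰|_{X e_j} ⊗ e_j`, with `t⁰ = Ψ(t)(∑_j e_j^*)`, and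
of its part with coefficients in `J`. -/
theorem unitEl_starPart_add_radPart {t : H.HomA X Y} (ht : t ∈ H.ad X Y (-1)) :
    unitEl H (starPart t) + radPart t = t := by
  refine ad_neg_one_induction (C := fun t => unitEl H (starPart t) + radPart t = t) ?_ ?_ ?_ ?_ ht
  · rw [starPart_zero, unitEl_zero, radPart_zero, add_zero]
  · intro s t hs ht
    conv_rhs => rw [← hs, ← ht]
    rw [starPart_add, radPart_add, unitEl_add]
    abel
  · intro i f hf
    have h0 : radPart (f ⊗ₜ[k] H.e i) = 0 := Finset.sum_eq_zero fun x _ => by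
      rw [psiLetterJ, psiRad_unit, TensorProduct.zero_tmul]
    rw [h0, add_zero, starPart_unit, unitEl, Finset.sum_eq_single i]
    · rw [corner_comp_proj hf, if_pos rfl]
    · intro j _ hj
      rw [corner_comp_proj hf, if_neg hj, TensorProduct.zero_tmul]
    · simp
  · intro i j f y hf hy
    rw [starPart_rad f hy, unitEl_zero, zero_add]
    conv_rhs => rw [← sum_coord_valJ hy, TensorProduct.tmul_sum]
    exact Finset.sum_congr rfl fun x _ => by
      rw [psiLetterJ, psiRad_tmul, TensorProduct.smul_tmul]

theorem sum_valJ_mem {g : H.LetterJ → (X.carrier →ₗ[k] Y.carrier)}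
    (hg : ∀ x, Y.proj x.1.2 ∘ₗ g x ∘ₗ X.proj x.1.1 = g x) :
    ∑ x : H.LetterJ, g x ⊗ₜ[k] H.valJ x ∈ H.ad X Y (-1) :=
  Submodule.sum_mem _ fun x _ => Submodule.subset_span
    ⟨x.1.1, x.1.2, _, _, hg x, H.radComp_le _ _ (H.valJ_mem x), rfl⟩

theorem radPart_mem {t : H.HomA X Y} (ht : t ∈ H.ad X Y (-1)) : radPart t ∈ H.ad X Y (-1) :=
  sum_valJ_mem fun _ => psiRad_corner ht _ _ _

theorem starPart_sum_valJ (g : H.LetterJ → (X.carrier →ₗ[k] Y.carrier)) :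
    starPart (∑ x : H.LetterJ, g x ⊗ₜ[k] H.valJ x) = 0 := by
  rw [starPart, map_sum]
  exact Finset.sum_eq_zero fun x _ => starPart_rad _ (H.valJ_mem x)

/-- The components along `J` of `∑_x g(x^*) ⊗ x`. -/
theorem psiRad_sum_valJ (g : ∀ i j, H.dualRad i j →ₗ[k] (X.carrier →ₗ[k] Y.carrier)) (i j : P)
    (ξ : H.dualRad i j) :
    psiRad (∑ x : H.LetterJ, g x.1.1 x.1.2
      ((Module.Basis.ofVectorSpace k (H.radComp x.1.1 x.1.2)).coord x.2) ⊗ₜ[k] H.valJ x) i j ξ =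
      g i j ξ := by
  have := FiniteDimensional.fintypeBasisIndex (Module.Basis.ofVectorSpace k (H.radComp i j))
  rw [psiRad_apply, map_sum]
  have hξ : ξ = ∑ q, ξ (Module.Basis.ofVectorSpace k (H.radComp i j) q) •
      (Module.Basis.ofVectorSpace k (H.radComp i j)).coord q := by
    exact ((Module.Basis.ofVectorSpace k (H.radComp i j)).sum_dual_apply_smul_coord ξ).symm
  conv_rhs => rw [hξ, map_sum]
  symm
  refine Fintype.sum_of_injective (fun q => (⟨(i, j), q⟩ : H.LetterJ))
    (fun a b h => eq_of_heq (Sigma.mk.inj h).2) _ _ ?_ ?_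
  · rintro ⟨⟨i', j'⟩, q⟩ hq
    rw [evalA_tmul, LinearMap.comp_apply, radProj_of_ne (H.valJ_mem _), map_zero, zero_smul]
    rintro ⟨rfl, rfl⟩
    exact hq ⟨q, rfl⟩
  · intro q
    rw [map_smul, evalA_tmul, LinearMap.comp_apply, radProj_self (i := i) (j := j) (H.valJ_mem ⟨(i, j), q⟩)]
    rfl

/-- The components of `∑_x g(x^*) ⊗ x`, the sum over the basis of `B_0`. -/
theorem psiBar_sum_val₀ (g : ∀ i j, H.dualBar 0 i j →ₗ[k] (X.carrier →ₗ[k] Y.carrier)) (i j : P)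
    (α : H.dualBar 0 i j) :
    psiBar (∑ x : H.Letter₀, g x.1.1 x.1.2
      ((Module.Basis.ofVectorSpace k (H.barComp 0 x.1.1 x.1.2)).coord x.2) ⊗ₜ[k] H.val₀ x) 0 i j α =
      g i j α := by
  have := FiniteDimensional.fintypeBasisIndex (Module.Basis.ofVectorSpace k (H.barComp 0 i j))
  rw [psiBar_apply, map_sum]
  have hα : α = ∑ q, α (Module.Basis.ofVectorSpace k (H.barComp 0 i j) q) •
      (Module.Basis.ofVectorSpace k (H.barComp 0 i j)).coord q := by
    exact ((Module.Basis.ofVectorSpace k (H.barComp 0 i j)).sum_dual_apply_smul_coord α).symm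
  conv_rhs => rw [hα, map_sum]
  symm
  refine Fintype.sum_of_injective (fun q => (⟨(i, j), q⟩ : H.Letter₀))
    (fun a b h => eq_of_heq (Sigma.mk.inj h).2) _ _ ?_ ?_
  · rintro ⟨⟨i', j'⟩, q⟩ hq
    rw [evalA_tmul, LinearMap.comp_apply, rangeRestrict_of_ne (H.val₀_mem _), map_zero, zero_smul]
    rintro ⟨rfl, rfl⟩
    exact hq ⟨q, rfl⟩
  · intro q
    rw [map_smul, evalA_tmul, LinearMap.comp_apply,
      rangeRestrict_of_mem (i := i) (j := j) (H.val₀_mem ⟨(i, j), q⟩)]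
    rfl

theorem psiRad_radPart (t : H.HomA X Y) (i j : P) (ξ : H.dualRad i j) :
    psiRad (radPart t) i j ξ = psiRad t i j ξ := psiRad_sum_valJ (psiRad t) i j ξ

end Evaluation

/-! ### Representations and the geometric series -/

section Expansion

/-- The powers of a sum of elementary tensors, as sums over words. -/
theorem sum_tmul_pow {k : Type*} [Field k] {R T : Type*} [Ring R] [Algebra k R] [Ring T] [Algebra k T]
    {L : Type*} [Fintype L] (a : L → R) (b : L → T) (n : ℕ) :
    (∑ x, a x ⊗ₜ[k] b x) ^ n =
      ∑ x : Fin n → L, (List.ofFn fun s => a (x s)).prod ⊗ₜ[k] (List.ofFn fun s => b (x s)).prod := by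
  induction n with
  | zero => simp [Algebra.TensorProduct.one_def]
  | succ n ih =>
    rw [pow_succ', ih, Finset.sum_mul_sum, ← Finset.sum_product', Finset.univ_product_univ]
    refine Fintype.sum_equiv (Fin.consEquiv fun _ => L) _ _ fun x => ?_
    simp [List.ofFn_succ, Algebra.TensorProduct.tmul_mul_tmul]

variable {k : Type u} [Field k] {Λ : Type u} [Ring Λ] [Algebra k Λ]
  {P : Type u} [Preorder P] [DecidableEq P] [Fintype P] {H : HomologicalSystem k Λ P}
  [IsAlgClosed k] [Module.Finite k Λ] (m : StrictAInfinity H)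
  {X Y Z U : SMod.{u, w} k P}

local notation:70 F:71 " ⊙ " G:70 => HomologicalSystem.compT _ _ _ _ F G

theorem deltaT_sum_pow {L : Type u} [Fintype L] (f : L → Module.End k X.carrier) (val : L → H.Yoneda)
    (n : ℕ) : deltaT (∑ x, f x ⊗ₜ[k] val x : H.HomA X X) ^ n = ∑ x : Fin n → L,
      (List.ofFn fun s => f (x s)).prod ⊗ₜ[k]
        (List.ofFn fun s => TensorAlgebra.ι k (val (x s))).prod := by
  rw [← sum_tmul_pow f fun x => TensorAlgebra.ι k (val x)]
  congr 1
  exact map_sum (H.toHomT X X) _ _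

/-- The partial sums of the geometric series. -/
noncomputable def geomT (Θ : H.HomA X X) (N : ℕ) : H.HomT X X := ∑ s ∈ Finset.range N, deltaT Θ ^ s

theorem geomT_succ (Θ : H.HomA X X) (N : ℕ) :
    geomT Θ (N + 1) = oneT H X + H.toHomT X X Θ ⊙ geomT Θ N := by
  have : ∑ s ∈ Finset.range (N + 1), deltaT Θ ^ s =
      1 + deltaT Θ * ∑ s ∈ Finset.range N, deltaT Θ ^ s := by
    rw [Finset.sum_range_succ', Finset.mul_sum, pow_zero, add_comm]
    simp only [pow_succ']
  rw [mul_eq_compT] at this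
  exact this

/-- A representation `φ` turns the element `dualB ζ` into the value of `ζ` on
`∑_s b_s (Θ ⊗ ⋯ ⊗ Θ)`, where `Θ = ∑_x φ(x^*) ⊗ x`. The bound `N` on the lengths of words makes the
infinite sum in `dualB` finite. -/
theorem map_dualB {L : Type u} [Fintype L] {V : Type u} [AddCommGroup V] [Module k V] {R : Type u}
    [Ring R] [Algebra k R] (val : L → H.Yoneda) (dual : L → R) (π : H.Yoneda →ₗ[k] V)
    (φ : R →ₐ[k] Module.End k U.carrier) {N : ℕ}
    (hN : ∀ n, N ≤ n → ∀ x : Fin n → L, m.b n (fun s => val (x s)) = 0) (ζ : Module.Dual k V) :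
    φ (dualB m val dual π ζ) =
      evalA U U (ζ ∘ₗ π) (bad m (geomT (∑ x, φ (dual x) ⊗ₜ[k] val x) (N + 2))) := by
  have h1 : geomT (∑ x, φ (dual x) ⊗ₜ[k] val x : H.HomA U U) (N + 2) =
      (∑ s ∈ Finset.range N, ∑ x : Fin (s + 2) → L, ((List.ofFn fun s => φ (dual (x s))).prod ⊗ₜ[k]
        (List.ofFn fun s => TensorAlgebra.ι k (val (x s))).prod : H.HomT U U)) +
      (H.toHomT U U (∑ x, φ (dual x) ⊗ₜ[k] val x) + oneT H U) := by
    rw [geomT, Finset.sum_range_succ', Finset.sum_range_succ', zero_add, pow_one, pow_zero, add_assoc]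
    refine congrArg₂ (· + ·) (Finset.sum_congr rfl fun s _ => ?_) rfl
    exact deltaT_sum_pow _ _ _
  rw [h1, map_add (bad m), map_add (bad m) (H.toHomT U U _), bad_oneT, bad_toHomT, add_zero, add_zero,
    map_sum, map_sum]
  have h2 : dualB m val dual π = ∑ n ∈ Finset.range N, ∑ x : Fin (n + 2) → L,
      LinearMap.toSpanSingleton k R (List.ofFn fun s => dual (x s)).prod ∘ₗ
        Module.Dual.eval k V (π (m.b (n + 2) fun s => val (x s))) := by
    unfold dualB
    rw [finsum_eq_sum_of_support_subset (s := Finset.range N)]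
    · exact Finset.sum_congr rfl fun n _ => finsum_eq_sum_of_fintype _
    · intro n hn
      by_contra h
      simp only [Finset.coe_range, Set.mem_Iio, not_lt] at h
      apply hn
      dsimp only
      rw [finsum_eq_sum_of_fintype]
      refine Finset.sum_eq_zero fun x _ => ?_
      rw [hN _ (by omega), map_zero, map_zero, LinearMap.comp_zero]
  rw [h2, LinearMap.sum_apply, map_sum]
  refine Finset.sum_congr rfl fun n _ => ?_
  rw [LinearMap.sum_apply, map_sum, map_sum, map_sum]
  refine Finset.sum_congr rfl fun x _ => ?_
  rw [bad_tmul, bTotal_ofFn, evalA_tmul, LinearMap.comp_apply, LinearMap.toSpanSingleton_apply, map_smul,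
    map_list_prod, List.map_ofFn]
  rfl

/-! ### Triangular series -/

variable (H) in
/-- A linear map as an element of `Hom_k(X, Y) ⊗ T_k(A)`. Composition with projections and inclusions
of this kind picks the rows and columns of a block matrix. -/
noncomputable def pureT (p : X.carrier →ₗ[k] Y.carrier) : H.HomT X Y := p ⊗ₜ[k] 1

theorem pureT_comp_pureT (p : Y.carrier →ₗ[k] Z.carrier) (q : X.carrier →ₗ[k] Y.carrier) :
    pureT H p ⊙ pureT H q = pureT H (p ∘ₗ q) := by
  rw [pureT, pureT, compT_tmul, mul_one]; rfl

theorem pureT_zero : pureT H (0 : X.carrier →ₗ[k] Y.carrier) = 0 := TensorProduct.zero_tmul _ _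

theorem pureT_id : pureT H (LinearMap.id : X.carrier →ₗ[k] X.carrier) = oneT H X := rfl

theorem evalA_bad_pureT (ζ : Module.Dual k H.Yoneda) (p : Z.carrier →ₗ[k] U.carrier)
    (q : X.carrier →ₗ[k] Y.carrier) (F : H.HomT Y Z) :
    evalA X U ζ (bad m (pureT H p ⊙ (F ⊙ pureT H q))) = p ∘ₗ evalA Y Z ζ (bad m F) ∘ₗ q := by
  induction F using TensorProduct.induction_on with
  | zero => simp only [map_zero, LinearMap.zero_apply, LinearMap.zero_comp, LinearMap.comp_zero]
  | add F F' hF hF' =>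
    simp only [map_add, LinearMap.add_apply, LinearMap.add_comp, LinearMap.comp_add, hF, hF']
  | tmul f v =>
    rw [pureT, pureT, compT_tmul, compT_tmul, one_mul, mul_one, bad_tmul, bad_tmul, evalA_tmul, evalA_tmul,
      LinearMap.smul_comp, LinearMap.comp_smul]

theorem pureT_comp_toHomT_tmul (p : Y.carrier →ₗ[k] Z.carrier) (f : X.carrier →ₗ[k] Y.carrier)
    (x : H.Yoneda) : pureT H p ⊙ H.toHomT X Y (f ⊗ₜ[k] x) = H.toHomT X Z ((p ∘ₗ f) ⊗ₜ[k] x) := by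
  rw [toHomT_tmul, toHomT_tmul, pureT, compT_tmul, one_mul]

theorem toHomT_tmul_comp_pureT (p : X.carrier →ₗ[k] Y.carrier) (f : Y.carrier →ₗ[k] Z.carrier)
    (x : H.Yoneda) : H.toHomT Y Z (f ⊗ₜ[k] x) ⊙ pureT H p = H.toHomT X Z ((f ∘ₗ p) ⊗ₜ[k] x) := by
  rw [toHomT_tmul, toHomT_tmul, pureT, compT_tmul, mul_one]

/-- A recursion `S_{N + 1} = A_N + δ S_N` with `A_N` eventually constant has the eventual solution
`(∑ δ^s) A`, as `δ` is nilpotent. -/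
theorem eventually_eq_geom_compT {δ : H.HomA Y Y} (hδ : δ ∈ H.ad Y Y 0) {S A : ℕ → H.HomT X Y}
    {A₀ : H.HomT X Y} (hA : ∀ᶠ N in Filter.atTop, A N = A₀)
    (hS : ∀ N, S (N + 1) = A N + H.toHomT Y Y δ ⊙ S N) :
    ∀ᶠ N in Filter.atTop, S N = geom δ ⊙ A₀ := by
  obtain ⟨N₀, hN₀⟩ := Filter.eventually_atTop.1 hA
  have key : ∀ n, S (N₀ + n) - geom δ ⊙ A₀ =
      H.compT X Y Y (deltaT δ ^ n) (S N₀ - geom δ ⊙ A₀) := by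
    intro n
    induction n with
    | zero => exact (oneT_compT _).symm
    | succ n ih =>
      rw [pow_succ', mul_eq_compT, compT_assoc, ← ih, ← add_assoc, hS, hN₀ _ (by omega)]
      change _ = H.toHomT Y Y δ ⊙ _
      have h1 : geom δ ⊙ A₀ = A₀ + H.toHomT Y Y δ ⊙ (geom δ ⊙ A₀) := by
        conv_lhs => rw [geom_eq_one_add hδ]
        rw [map_add, LinearMap.add_apply, oneT_compT, compT_assoc]
      conv_lhs => rw [h1]
      rw [map_sub]
      abel
  refine Filter.eventually_atTop.2 ⟨N₀ + (Fintype.card P + 1), fun N hN => ?_⟩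
  obtain ⟨n, rfl⟩ := Nat.exists_eq_add_of_le (le_trans (Nat.le_add_right _ _) hN)
  rw [← sub_eq_zero, key, deltaT_pow_eq_zero hδ (by omega)]
  exact LinearMap.map_zero₂ _ _

/-- If the row `p` of `Θ` is `δ p`, then the row `p` of `∑ Θ^s` is `(∑ δ^s) p`. -/
theorem eventually_row {W : SMod.{u, w} k P} {Θ : H.HomA W W} {δ : H.HomA Y Y} (hδ : δ ∈ H.ad Y Y 0)
    {p : H.HomT W Y} (h : p ⊙ H.toHomT W W Θ = H.toHomT Y Y δ ⊙ p) :
    ∀ᶠ N in Filter.atTop, p ⊙ geomT Θ N = geom δ ⊙ p := by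
  refine eventually_eq_geom_compT hδ (A := fun _ => p) (Filter.Eventually.of_forall fun _ => rfl)
    fun N => ?_
  rw [geomT_succ, map_add, compT_oneT, ← compT_assoc, h, compT_assoc]

/-- If the row `p` of `Θ` is `δ p + t q`, and the row `q` of `∑ Θ^s` is `Q`, then the row `p` of
`∑ Θ^s` is `(∑ δ^s) (p + t Q)`. -/
theorem eventually_row_add {W : SMod.{u, w} k P} {Θ : H.HomA W W} {δ : H.HomA Y Y} (hδ : δ ∈ H.ad Y Y 0)
    {p : H.HomT W Y} {t : H.HomA X Y} {q Q : H.HomT W X}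
    (h : p ⊙ H.toHomT W W Θ = H.toHomT Y Y δ ⊙ p + H.toHomT X Y t ⊙ q)
    (hQ : ∀ᶠ N in Filter.atTop, q ⊙ geomT Θ N = Q) :
    ∀ᶠ N in Filter.atTop, p ⊙ geomT Θ N = geom δ ⊙ (p + H.toHomT X Y t ⊙ Q) := by
  refine eventually_eq_geom_compT hδ (A := fun N => p + H.toHomT X Y t ⊙ (q ⊙ geomT Θ N))
    (hQ.mono fun N hN => by rw [hN]) fun N => ?_
  rw [geomT_succ, map_add, compT_oneT, ← compT_assoc, h, map_add, LinearMap.add_apply, compT_assoc,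
    compT_assoc]
  abel

end Expansion

/-! ### The modules `M(X)` -/

section Functor

variable {k : Type u} [Field k] {Λ : Type u} [Ring Λ] [Algebra k Λ]
  {P : Type u} [Preorder P] [DecidableEq P] [Fintype P] {H : HomologicalSystem k Λ P}
  [IsAlgClosed k] [Module.Finite k Λ] {m : StrictAInfinity H}
  {X Y Z : TwObj.{u, w} m}

local notation:70 F:71 " ⊙ " G:70 => HomologicalSystem.compT _ _ _ _ F G

theorem rhoM_e (i : P) : rhoM X (TensorAlg.e k _ i) = X.X.proj i := TensorAlg.lift_e _ _ _

theorem rhoM_gen (i j : P) (α : H.dualBar 0 i j) :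
    rhoM X (TensorAlg.gen k _ i j α) = psiBar X.δ 0 i j α :=
  (TensorAlg.lift_gen _ _ _ _ _).trans (psiBar_corner X.δ_mem i j α)

theorem rhoM_dual₀ (x : H.Letter₀) : rhoM X (H.dual₀ x) = psiLetter₀ X.δ x := rhoM_gen _ _ _

theorem geomT_eq_geom {V : SMod.{u, w} k P} {δ : H.HomA V V} (hδ : δ ∈ H.ad V V 0) {N : ℕ}
    (hN : Fintype.card P + 1 ≤ N) : geomT δ N = geom δ := (geom_eq_sum hδ hN).symm

/-- A representation of `A(Δ)` turns `β(ζ)` into the value of `ζ` on the left-hand side of the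
Maurer–Cartan equation. -/
theorem map_beta {V : SMod.{u, w} k P} (φ : H.AΔ →ₐ[k] Module.End k V.carrier) {δ : H.HomA V V}
    (hδ : δ ∈ H.ad V V 0) (hφ : ∑ x : H.Letter₀, φ (H.dual₀ x) ⊗ₜ[k] H.val₀ x = δ) (i j : P)
    (ζ : H.dualBar 1 i j) : φ (beta m i j ζ) = psiBar (bad m (geom δ)) 1 i j ζ := by
  rw [beta, map_dualB m _ _ _ φ (N := Fintype.card P + 2)
    (fun n hn x => b_letters_eq_zero m hn fun s => .inl (x s)), hφ, geomT_eq_geom hδ (by omega)]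
  rfl

/-- The elements `β(ζ)` generate the ideal `I`. -/
theorem map_idealI {V : Type w} [AddCommGroup V] [Module k V] (φ : H.AΔ →ₐ[k] Module.End k V)
    (h : ∀ i j ζ, φ (beta m i j ζ) = 0) {a : H.AΔ} (ha : a ∈ idealI m) : φ a = 0 := by
  have : idealI m ≤ TwoSidedIdeal.ker φ.toRingHom := by
    refine TwoSidedIdeal.span_le.2 ?_
    rintro _ ⟨i, j, ζ, rfl⟩
    exact (TwoSidedIdeal.mem_ker _).2 (h i j ζ)
  exact (TwoSidedIdeal.mem_ker _).1 (this ha)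

/-- By the Maurer–Cartan equation, `M(X)` is annihilated by `I`. -/
theorem rhoM_idealI (X : TwObj.{u, w} m) {a : H.AΔ} (ha : a ∈ idealI m) : rhoM X a = 0 := by
  refine map_idealI (rhoM X) (fun i j ζ => ?_) ha
  rw [map_beta (rhoM X) X.δ_mem, bad_geom, psiBar_apply, map_zero]
  rw [← sum_psiLetter₀ X.δ_mem]
  exact Finset.sum_congr rfl fun x _ => by rw [rhoM_dual₀]

/-! ### The differential of `T(Δ)` -/

/-- The second row of `deltaMat w` is `(0, w)`. -/
theorem deltaMat_lower (w : H.TΔ) : deltaMat m w 1 0 = 0 ∧ deltaMat m w 1 1 = w := by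
  induction w using TensorAlg.induction with
  | he i =>
    rw [deltaMat, TensorAlg.lift_e]
    simp
  | hg i j α =>
    rw [deltaMat, TensorAlg.lift_gen]
    have hc := e_mul_gen (k := k) (W := fun i j => H.dualBar 0 i j × H.dualRad i j) i j α
    simp [hc]
  | hs c =>
    rw [AlgHom.commutes]
    simp [Matrix.algebraMap_matrix_apply]
  | ha x y hx hy =>
    simp only [map_add, Matrix.add_apply, hx.1, hx.2, hy.1, hy.2, add_zero, and_self]
  | hm x y hx hy =>
    simp only [map_mul, Matrix.mul_apply, Fin.sum_univ_two, hx.1, hx.2, hy.1, hy.2, mul_zero, zero_mul,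
      add_zero, zero_add, and_self]

theorem delta_apply (w : H.TΔ) : delta m w = deltaMat m w 0 1 := rfl

/-- The twisted Leibniz rule: the entry `deltaMat v 0 0` is `v` up to the sign of its degree. -/
theorem delta_mul (v w : H.TΔ) : delta m (v * w) = deltaMat m v 0 0 * delta m w + delta m v * w := by
  simp only [delta_apply, map_mul, Matrix.mul_apply, Fin.sum_univ_two, (deltaMat_lower w).2]

theorem delta_incl_mul (a : H.AΔ) (w : H.TΔ) :
    delta m (H.incl a * w) = H.incl a * delta m w + delta m (H.incl a) * w := by
  rw [delta_mul, (deltaMat_incl m a).1]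

theorem deltaMat_inclRad (i j : P) (ξ : H.dualRad i j) :
    deltaMat m (H.inclRad i j ξ) 0 0 = -H.inclRad i j ξ := by
  rw [inclRad, deltaMat, LinearMap.comp_apply, TensorAlg.lift_gen, ← LinearMap.map_neg]
  have hn := e_mul_gen (k := k) (W := fun i j => H.dualBar 0 i j × H.dualRad i j) i j (0, -ξ)
  simp [hn]

theorem deltaMat_of_mem_V {v : H.TΔ} (hv : v ∈ H.V) : deltaMat m v 0 0 = -v := by
  induction hv using Submodule.span_induction with
  | mem v h =>
    obtain ⟨i, j, ξ, a, a', rfl⟩ := h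
    simp only [map_mul, Matrix.mul_apply, Fin.sum_univ_two, (deltaMat_lower _).1, (deltaMat_incl m _).1,
      deltaMat_inclRad, mul_zero, add_zero, mul_neg, neg_mul]
  | zero => simp
  | add x y _ _ hx hy => rw [map_add, Matrix.add_apply, hx, hy, neg_add]
  | smul c x _ hx => rw [map_smul, Matrix.smul_apply, hx, smul_neg]

theorem delta_mul_of_mem_V {v : H.TΔ} (hv : v ∈ H.V) (w : H.TΔ) :
    delta m (v * w) = -(v * delta m w) + delta m v * w := by
  rw [delta_mul, deltaMat_of_mem_V hv, neg_mul]

theorem delta_e (i : P) : delta m (TensorAlg.e k _ i) = 0 := by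
  rw [delta_apply, deltaMat, TensorAlg.lift_e]
  simp

theorem delta_algebraMap (c : k) : delta m (algebraMap k _ c) = 0 := by
  rw [delta_apply, AlgHom.commutes]
  simp [Matrix.algebraMap_matrix_apply]

theorem delta_incl_gen (i j : P) (α : H.dualBar 0 i j) :
    delta m (H.incl (TensorAlg.gen k _ i j α)) =
      H.incl (TensorAlg.e k _ j) * deltaBar m i j α * H.incl (TensorAlg.e k _ i) := by
  rw [incl_gen, incl_e, incl_e, delta_apply, deltaMat, TensorAlg.lift_gen]
  simp

theorem delta_inclRad (i j : P) (ξ : H.dualRad i j) : delta m (H.inclRad i j ξ) =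
    H.incl (TensorAlg.e k _ j) * deltaRad m i j ξ * H.incl (TensorAlg.e k _ i) := by
  rw [incl_e, incl_e, delta_apply, inclRad, deltaMat, LinearMap.comp_apply, TensorAlg.lift_gen]
  simp

end Functor

/-! ### Bimodule maps on `V` -/

section Bimodules

variable {k : Type u} [Field k] {Λ : Type u} [Ring Λ] [Algebra k Λ]
  {P : Type u} [Preorder P] [DecidableEq P] [Fintype P] {H : HomologicalSystem k Λ P}
  [IsAlgClosed k] [Module.Finite k Λ] {m : StrictAInfinity H}
  {M N L : Type w} [AddCommGroup M] [Module k M] [AddCommGroup N] [Module k N]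
  [AddCommGroup L] [Module k L] {ρM : H.AΔ →ₐ[k] Module.End k M}
  {ρN : H.AΔ →ₐ[k] Module.End k N} {ρL : H.AΔ →ₐ[k] Module.End k L}

variable (ρM ρN) in
/-- The linear map on `T(Δ)` whose restriction to `V` is the bimodule map with values `g`. -/
noncomputable def extT (g : ∀ i j, H.dualRad i j →ₗ[k] (M →ₗ[k] N)) : H.TΔ →ₗ[k] (M →ₗ[k] N) :=
  lowerBlock ∘ₗ (repT (diagRep ρM ρN) fun i j => lower ∘ₗ g i j).toLinearMap

theorem extT_incl_mul (g : ∀ i j, H.dualRad i j →ₗ[k] (M →ₗ[k] N)) (a : H.AΔ) (w : H.TΔ) :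
    extT ρM ρN g (H.incl a * w) = ρN a ∘ₗ extT ρM ρN g w := by
  refine LinearMap.ext fun x => ?_
  simp [extT, lowerBlock, repT_incl, diagRep]

theorem extT_mul_incl (g : ∀ i j, H.dualRad i j →ₗ[k] (M →ₗ[k] N)) (w : H.TΔ) (a : H.AΔ) :
    extT ρM ρN g (w * H.incl a) = extT ρM ρN g w ∘ₗ ρM a := by
  refine LinearMap.ext fun x => ?_
  simp [extT, lowerBlock, repT_incl, diagRep]

theorem starMap_incl_mul (g : H.V →ₗ[k] (N →ₗ[k] L)) (f : H.V →ₗ[k] (M →ₗ[k] N)) (a : H.AΔ) (w : H.TΔ) :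
    starMap ρM ρN ρL g f (H.incl a * w) = ρL a ∘ₗ starMap ρM ρN ρL g f w := by
  refine LinearMap.ext fun x => ?_
  simp [starMap, lowerBlock, repT_incl, diagRep]

theorem starMap_mul_incl (g : H.V →ₗ[k] (N →ₗ[k] L)) (f : H.V →ₗ[k] (M →ₗ[k] N)) (w : H.TΔ) (a : H.AΔ) :
    starMap ρM ρN ρL g f (w * H.incl a) = starMap ρM ρN ρL g f w ∘ₗ ρM a := by
  refine LinearMap.ext fun x => ?_
  simp [starMap, lowerBlock, repT_incl, diagRep]
  rfl

theorem rawComp_snd_apply (g : RawHom H N L) (f : RawHom H M N) (v : H.V) :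
    (rawComp m ρM ρN ρL g f).2 v = g.1 ∘ₗ f.2 v + g.2 v ∘ₗ f.1 + starMap ρM ρN ρL g.2 f.2 (delta m v) :=
  rfl

/-- The composite of two morphisms is left linear: the term `g¹(δ a) f¹(v)`, by which `g⁰` fails to be
linear, is produced by `δ(a v) = a δ(v) + δ(a) v`. -/
theorem rawComp_left {f : RawHom H M N} {g : RawHom H N L} (hf : IsModHom m ρM ρN f)
    (hg : IsModHom m ρN ρL g) (a : H.AΔ) (v : H.V) :
    (rawComp m ρM ρN ρL g f).2 ⟨H.incl a * v, incl_mul_mem a v.2⟩ =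
      ρL a ∘ₗ (rawComp m ρM ρN ρL g f).2 v := by
  have h : starMap ρM ρN ρL g.2 f.2 (delta m (H.incl a) * v) =
      g.2 ⟨delta m (H.incl a), delta_incl_mem m a⟩ ∘ₗ f.2 v :=
    starMap_mul ρM ρN ρL g.2 f.2 hg.left hg.right hf.left hf.right
      ⟨delta m (H.incl a), delta_incl_mem m a⟩ v
  have hc : ρL a ∘ₗ g.1 ∘ₗ f.2 v = g.1 ∘ₗ ρN a ∘ₗ f.2 v +
      g.2 ⟨delta m (H.incl a), delta_incl_mem m a⟩ ∘ₗ f.2 v := by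
    rw [← LinearMap.comp_assoc, hg.compat, LinearMap.add_comp]; rfl
  have h1 : starMap ρM ρN ρL g.2 f.2 (delta m (H.incl a * v)) =
      ρL a ∘ₗ starMap ρM ρN ρL g.2 f.2 (delta m v) +
        g.2 ⟨delta m (H.incl a), delta_incl_mem m a⟩ ∘ₗ f.2 v := by
    rw [delta_incl_mul, map_add, starMap_incl_mul, h]
  refine (rawComp_snd_apply g f ⟨H.incl a * v, incl_mul_mem a v.2⟩).trans
    ((congrArg₂ (· + ·) (congrArg₂ (fun p q => g.1 ∘ₗ p + q ∘ₗ f.1) (hf.left a v) (hg.left a v)) h1).trans ?_)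
  refine LinearMap.ext fun x => ?_
  have hx := LinearMap.congr_fun hc x
  rw [rawComp_snd_apply]
  simp only [LinearMap.add_apply, LinearMap.comp_apply, map_add] at hx ⊢
  rw [hx]
  abel

/-- The composite of two morphisms is right linear: the term `g¹(v) f¹(δ a)`, by which `f⁰` fails to be
linear, is produced by `δ(v a) = δ(v) a - v δ(a)`. -/
theorem rawComp_right {f : RawHom H M N} {g : RawHom H N L} (hf : IsModHom m ρM ρN f)
    (hg : IsModHom m ρN ρL g) (a : H.AΔ) (v : H.V) :
    (rawComp m ρM ρN ρL g f).2 ⟨v * H.incl a, mul_incl_mem a v.2⟩ =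
      (rawComp m ρM ρN ρL g f).2 v ∘ₗ ρM a := by
  have h : starMap ρM ρN ρL g.2 f.2 (v * delta m (H.incl a)) =
      g.2 v ∘ₗ f.2 ⟨delta m (H.incl a), delta_incl_mem m a⟩ :=
    starMap_mul ρM ρN ρL g.2 f.2 hg.left hg.right hf.left hf.right v
      ⟨delta m (H.incl a), delta_incl_mem m a⟩
  have hc : g.2 v ∘ₗ ρN a ∘ₗ f.1 = g.2 v ∘ₗ f.1 ∘ₗ ρM a +
      g.2 v ∘ₗ f.2 ⟨delta m (H.incl a), delta_incl_mem m a⟩ := by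
    rw [hf.compat, LinearMap.comp_add]
  have h1 : starMap ρM ρN ρL g.2 f.2 (delta m (v * H.incl a)) =
      starMap ρM ρN ρL g.2 f.2 (delta m v) ∘ₗ ρM a -
        g.2 v ∘ₗ f.2 ⟨delta m (H.incl a), delta_incl_mem m a⟩ := by
    rw [delta_mul_of_mem_V v.2, map_add, map_neg, starMap_mul_incl, h]; abel
  refine (rawComp_snd_apply g f ⟨v * H.incl a, mul_incl_mem a v.2⟩).trans
    ((congrArg₂ (· + ·) (congrArg₂ (fun p q => g.1 ∘ₗ p + q ∘ₗ f.1) (hf.right a v) (hg.right a v)) h1).trans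
      ?_)
  refine LinearMap.ext fun x => ?_
  have hx := LinearMap.congr_fun hc x
  rw [rawComp_snd_apply]
  simp only [LinearMap.add_apply, LinearMap.sub_apply, LinearMap.comp_apply] at hx ⊢
  rw [hx]
  abel

/-- Bimodule maps on `V` are determined by their restriction to `D̂(J)`. -/
theorem bimod_ext {f g : H.V →ₗ[k] (M →ₗ[k] N)}
    (hf : ∀ (a : H.AΔ) (v : H.V), f ⟨H.incl a * v, incl_mul_mem a v.2⟩ = ρN a ∘ₗ f v)
    (hf' : ∀ (a : H.AΔ) (v : H.V), f ⟨v * H.incl a, mul_incl_mem a v.2⟩ = f v ∘ₗ ρM a)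
    (hg : ∀ (a : H.AΔ) (v : H.V), g ⟨H.incl a * v, incl_mul_mem a v.2⟩ = ρN a ∘ₗ g v)
    (hg' : ∀ (a : H.AΔ) (v : H.V), g ⟨v * H.incl a, mul_incl_mem a v.2⟩ = g v ∘ₗ ρM a)
    (h : ∀ i j ξ, f (H.inclRadV i j ξ) = g (H.inclRadV i j ξ)) : f = g :=
  V_ext _ _ fun i j ξ a a' hv => by
    rw [bimod_gen ρM ρN f hf hf', bimod_gen ρM ρN g hg hg', h]

theorem extV_left (g : ∀ i j, H.dualRad i j →ₗ[k] (M →ₗ[k] N)) (a : H.AΔ) (v : H.V) :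
    extV ρM ρN g ⟨H.incl a * v, incl_mul_mem a v.2⟩ = ρN a ∘ₗ extV ρM ρN g v :=
  extT_incl_mul g a v

theorem extV_right (g : ∀ i j, H.dualRad i j →ₗ[k] (M →ₗ[k] N)) (a : H.AΔ) (v : H.V) :
    extV ρM ρN g ⟨v * H.incl a, mul_incl_mem a v.2⟩ = extV ρM ρN g v ∘ₗ ρM a :=
  extT_mul_incl g v a

theorem extV_inclRadV (g : ∀ i j, H.dualRad i j →ₗ[k] (M →ₗ[k] N)) (i j : P) (ξ : H.dualRad i j) :
    extV ρM ρN g (H.inclRadV i j ξ) =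
      ρN (TensorAlg.e k _ j) ∘ₗ g i j ξ ∘ₗ ρM (TensorAlg.e k _ i) := by
  change extT ρM ρN g (H.inclRad i j ξ) = _
  refine LinearMap.ext fun x => ?_
  simp [extT, repT_inclRad, lowerBlock, diagRep, lower]

end Bimodules

/-! ### Triangular representations of `T(Δ)` -/

section Blocks

variable {k : Type u} [Field k] {Λ : Type u} [Ring Λ] [Algebra k Λ]
  {P : Type u} [Preorder P] [DecidableEq P] [Fintype P] {H : HomologicalSystem k Λ P}
  [IsAlgClosed k] [Module.Finite k Λ]
  {M N L : Type w} [AddCommGroup M] [Module k M] [AddCommGroup N] [Module k N]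
  [AddCommGroup L] [Module k L] (ρM : H.AΔ →ₐ[k] Module.End k M)
  (ρN : H.AΔ →ₐ[k] Module.End k N) (ρL : H.AΔ →ₐ[k] Module.End k L)

/-- The representation of `T(Δ)` on `M × N` underlying `extT`. -/
noncomputable abbrev pairRep (g : ∀ i j, H.dualRad i j →ₗ[k] (M →ₗ[k] N)) :
    H.TΔ →ₐ[k] Module.End k (M × N) :=
  repT (diagRep ρM ρN) fun i j => lower ∘ₗ g i j

theorem pairRep_incl (g : ∀ i j, H.dualRad i j →ₗ[k] (M →ₗ[k] N)) (a : H.AΔ) (v : M × N) :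
    pairRep ρM ρN g (H.incl a) v = (ρM a v.1, ρN a v.2) := by
  rw [repT_incl]; rfl

theorem pairRep_inclRad (g : ∀ i j, H.dualRad i j →ₗ[k] (M →ₗ[k] N)) (i j : P) (ξ : H.dualRad i j)
    (v : M × N) : pairRep ρM ρN g (H.inclRad i j ξ) v =
      (0, (ρN (TensorAlg.e k _ j) ∘ₗ g i j ξ ∘ₗ ρM (TensorAlg.e k _ i)) v.1) := by
  rw [repT_inclRad]
  simp [diagRep, lower]

/-- The representation of `T(Δ)` on `M × N × L` underlying `starMap`. -/
noncomputable abbrev tripleRep (g : H.V →ₗ[k] (N →ₗ[k] L)) (f : H.V →ₗ[k] (M →ₗ[k] N)) :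
    H.TΔ →ₐ[k] Module.End k (M × N × L) :=
  repT (diagRep ρM (diagRep ρN ρL)) fun i j =>
    lower ∘ₗ LinearMap.llcomp k M N (N × L) (LinearMap.inl k N L) ∘ₗ f ∘ₗ H.inclRadV i j +
    LinearMap.llcomp k (M × N × L) (N × L) (M × N × L) (LinearMap.inr k M (N × L)) ∘ₗ
      LinearMap.lcomp k (N × L) (LinearMap.snd k M (N × L)) ∘ₗ lower ∘ₗ g ∘ₗ H.inclRadV i j

theorem tripleRep_incl (g : H.V →ₗ[k] (N →ₗ[k] L)) (f : H.V →ₗ[k] (M →ₗ[k] N)) (a : H.AΔ)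
    (v : M × N × L) : tripleRep ρM ρN ρL g f (H.incl a) v = (ρM a v.1, ρN a v.2.1, ρL a v.2.2) := by
  rw [repT_incl]; rfl

theorem tripleRep_inclRad (g : H.V →ₗ[k] (N →ₗ[k] L)) (f : H.V →ₗ[k] (M →ₗ[k] N)) (i j : P)
    (ξ : H.dualRad i j) (v : M × N × L) : tripleRep ρM ρN ρL g f (H.inclRad i j ξ) v =
      (0, (ρN (TensorAlg.e k _ j) ∘ₗ f (H.inclRadV i j ξ) ∘ₗ ρM (TensorAlg.e k _ i)) v.1,
        (ρL (TensorAlg.e k _ j) ∘ₗ g (H.inclRadV i j ξ) ∘ₗ ρN (TensorAlg.e k _ i)) v.2.1) := by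
  rw [repT_inclRad]
  simp [diagRep, lower]

end Blocks

/-! ### The differential `b_1^{tw}` in terms of modules -/

section BlockRepresentations

variable {k : Type u} [Field k] {Λ : Type u} [Ring Λ] [Algebra k Λ]
  {P : Type u} [Preorder P] [DecidableEq P] [Fintype P] {H : HomologicalSystem k Λ P}
  [IsAlgClosed k] [Module.Finite k Λ] {m : StrictAInfinity H}

local notation:70 F:71 " ⊙ " G:70 => HomologicalSystem.compT _ _ _ _ F G

/-- The product of two `S`-modules. -/
noncomputable abbrev prodS (X Y : SMod.{u, w} k P) : SMod.{u, w} k P where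
  carrier := X.carrier × Y.carrier

/-- A row of `Θ = ∑_x φ(x) ⊗ x`, the sum over the letters, when the letters of `B_0` act on the component
`p` through `δ` and those of `J` map the component `q` to it through `t`. -/
theorem pureT_comp_sum_letters {W X Y : SMod.{u, w} k P}
    (φ : H.Letter₀ ⊕ H.LetterJ → Module.End k W.carrier) {p : W.carrier →ₗ[k] Y.carrier}
    {q : W.carrier →ₗ[k] X.carrier} {δ : H.HomA Y Y} (hδ : δ ∈ H.ad Y Y 0) {t : H.HomA X Y}
    (h₀ : ∀ x, p ∘ₗ φ (.inl x) = psiLetter₀ δ x ∘ₗ p)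
    (hJ : ∀ x, p ∘ₗ φ (.inr x) = psiLetterJ t x ∘ₗ q) :
    pureT H p ⊙ H.toHomT W W (∑ x, φ x ⊗ₜ[k] Sum.elim H.val₀ H.valJ x) =
      H.toHomT Y Y δ ⊙ pureT H p + H.toHomT X Y (radPart t) ⊙ pureT H q := by
  rw [Fintype.sum_sum_type, map_add, map_add]
  refine congrArg₂ (· + ·) ?_ ?_
  · conv_rhs => rw [← sum_psiLetter₀ hδ]
    rw [map_sum, map_sum, map_sum, map_sum, LinearMap.sum_apply]
    refine Finset.sum_congr rfl fun x _ => ?_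
    rw [pureT_comp_toHomT_tmul, toHomT_tmul_comp_pureT, h₀]
    rfl
  · rw [radPart, map_sum, map_sum, map_sum, map_sum, LinearMap.sum_apply]
    refine Finset.sum_congr rfl fun x _ => ?_
    rw [pureT_comp_toHomT_tmul, toHomT_tmul_comp_pureT, hJ]
    rfl

theorem pureT_comp_sum_letters_diag {W Y : SMod.{u, w} k P}
    (φ : H.Letter₀ ⊕ H.LetterJ → Module.End k W.carrier) {p : W.carrier →ₗ[k] Y.carrier}
    {δ : H.HomA Y Y} (hδ : δ ∈ H.ad Y Y 0) (h₀ : ∀ x, p ∘ₗ φ (.inl x) = psiLetter₀ δ x ∘ₗ p)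
    (hJ : ∀ x, p ∘ₗ φ (.inr x) = 0) :
    pureT H p ⊙ H.toHomT W W (∑ x, φ x ⊗ₜ[k] Sum.elim H.val₀ H.valJ x) =
      H.toHomT Y Y δ ⊙ pureT H p := by
  rw [pureT_comp_sum_letters φ hδ (q := p) (t := 0) h₀ fun x => ?_, radPart_zero, map_zero, map_zero,
    LinearMap.zero_apply, add_zero]
  rw [hJ, psiLetterJ, psiRad_zero, LinearMap.zero_comp]

variable {X Y Z : TwObj.{u, w} m}

/-- The values of the bimodule map given by `Ψ(t)` on the differential of `D̂(B_0)`. -/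
theorem extT_deltaBar {t : H.HomA X.X Y.X} (ht : t ∈ H.ad X.X Y.X (-1)) (i j : P) (α : H.dualBar 0 i j) :
    extT (rhoM X) (rhoM Y) (psiRad t) (deltaBar m i j α) = psiBar (b1tw X Y (radPart t)) 0 i j α := by
  -- the rows of `Θ` are `δ_X p_X` and `δ_Y p_Y + t p_X`, with `t` the part in `J`; so the entry of
  -- `∑ Θ^s` from `X` to `Y` is `(∑ δ_Y^s) t (∑ δ_X^s)`
  let W := prodS X.X Y.X
  let φ : H.TΔ →ₐ[k] Module.End k W.carrier :=
    pairRep (rhoM X) (rhoM Y) (psiRad t)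
  let Θ : H.HomA W W := ∑ x, φ (Sum.elim (fun x => H.incl (H.dual₀ x)) H.dualJ x) ⊗ₜ[k]
    Sum.elim H.val₀ H.valJ x
  let pX : W.carrier →ₗ[k] X.X.carrier := LinearMap.fst k _ _
  let pY : W.carrier →ₗ[k] Y.X.carrier := LinearMap.snd k _ _
  let iX : X.X.carrier →ₗ[k] W.carrier := LinearMap.inl k _ _
  have hX : pureT H pX ⊙ H.toHomT W W Θ = H.toHomT _ _ X.δ ⊙ pureT H pX := by
    refine pureT_comp_sum_letters_diag _ X.δ_mem (fun x => LinearMap.ext fun v => ?_)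
      fun x => LinearMap.ext fun v => ?_
    · exact (congrArg (fun z => z.1) (pairRep_incl _ _ _ (H.dual₀ x) v)).trans
        (LinearMap.congr_fun (rhoM_dual₀ x) _)
    · exact congrArg (fun z => z.1) (pairRep_inclRad (rhoM X) (rhoM Y) (psiRad t) _ _ _ v)
  have hY : pureT H pY ⊙ H.toHomT W W Θ =
      H.toHomT _ _ Y.δ ⊙ pureT H pY + H.toHomT _ _ (radPart t) ⊙ pureT H pX := by
    refine pureT_comp_sum_letters _ Y.δ_mem (fun x => LinearMap.ext fun v => ?_)
      fun x => LinearMap.ext fun v => ?_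
    · exact (congrArg (fun z => z.2) (pairRep_incl _ _ _ (H.dual₀ x) v)).trans
        (LinearMap.congr_fun (rhoM_dual₀ x) _)
    · refine (congrArg (fun z => z.2) (pairRep_inclRad (rhoM X) (rhoM Y) (psiRad t) _ _ _ v)).trans ?_
      dsimp only
      rw [rhoM_e, rhoM_e, psiRad_corner ht]
      rfl
  obtain ⟨N, hN⟩ := Filter.eventually_atTop.1 (eventually_row_add Y.δ_mem hY (eventually_row X.δ_mem hX))
  have hN' := hN (max N (Fintype.card P + 2) + 2) (by omega)
  have h1 : pY ∘ₗ φ (deltaBar m i j α) ∘ₗ iX = psiBar (b1tw X Y (radPart t)) 0 i j α := by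
    rw [deltaBar, map_dualB m _ _ _ φ (N := max N (Fintype.card P + 2))
      (fun n hn x => b_letters_eq_zero m (by omega) x), ← evalA_bad_pureT, ← compT_assoc]
    change evalA _ _ _ (bad m ((pureT H pY ⊙ geomT Θ _) ⊙ pureT H iX)) = _
    have e1 : pY ∘ₗ iX = 0 := LinearMap.snd_comp_inl ..
    have e2 : pX ∘ₗ iX = LinearMap.id := LinearMap.fst_comp_inl ..
    rw [hN', compT_assoc, map_add, LinearMap.add_apply, compT_assoc, compT_assoc, pureT_comp_pureT,
      pureT_comp_pureT, e1, e2, pureT_zero, zero_add, pureT_id, compT_oneT, ← b1tw_apply]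
    rfl
  rw [← h1]
  rfl

theorem evalA_rTensor_llcomp (ζ : Module.Dual k H.Yoneda) (h : Y.X.carrier →ₗ[k] Z.X.carrier)
    (s : H.HomA X.X Y.X) :
    evalA X.X Z.X ζ (LinearMap.rTensor _ (LinearMap.llcomp k X.X.carrier Y.X.carrier Z.X.carrier h) s) =
      h ∘ₗ evalA X.X Y.X ζ s := by
  induction s using TensorProduct.induction_on with
  | zero => simp only [map_zero, LinearMap.comp_zero]
  | add F F' hF hF' => simp only [map_add, LinearMap.comp_add, hF, hF']
  | tmul f x =>
    rw [LinearMap.rTensor_tmul, evalA_tmul, evalA_tmul, LinearMap.comp_smul]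
    rfl

theorem evalA_rTensor_lcomp (ζ : Module.Dual k H.Yoneda) (h : X.X.carrier →ₗ[k] Y.X.carrier)
    (s : H.HomA Y.X Z.X) :
    evalA X.X Z.X ζ (LinearMap.rTensor _ (LinearMap.lcomp k Z.X.carrier h) s) =
      evalA Y.X Z.X ζ s ∘ₗ h := by
  induction s using TensorProduct.induction_on with
  | zero => simp only [map_zero, LinearMap.zero_comp]
  | add F F' hF hF' => simp only [map_add, LinearMap.add_comp, hF, hF']
  | tmul f x =>
    rw [LinearMap.rTensor_tmul, evalA_tmul, evalA_tmul, LinearMap.smul_comp]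
    rfl

theorem b1tw_mem {t : H.HomA X.X Y.X} (ht : t ∈ H.ad X.X Y.X (-1)) : b1tw X Y t ∈ H.ad X.X Y.X 0 := by
  have := bad_mem m (chain_mem (geom_mem X.δ_mem) ht)
  rwa [show (0 : ℤ) - 1 + 1 = 0 by norm_num, ← b1tw_apply] at this

/-- The components of `b_1^{tw}(t)` measure the failure of `M(t)` to be a morphism, on the generators
of `A(Δ)`. -/
theorem psiBar_b1tw {t : H.HomA X.X Y.X} (ht : t ∈ H.ad X.X Y.X (-1)) (i j : P) (α : H.dualBar 0 i j) :
    psiBar (b1tw X Y t) 0 i j α = starPart t ∘ₗ psiBar X.δ 0 i j α - psiBar Y.δ 0 i j α ∘ₗ starPart t +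
      extT (rhoM X) (rhoM Y) (psiRad t) (deltaBar m i j α) := by
  have h : b1tw X Y t = b1tw X Y (unitEl H (starPart t)) + b1tw X Y (radPart t) := by
    rw [← map_add, unitEl_starPart_add_radPart ht]
  rw [extT_deltaBar ht, h, b1tw_unitEl (starPart_comp_proj ht)]
  simp only [psiBar_apply, map_add, map_sub, evalA_rTensor_llcomp, evalA_rTensor_lcomp]

/-- The corner conditions in the definition of `δ` on generators do not change the value. -/
theorem extT_delta_gen {t : H.HomA X.X Y.X} (ht : t ∈ H.ad X.X Y.X (-1)) (i j : P) (α : H.dualBar 0 i j) :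
    extT (rhoM X) (rhoM Y) (psiRad t) (delta m (H.incl (TensorAlg.gen k _ i j α))) =
      extT (rhoM X) (rhoM Y) (psiRad t) (deltaBar m i j α) := by
  rw [delta_incl_gen, extT_mul_incl, extT_incl_mul, rhoM_e, rhoM_e, extT_deltaBar ht, LinearMap.comp_assoc]
  exact psiBar_corner (b1tw_mem (radPart_mem ht)) i j α

theorem mapM_eq (t : H.HomA X.X Y.X) : mapM X Y t = (starPart t, extV (rhoM X) (rhoM Y) (psiRad t)) := rfl

/-- If `t` is a cycle, then `M(t)` is a morphism. -/
theorem isModHom_mapM {t : H.HomA X.X Y.X} (ht : t ∈ cyc X Y) :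
    IsModHom m (rhoM X) (rhoM Y) (mapM X Y t) where
  left := extV_left _
  right := extV_right _
  compat a := by
    change rhoM Y a ∘ₗ starPart t = starPart t ∘ₗ rhoM X a +
      extT (rhoM X) (rhoM Y) (psiRad t) (delta m (H.incl a))
    induction a using TensorAlg.induction with
    | he i => rw [incl_e, delta_e, map_zero, add_zero, rhoM_e, rhoM_e, starPart_comp_proj ht.1]
    | hg i j α =>
      have h1 := psiBar_b1tw ht.1 i j α
      rw [show b1tw X Y t = 0 from ht.2, psiBar_apply, map_zero] at h1
      rw [extT_delta_gen ht.1, rhoM_gen, rhoM_gen, ← sub_eq_zero, ← neg_eq_zero, h1]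
      abel
    | hs c =>
      rw [AlgHom.commutes, AlgHom.commutes, AlgHom.commutes, delta_algebraMap, map_zero, add_zero]
      refine LinearMap.ext fun x => ?_
      simp [Module.algebraMap_end_apply]
    | ha x y hx hy =>
      simp only [map_add, LinearMap.add_comp, LinearMap.comp_add, hx, hy]
      abel
    | hm x y hx hy =>
      rw [map_mul, map_mul, map_mul, delta_incl_mul, map_add, extT_incl_mul, extT_mul_incl]
      refine LinearMap.ext fun v => ?_
      have h1 := LinearMap.congr_fun hy v
      have h2 := LinearMap.congr_fun hx (rhoM X y v)
      simp only [LinearMap.add_apply, LinearMap.comp_apply, Module.End.mul_apply] at h1 h2 ⊢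
      rw [h1, map_add, h2]
      abel

end BlockRepresentations

/-! ### Functoriality -/

section Functoriality

variable {k : Type u} [Field k] {Λ : Type u} [Ring Λ] [Algebra k Λ]
  {P : Type u} [Preorder P] [DecidableEq P] [Fintype P] {H : HomologicalSystem k Λ P}
  [IsAlgClosed k] [Module.Finite k Λ] {m : StrictAInfinity H} {X Y Z : TwObj.{u, w} m}

local notation:70 F:71 " ⊙ " G:70 => HomologicalSystem.compT _ _ _ _ F G

theorem extV_psiRad_inclRadV {t : H.HomA X.X Y.X} (ht : t ∈ H.ad X.X Y.X (-1)) (i j : P)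
    (ξ : H.dualRad i j) :
    extV (rhoM X) (rhoM Y) (psiRad t) (H.inclRadV i j ξ) = psiRad t i j ξ := by
  rw [extV_inclRadV, rhoM_e, rhoM_e, psiRad_corner ht]

/-- The values of the convolution product of `Ψ(t₂)` and `Ψ(t₁)` on the differential of `D̂(J)`. -/
theorem starMap_deltaRad {t₁ : H.HomA X.X Y.X} (h₁ : t₁ ∈ H.ad X.X Y.X (-1)) {t₂ : H.HomA Y.X Z.X}
    (h₂ : t₂ ∈ H.ad Y.X Z.X (-1)) (i j : P) (ξ : H.dualRad i j) :
    starMap (rhoM X) (rhoM Y) (rhoM Z) (extV (rhoM Y) (rhoM Z) (psiRad t₂))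
      (extV (rhoM X) (rhoM Y) (psiRad t₁)) (deltaRad m i j ξ) =
      psiRad (b2tw X Y Z (radPart t₂) (radPart t₁)) i j ξ := by
  -- the entry of `∑ Θ^s` from `X` to `Z` is `(∑ δ_Z^s) t₂ (∑ δ_Y^s) t₁ (∑ δ_X^s)`, with the parts of
  -- `t₁` and `t₂` in `J`
  let W := prodS X.X (prodS Y.X Z.X)
  let f := extV (rhoM X) (rhoM Y) (psiRad t₁)
  let g := extV (rhoM Y) (rhoM Z) (psiRad t₂)
  let φ : H.TΔ →ₐ[k] Module.End k W.carrier := tripleRep (rhoM X) (rhoM Y) (rhoM Z) g f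
  let Θ : H.HomA W W := ∑ x, φ (Sum.elim (fun x => H.incl (H.dual₀ x)) H.dualJ x) ⊗ₜ[k]
    Sum.elim H.val₀ H.valJ x
  let pX : W.carrier →ₗ[k] X.X.carrier := LinearMap.fst k _ _
  let pY : W.carrier →ₗ[k] Y.X.carrier := LinearMap.fst k _ _ ∘ₗ LinearMap.snd k _ _
  let pZ : W.carrier →ₗ[k] Z.X.carrier := LinearMap.snd k _ _ ∘ₗ LinearMap.snd k _ _
  let iX : X.X.carrier →ₗ[k] W.carrier := LinearMap.inl k _ _
  have hX : pureT H pX ⊙ H.toHomT W W Θ = H.toHomT _ _ X.δ ⊙ pureT H pX := by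
    refine pureT_comp_sum_letters_diag _ X.δ_mem (fun x => LinearMap.ext fun v => ?_)
      fun x => LinearMap.ext fun v => ?_
    · exact (congrArg (fun z => z.1) (tripleRep_incl _ _ _ _ _ (H.dual₀ x) v)).trans
        (LinearMap.congr_fun (rhoM_dual₀ x) _)
    · exact congrArg (fun z => z.1) (tripleRep_inclRad (rhoM X) (rhoM Y) (rhoM Z) g f _ _ _ v)
  have hY : pureT H pY ⊙ H.toHomT W W Θ =
      H.toHomT _ _ Y.δ ⊙ pureT H pY + H.toHomT _ _ (radPart t₁) ⊙ pureT H pX := by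
    refine pureT_comp_sum_letters _ Y.δ_mem (fun x => LinearMap.ext fun v => ?_)
      fun x => LinearMap.ext fun v => ?_
    · exact (congrArg (fun z => z.2.1) (tripleRep_incl _ _ _ _ _ (H.dual₀ x) v)).trans
        (LinearMap.congr_fun (rhoM_dual₀ x) _)
    · refine (congrArg (fun z => z.2.1)
        (tripleRep_inclRad (rhoM X) (rhoM Y) (rhoM Z) g f _ _ _ v)).trans ?_
      dsimp only
      rw [extV_psiRad_inclRadV h₁, rhoM_e, rhoM_e, psiRad_corner h₁]
      rfl
  have hZ : pureT H pZ ⊙ H.toHomT W W Θ =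
      H.toHomT _ _ Z.δ ⊙ pureT H pZ + H.toHomT _ _ (radPart t₂) ⊙ pureT H pY := by
    refine pureT_comp_sum_letters _ Z.δ_mem (fun x => LinearMap.ext fun v => ?_)
      fun x => LinearMap.ext fun v => ?_
    · exact (congrArg (fun z => z.2.2) (tripleRep_incl _ _ _ _ _ (H.dual₀ x) v)).trans
        (LinearMap.congr_fun (rhoM_dual₀ x) _)
    · refine (congrArg (fun z => z.2.2)
        (tripleRep_inclRad (rhoM X) (rhoM Y) (rhoM Z) g f _ _ _ v)).trans ?_
      dsimp only
      rw [extV_psiRad_inclRadV h₂, rhoM_e, rhoM_e, psiRad_corner h₂]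
      rfl
  obtain ⟨N, hN⟩ := Filter.eventually_atTop.1 (eventually_row_add Z.δ_mem hZ
    (eventually_row_add Y.δ_mem hY (eventually_row X.δ_mem hX)))
  have hN' := hN (max N (Fintype.card P + 2) + 2) (by omega)
  have h1 : pZ ∘ₗ φ (deltaRad m i j ξ) ∘ₗ iX =
      psiRad (b2tw X Y Z (radPart t₂) (radPart t₁)) i j ξ := by
    rw [deltaRad, map_dualB m _ _ _ φ (N := max N (Fintype.card P + 2))
      (fun n hn x => b_letters_eq_zero m (by omega) x), ← evalA_bad_pureT, ← compT_assoc]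
    change evalA _ _ _ (bad m ((pureT H pZ ⊙ geomT Θ _) ⊙ pureT H iX)) = _
    have e1 : pZ ∘ₗ iX = 0 := LinearMap.ext fun v => rfl
    have e2 : pY ∘ₗ iX = 0 := LinearMap.ext fun v => rfl
    have e3 : pX ∘ₗ iX = LinearMap.id := LinearMap.fst_comp_inl ..
    rw [hN']
    simp only [compT_assoc, map_add, LinearMap.add_apply, pureT_comp_pureT, e1, e2, e3, pureT_zero, zero_add,
      pureT_id, compT_oneT, map_zero]
    rfl
  rw [← h1]
  rfl

/-- `J J ⊆ J`, and the functionals `e_l^*` vanish on `J`. -/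
theorem star_yonedaMul_radComp (l : P) {i j i' j' : P} {x y : H.Yoneda} (hx : x ∈ H.radComp i j)
    (hy : y ∈ H.radComp i' j') : H.star l (H.yonedaMul (H.signInv x) y) = 0 := by
  have hs : H.signInv x = x := by
    have h := (H.mem_barComp'.1 (H.radComp_le _ _ hx)).2.2
    have := H.signInv_of_degProj (n := 0) (x := x) h
    rwa [pow_zero, one_smul] at this
  rw [hs]
  obtain ⟨f, -, rfl⟩ := hx
  obtain ⟨g, hg, rfl⟩ := hy
  rw [LinearMap.comp_apply, LinearMap.comp_apply, ← ofEnd_mul, star, LinearMap.comp_apply, toEnd_ofEnd]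
  refine H.starEnd_radical l (Ideal.mul_mem_left (Ring.jacobson H.EndΔ) _ ?_)
  exact Ideal.mul_mem_right _ (Ring.jacobson H.EndΔ) (Ideal.mul_mem_left (Ring.jacobson H.EndΔ) _ hg)

theorem starPart_sum {ι : Type*} (s : Finset ι) (F : ι → H.HomA X.X Y.X) :
    starPart (∑ x ∈ s, F x) = ∑ x ∈ s, starPart (F x) := map_sum _ _ _

/-- On paths from `i` to some `j` strictly above `i`, the value of `b` has no component along the `e_l`.
-/
theorem starPart_bad_of_mem_adS {F : H.HomT X.X Z.X} (hF : F ∈ adS H X.X Z.X (-2)) :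
    starPart (bad m F) = 0 := by
  induction hF using Submodule.span_induction with
  | zero => rw [map_zero, starPart_zero]
  | add F F' _ _ hF hF' => rw [map_add, starPart_add, hF, hF', add_zero]
  | smul c F _ hF => rw [map_smul, starPart, map_smul]; exact (congrArg (c • ·) hF).trans (smul_zero c)
  | mem F hF =>
    obtain ⟨i, j, f, v, -, hv, hlt, rfl⟩ := hF
    have hij : i ≠ j := fun h => hlt.2 (h ▸ le_rfl)
    have h := hv.bTotal_mem m
    rw [show (-2 : ℤ) + 1 = -1 by norm_num] at h
    rw [bad_tmul, starPart_tmul, Finset.sum_eq_zero fun l _ => H.star_of_ne hij l h, zero_smul]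

theorem geom_sub_oneT_mem_adS (X : TwObj.{u, w} m) : geom X.δ - oneT H X.X ∈ adS H X.X X.X 0 := by
  rw [geom_eq_one_add X.δ_mem, add_sub_cancel_left]
  have := compT_mem_adS' (toHomT_mem_adS X.δ_mem) (geom_mem X.δ_mem)
  rwa [add_zero] at this

/-- The product of two elements with coefficients in `J` has no component along the `e_i`: words with
a letter of `B_0` lead to a strictly larger index, and `J J ⊆ J`. -/
theorem starPart_b2tw_radPart {t₁ : H.HomA X.X Y.X} (h₁ : t₁ ∈ H.ad X.X Y.X (-1)) {t₂ : H.HomA Y.X Z.X}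
    (h₂ : t₂ ∈ H.ad Y.X Z.X (-1)) : starPart (b2tw X Y Z (radPart t₂) (radPart t₁)) = 0 := by
  have r₁ := toHomT_mem (.inl rfl) (radPart_mem h₁)
  have r₂ := toHomT_mem (.inl rfl) (radPart_mem h₂)
  have gX := geom_mem X.δ_mem
  have gY := geom_mem Y.δ_mem
  -- splitting off the word `t₂ t₁`, every other word contains a letter of `B_0`
  have h : geom Z.δ ⊙ (H.toHomT _ _ (radPart t₂) ⊙ (geom Y.δ ⊙ (H.toHomT _ _ (radPart t₁) ⊙ geom X.δ))) =
      ((geom Z.δ - oneT H Z.X) ⊙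
        (H.toHomT _ _ (radPart t₂) ⊙ (geom Y.δ ⊙ (H.toHomT _ _ (radPart t₁) ⊙ geom X.δ))) +
      H.toHomT _ _ (radPart t₂) ⊙ ((geom Y.δ - oneT H Y.X) ⊙ (H.toHomT _ _ (radPart t₁) ⊙ geom X.δ)) +
      H.toHomT _ _ (radPart t₂) ⊙ (H.toHomT _ _ (radPart t₁) ⊙ (geom X.δ - oneT H X.X))) +
      H.toHomT _ _ (radPart t₂) ⊙ H.toHomT _ _ (radPart t₁) := by
    simp only [map_sub, LinearMap.sub_apply, oneT_compT, compT_oneT]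
    abel
  have hS : (geom Z.δ - oneT H Z.X) ⊙
        (H.toHomT _ _ (radPart t₂) ⊙ (geom Y.δ ⊙ (H.toHomT _ _ (radPart t₁) ⊙ geom X.δ))) +
      H.toHomT _ _ (radPart t₂) ⊙ ((geom Y.δ - oneT H Y.X) ⊙ (H.toHomT _ _ (radPart t₁) ⊙ geom X.δ)) +
      H.toHomT _ _ (radPart t₂) ⊙ (H.toHomT _ _ (radPart t₁) ⊙ (geom X.δ - oneT H X.X)) ∈
      adS H X.X Z.X (-2) := by
    refine add_mem (add_mem ?_ ?_) ?_
    · have := compT_mem_adS' (geom_sub_oneT_mem_adS Z)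
        (compT_mem_adT r₂ (compT_mem_adT gY (compT_mem_adT r₁ gX)))
      rwa [show (0 : ℤ) + (-1 + (0 + (-1 + 0))) = -2 by norm_num] at this
    · have := compT_mem_adS r₂ (compT_mem_adS' (geom_sub_oneT_mem_adS Y) (compT_mem_adT r₁ gX))
      rwa [show (-1 : ℤ) + (0 + (-1 + 0)) = -2 by norm_num] at this
    · have := compT_mem_adS r₂ (compT_mem_adS r₁ (geom_sub_oneT_mem_adS X))
      rwa [show (-1 : ℤ) + (-1 + 0) = -2 by norm_num] at this
  rw [b2tw, h, map_add, starPart_add, starPart_bad_of_mem_adS hS, zero_add]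
  simp only [radPart, map_sum, LinearMap.sum_apply, starPart_sum]
  refine Finset.sum_eq_zero fun x _ => Finset.sum_eq_zero fun y _ => ?_
  rw [toHomT_tmul, toHomT_tmul, compT_tmul, bad_tmul, bTotal_ι_mul_ι]
  refine (starPart_tmul _ _).trans ?_
  rw [Finset.sum_eq_zero fun l _ => star_yonedaMul_radComp l (H.valJ_mem _) (H.valJ_mem _), zero_smul]

/-- The composition of `tw(B)` in terms of the components along the `e_i` and along `J`. -/
theorem b2tw_eq {t₁ : H.HomA X.X Y.X} (h₁ : t₁ ∈ H.ad X.X Y.X (-1)) {t₂ : H.HomA Y.X Z.X}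
    (h₂ : t₂ ∈ H.ad Y.X Z.X (-1)) : b2tw X Y Z t₂ t₁ =
      LinearMap.rTensor _ (LinearMap.lcomp k Z.X.carrier (starPart t₁)) t₂ +
      LinearMap.rTensor _ (LinearMap.llcomp k X.X.carrier Y.X.carrier Z.X.carrier (starPart t₂))
        (radPart t₁) + b2tw X Y Z (radPart t₂) (radPart t₁) := by
  rw [← b2tw_unitEl_right (starPart_comp_proj h₁) h₂, ← b2tw_unitEl_left (radPart_mem h₁)]
  have e1 : b2tw X Y Z t₂ t₁ = b2tw X Y Z t₂ (unitEl H (starPart t₁)) + b2tw X Y Z t₂ (radPart t₁) := by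
    conv_lhs => rw [← unitEl_starPart_add_radPart h₁]
    simp only [b2tw, map_add, LinearMap.add_apply]
  have e2 : b2tw X Y Z t₂ (radPart t₁) = b2tw X Y Z (unitEl H (starPart t₂)) (radPart t₁) +
      b2tw X Y Z (radPart t₂) (radPart t₁) := by
    conv_lhs => rw [← unitEl_starPart_add_radPart h₂]
    simp only [b2tw, map_add, LinearMap.add_apply]
  rw [e1, e2, add_assoc]

theorem starPart_b2tw {t₁ : H.HomA X.X Y.X} (h₁ : t₁ ∈ H.ad X.X Y.X (-1)) {t₂ : H.HomA Y.X Z.X}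
    (h₂ : t₂ ∈ H.ad Y.X Z.X (-1)) : starPart (b2tw X Y Z t₂ t₁) = starPart t₂ ∘ₗ starPart t₁ := by
  have h0 : starPart (radPart t₁) = 0 := starPart_sum_valJ _
  rw [b2tw_eq h₁ h₂, starPart_add, starPart_add, starPart_b2tw_radPart h₁ h₂, add_zero]
  rw [starPart] at h0
  simp only [starPart, evalA_rTensor_lcomp, evalA_rTensor_llcomp]
  rw [h0, LinearMap.comp_zero, add_zero]

theorem psiRad_b2tw {t₁ : H.HomA X.X Y.X} (h₁ : t₁ ∈ H.ad X.X Y.X (-1)) {t₂ : H.HomA Y.X Z.X}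
    (h₂ : t₂ ∈ H.ad Y.X Z.X (-1)) (i j : P) (ξ : H.dualRad i j) :
    psiRad (b2tw X Y Z t₂ t₁) i j ξ = starPart t₂ ∘ₗ psiRad t₁ i j ξ + psiRad t₂ i j ξ ∘ₗ starPart t₁ +
      psiRad (b2tw X Y Z (radPart t₂) (radPart t₁)) i j ξ := by
  rw [b2tw_eq h₁ h₂, psiRad_add, psiRad_add, ← psiRad_radPart t₁]
  rw [psiRad_apply, evalA_rTensor_lcomp, psiRad_apply (LinearMap.rTensor _ _ (radPart t₁)),
    evalA_rTensor_llcomp, ← psiRad_apply, ← psiRad_apply, add_comm (psiRad t₂ i j ξ ∘ₗ _)]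

/-- `M` turns `b_2^{tw}` into the composition of `(A(Δ), I)-Mod`; it suffices to compare both sides on
`D̂(J)`. -/
theorem mapM_b2tw {t₁ : H.HomA X.X Y.X} (h₁ : t₁ ∈ cyc X Y) {t₂ : H.HomA Y.X Z.X} (h₂ : t₂ ∈ cyc Y Z) :
    mapM X Z (b2tw X Y Z t₂ t₁) =
      rawComp m (rhoM X) (rhoM Y) (rhoM Z) (mapM Y Z t₂) (mapM X Y t₁) := by
  refine Prod.ext (starPart_b2tw h₁.1 h₂.1) ?_
  have hf := isModHom_mapM h₁
  have hg := isModHom_mapM h₂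
  refine bimod_ext (extV_left _) (extV_right _) (rawComp_left hf hg) (rawComp_right hf hg)
    fun i j ξ => ?_
  have hJ := b2tw_mem (radPart_mem h₁.1) (radPart_mem h₂.1)
  have hd : starMap (rhoM X) (rhoM Y) (rhoM Z) (mapM Y Z t₂).2 (mapM X Y t₁).2
      (delta m (H.inclRad i j ξ)) = psiRad (b2tw X Y Z (radPart t₂) (radPart t₁)) i j ξ := by
    rw [delta_inclRad, starMap_mul_incl, starMap_incl_mul, rhoM_e, rhoM_e, mapM_eq, mapM_eq,
      starMap_deltaRad h₁.1 h₂.1, LinearMap.comp_assoc, psiRad_corner hJ]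
  refine Eq.trans ?_ (rawComp_snd_apply (mapM Y Z t₂) (mapM X Y t₁) (H.inclRadV i j ξ)).symm
  refine Eq.trans ?_ (congrArg (_ + ·) hd.symm)
  rw [mapM_eq, mapM_eq, mapM_eq, extV_psiRad_inclRadV h₁.1, extV_psiRad_inclRadV h₂.1,
    extV_psiRad_inclRadV (b2tw_mem h₁.1 h₂.1), psiRad_b2tw h₁.1 h₂.1]

variable (m) in
theorem mIsFunctor : MIsFunctor.{u, w} m where
  ann X _ ha := rhoM_idealI X ha
  isModHom _ _ _ ht := isModHom_mapM ht
  congr X Y t _ t' _ h := by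
    rw [bdry_eq_bot, Submodule.mem_bot, sub_eq_zero] at h
    rw [h]
  map_unit X := by
    rw [unit_eq_unitEl, mapM_eq, starPart_unitEl]
    refine Prod.ext rfl (V_ext _ _ fun i j ξ a a' hv => ?_)
    dsimp only
    rw [extV_inclRad, psiRad_unitEl]
    simp [rawId]
  map_comp _ _ _ _ h₁ _ h₂ := mapM_b2tw h₁ h₂

end Functoriality

/-! ### The equivalence -/

section Reconstruction

variable {k : Type u} [Field k] {Λ : Type u} [Ring Λ] [Algebra k Λ]
  {P : Type u} [Preorder P] [DecidableEq P] [Fintype P] {H : HomologicalSystem k Λ P}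
  [IsAlgClosed k] [Module.Finite k Λ] {m : StrictAInfinity H} {X Y Z : TwObj.{u, w} m}

/-- The action of `S = k^P` on a left `A(Δ)`-module. -/
noncomputable def scalarAction {M : Type w} [AddCommGroup M] [Module k M]
    (ρ : H.AΔ →ₐ[k] Module.End k M) : (P → k) →ₐ[k] Module.End k M :=
  AlgHom.ofLinearMap (Fintype.linearCombination k fun i => ρ (TensorAlg.e k _ i))
    (by
      have := (TensorAlg.e_complete k (H.dualBar 0)).complete
      simp only [Fintype.linearCombination_apply, Pi.one_apply, one_smul]
      rw [← map_sum, this, map_one])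
    (fun c d => by
      have h := TensorAlg.e_complete k (H.dualBar 0)
      simp only [Fintype.linearCombination_apply, Pi.mul_apply, Finset.sum_mul_sum, smul_mul_smul_comm,
        ← map_mul]
      refine Finset.sum_congr rfl fun i _ => ?_
      rw [Finset.sum_eq_single i, (h.idem i).eq]
      · intro j _ hj
        rw [h.ortho (Ne.symm hj), map_zero, smul_zero]
      · simp)

theorem scalarAction_single {M : Type w} [AddCommGroup M] [Module k M]
    (ρ : H.AΔ →ₐ[k] Module.End k M) (i : P) :
    scalarAction ρ (Pi.single i 1) = ρ (TensorAlg.e k _ i) := by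
  simp [scalarAction, Fintype.linearCombination_apply_single]

/-- The `S`-module underlying a left `A(Δ)`-module. -/
noncomputable abbrev scalarModule {M : Type w} [AddCommGroup M] [Module k M]
    (ρ : H.AΔ →ₐ[k] Module.End k M) : SMod.{u, w} k P :=
  letI : Module (P → k) M := Module.compHom M (scalarAction ρ).toRingHom
  haveI : IsScalarTower k (P → k) M :=
    ⟨fun c d x => LinearMap.congr_fun (map_smul (scalarAction ρ) c d) x⟩
  { carrier := M }

theorem scalarModule_proj {M : Type w} [AddCommGroup M] [Module k M]
    (ρ : H.AΔ →ₐ[k] Module.End k M) (i : P) :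
    (scalarModule ρ).proj i = ρ (TensorAlg.e k _ i) :=
  (LinearMap.ext fun _ => rfl : (scalarModule ρ).proj i = scalarAction ρ (Pi.single i 1)).trans
    (scalarAction_single ρ i)

/-- `∑_x ρ(x^*) ⊗ x`, the sum over the basis of `B_0`: the element `δ` of the object of `tw(B)` which
belongs to an `A(Δ)`-module. -/
noncomputable def twistOf {M : Type w} [AddCommGroup M] [Module k M]
    (ρ : H.AΔ →ₐ[k] Module.End k M) : H.HomA (scalarModule ρ) (scalarModule ρ) :=
  ∑ x : H.Letter₀, (ρ (H.dual₀ x) : M →ₗ[k] M) ⊗ₜ[k] H.val₀ x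

theorem dual₀_corner {M : Type w} [AddCommGroup M] [Module k M]
    (ρ : H.AΔ →ₐ[k] Module.End k M) (x : H.Letter₀) :
    ρ (TensorAlg.e k _ x.1.2) ∘ₗ ρ (H.dual₀ x) ∘ₗ ρ (TensorAlg.e k _ x.1.1) = ρ (H.dual₀ x) := by
  change ρ _ * (ρ _ * ρ _) = _
  rw [← mul_assoc, ← map_mul, ← map_mul, dual₀, e_mul_gen]

theorem twistOf_mem {M : Type w} [AddCommGroup M] [Module k M]
    (ρ : H.AΔ →ₐ[k] Module.End k M) : twistOf ρ ∈ H.ad (scalarModule ρ) (scalarModule ρ) 0 := by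
  refine Submodule.sum_mem _ fun x _ => Submodule.subset_span ⟨x.1.1, x.1.2, _, _, ?_, H.val₀_mem x, rfl⟩
  rw [scalarModule_proj, scalarModule_proj]
  exact dual₀_corner ρ x

/-- The filtration of an `S`-module by height: `v` lies in its `r`-th term if `v e_i = 0` whenever
`height i + r < |P|`. -/
noncomputable def heightFiltration (X : SMod.{u, w} k P) (r : ℕ) : Submodule (P → k) X.carrier where
  carrier := {v | ∀ i : P, height i + r < Fintype.card P → X.proj i v = 0}
  add_mem' hv hw i hi := by rw [map_add, hv i hi, hw i hi, add_zero]
  zero_mem' i _ := map_zero _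
  smul_mem' c v hv i hi := by
    change (Pi.single i 1 : P → k) • c • v = 0
    rw [smul_smul, mul_comm, ← smul_smul]
    exact (congrArg (c • ·) (hv i hi)).trans (smul_zero c)

/-- The object of `tw(B)` given by an `A(Δ)`-module annihilated by `I`. It is triangular for the
filtration by height, as the letters of `B_0` raise the height. -/
noncomputable def ofIMod (M : IMod.{u, w} m) : TwObj.{u, w} m where
  X := scalarModule M.ρ
  δ := twistOf M.ρ
  δ_mem := twistOf_mem M.ρ
  filtration := by
    refine ⟨Fintype.card P, heightFiltration (scalarModule M.ρ), ?_, ?_, ?_, ?_⟩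
    · intro r r' hr v hv i hi
      exact hv i (by omega)
    · rw [eq_bot_iff]
      intro v hv
      have h := LinearMap.congr_fun (sum_proj (X := scalarModule M.ρ)) v
      rw [LinearMap.sum_apply, Finset.sum_eq_zero fun i _ => hv i (height_lt_card i)] at h
      exact h.symm
    · rw [eq_top_iff]
      intro v _ i hi
      omega
    · intro ζ r v hv
      rw [twistOf, map_sum, LinearMap.sum_apply]
      refine Submodule.sum_mem _ fun x _ => ?_
      intro i hi
      rw [evalA_tmul, LinearMap.smul_apply, map_smul]
      refine (congrArg (_ • ·) ?_).trans (smul_zero _)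
      have hc : (scalarModule M.ρ).proj x.1.2 ∘ₗ (M.ρ (H.dual₀ x) : M.carrier →ₗ[k] M.carrier) ∘ₗ
          (scalarModule M.ρ).proj x.1.1 = M.ρ (H.dual₀ x) := by
        rw [scalarModule_proj, scalarModule_proj]
        exact dual₀_corner M.ρ x
      refine (LinearMap.congr_fun (proj_comp_corner hc i) v).trans ?_
      split_ifs with h
      · subst h
        have hlt := H.lt_of_mem_barComp (H.val₀_mem x) (H.val₀_ne_zero x)
        have := height_strictMono (lt_of_le_not_ge hlt.1 hlt.2)
        rw [← hc, LinearMap.comp_apply, LinearMap.comp_apply, hv x.1.1 (by omega), map_zero, map_zero]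
      · rfl
  maurerCartan := by
    rw [finsum_bad_pow (twistOf_mem M.ρ)]
    have h := bad_mem m (geom_mem (twistOf_mem M.ρ))
    rw [zero_add] at h
    refine eq_zero_of_psiBar h fun i j ζ => ?_
    refine (map_beta (V := scalarModule M.ρ) M.ρ (twistOf_mem M.ρ) rfl i j ζ).symm.trans ?_
    exact M.ann _ (TwoSidedIdeal.subset_span ⟨i, j, ζ, rfl⟩)

theorem rhoM_ofIMod (M : IMod.{u, w} m) : rhoM (ofIMod M) = M.ρ := by
  refine AlgHom.ext fun a => ?_
  induction a using TensorAlg.induction with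
  | he i => exact (rhoM_e i).trans (scalarModule_proj M.ρ i)
  | hg i j α =>
    refine (rhoM_gen i j α).trans ?_
    exact psiBar_sum_val₀ (X := scalarModule M.ρ) (Y := scalarModule M.ρ)
      (fun i j => M.ρ.toLinearMap ∘ₗ TensorAlg.gen k (H.dualBar 0) i j) i j α
  | hs c => rw [AlgHom.commutes]; exact (AlgHom.commutes M.ρ c).symm
  | ha x y hx hy => rw [map_add, hx, hy]; exact (map_add M.ρ x y).symm
  | hm x y hx hy => rw [map_mul, hx, hy]; exact (map_mul M.ρ x y).symm

/-- The object `M(X)`. -/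
noncomputable def toIMod (X : TwObj.{u, w} m) : IMod.{u, w} m :=
  ⟨X.X.carrier, rhoM X, fun _ ha => rhoM_idealI X ha⟩

/-- Every object of `(A(Δ), I)-Mod` is equal to some `M(X)`, and not just isomorphic to it. -/
theorem exists_eq_toIMod (M : IMod.{u, w} m) : ∃ X : TwObj.{u, w} m, M = toIMod X := by
  refine ⟨ofIMod M, ?_⟩
  have h := rhoM_ofIMod M
  have h' : ∀ (ρ : H.AΔ →ₐ[k] Module.End k M.carrier) (hρ : ∀ a ∈ idealI m, ρ a = 0), ρ = M.ρ →
      M = ⟨M.carrier, ρ, hρ⟩ := by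
    rintro ρ hρ rfl
    rfl
  exact h' (rhoM (ofIMod M)) _ h

/-- Every morphism between modules `M(X)` and `M(Y)` is of the form `M(t)`. -/
theorem exists_mapM_eq {f : RawHom H X.X.carrier Y.X.carrier} (hf : IsModHom m (rhoM X) (rhoM Y) f) :
    ∃ t ∈ cyc X Y, mapM X Y t = f := by
  have h0 : ∀ j, f.1 ∘ₗ X.X.proj j = Y.X.proj j ∘ₗ f.1 := by
    intro j
    have := hf.compat (TensorAlg.e k _ j)
    rw [rhoM_e, rhoM_e] at this
    rw [this]
    refine (add_eq_left.2 ?_).symm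
    have hz : (⟨delta m (H.incl (TensorAlg.e k _ j)), delta_incl_mem m _⟩ : H.V) = 0 :=
      Subtype.ext ((congrArg (delta m) (incl_e j)).trans (delta_e j))
    rw [hz, map_zero]
  have hc : ∀ i j ξ, Y.X.proj j ∘ₗ f.2 (H.inclRadV i j ξ) ∘ₗ X.X.proj i = f.2 (H.inclRadV i j ξ) := by
    intro i j ξ
    rw [← rhoM_e, ← rhoM_e]
    exact bimod_corner _ _ f.2 hf.left hf.right i j ξ
  -- the preimage is `∑_j f⁰|_{X e_j} ⊗ e_j + ∑_x f¹(x^*) ⊗ x`, with `x` in the basis of `J`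
  let s : H.HomA X.X Y.X := ∑ x : H.LetterJ, f.2 (H.inclRadV x.1.1 x.1.2
    ((Module.Basis.ofVectorSpace k (H.radComp x.1.1 x.1.2)).coord x.2)) ⊗ₜ[k] H.valJ x
  have hs : s ∈ H.ad X.X Y.X (-1) := sum_valJ_mem fun x => hc _ _ _
  have ht : unitEl H f.1 + s ∈ H.ad X.X Y.X (-1) := add_mem (unitEl_mem h0) hs
  have e1 : starPart (unitEl H f.1 + s) = f.1 := by
    rw [starPart_add, starPart_unitEl, starPart_sum_valJ, add_zero]
  have e2 : ∀ i j ξ, psiRad (unitEl H f.1 + s) i j ξ = f.2 (H.inclRadV i j ξ) := by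
    intro i j ξ
    rw [psiRad_add, psiRad_unitEl, zero_add]
    exact psiRad_sum_valJ (fun i j => f.2 ∘ₗ H.inclRadV i j) i j ξ
  have e3 : mapM X Y (unitEl H f.1 + s) = f := by
    refine Prod.ext e1 (bimod_ext (extV_left _) (extV_right _) hf.left hf.right fun i j ξ => ?_)
    refine (extV_psiRad_inclRadV ht i j ξ).trans (e2 i j ξ)
  refine ⟨_, ⟨ht, LinearMap.mem_ker.2 (eq_zero_of_psiBar (b1tw_mem ht) fun i j α => ?_)⟩, e3⟩
  have h1 := hf.compat (TensorAlg.gen k _ i j α)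
  have h2 : f.2 ⟨delta m (H.incl (TensorAlg.gen k _ i j α)), delta_incl_mem m _⟩ =
      extT (rhoM X) (rhoM Y) (psiRad (unitEl H f.1 + s)) (deltaBar m i j α) := by
    rw [← extT_delta_gen ht]
    exact (LinearMap.congr_fun (congrArg Prod.snd e3) _).symm
  rw [h2, rhoM_gen, rhoM_gen] at h1
  rw [psiBar_b1tw ht, e1, h1]
  abel

/-- `t` is determined by its components along the `e_j` and along `J`, which `M(t)` records. -/
theorem mapM_injective {t t' : H.HomA X.X Y.X} (ht : t ∈ cyc X Y) (ht' : t' ∈ cyc X Y)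
    (h : mapM X Y t = mapM X Y t') : t = t' := by
  have h1 : starPart t = starPart t' := congrArg Prod.fst h
  have h2 : ∀ i j ξ, psiRad t i j ξ = psiRad t' i j ξ := by
    intro i j ξ
    rw [← extV_psiRad_inclRadV ht.1, ← extV_psiRad_inclRadV ht'.1]
    exact LinearMap.congr_fun (congrArg Prod.snd h) _
  rw [← unitEl_starPart_add_radPart ht.1, ← unitEl_starPart_add_radPart ht'.1, h1]
  simp only [radPart, psiLetterJ, h2]

variable (m) in
/-- The laws of a category are inherited from `H^{-1}(tw(B))`, as `M` is surjective on objects and on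
morphisms. -/
theorem modIsCategory : ModIsCategory.{u, w} m where
  id_mem M := by
    obtain ⟨X, rfl⟩ := exists_eq_toIMod M
    have := isModHom_mapM ((twIsCategory m).unit_mem X)
    rwa [(mIsFunctor m).map_unit X] at this
  comp_mem M N L f g hf hg := by
    obtain ⟨X, rfl⟩ := exists_eq_toIMod M
    obtain ⟨Y, rfl⟩ := exists_eq_toIMod N
    obtain ⟨Z, rfl⟩ := exists_eq_toIMod L
    obtain ⟨t₁, h₁, rfl⟩ := exists_mapM_eq (X := X) (Y := Y) hf
    obtain ⟨t₂, h₂, rfl⟩ := exists_mapM_eq (X := Y) (Y := Z) hg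
    have := isModHom_mapM (b2tw_mem_cyc h₁ h₂)
    rwa [mapM_b2tw h₁ h₂] at this
  id_comp M N f hf := by
    obtain ⟨X, rfl⟩ := exists_eq_toIMod M
    obtain ⟨Y, rfl⟩ := exists_eq_toIMod N
    obtain ⟨t, ht, rfl⟩ := exists_mapM_eq (X := X) (Y := Y) hf
    have h := (twIsCategory m).comp_unit X Y t ht
    rw [bdry_eq_bot, Submodule.mem_bot, sub_eq_zero] at h
    have h' := mapM_b2tw ((twIsCategory m).unit_mem X) ht
    rw [h, (mIsFunctor m).map_unit X] at h'
    exact h'.symm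
  comp_id M N f hf := by
    obtain ⟨X, rfl⟩ := exists_eq_toIMod M
    obtain ⟨Y, rfl⟩ := exists_eq_toIMod N
    obtain ⟨t, ht, rfl⟩ := exists_mapM_eq (X := X) (Y := Y) hf
    have h := (twIsCategory m).unit_comp X Y t ht
    rw [bdry_eq_bot, Submodule.mem_bot, sub_eq_zero] at h
    have h' := mapM_b2tw ht ((twIsCategory m).unit_mem Y)
    rw [h, (mIsFunctor m).map_unit Y] at h'
    exact h'.symm
  assoc M N L K f g h hf hg hh := by
    obtain ⟨X, rfl⟩ := exists_eq_toIMod M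
    obtain ⟨Y, rfl⟩ := exists_eq_toIMod N
    obtain ⟨Z, rfl⟩ := exists_eq_toIMod L
    obtain ⟨U, rfl⟩ := exists_eq_toIMod K
    obtain ⟨t₁, h₁, rfl⟩ := exists_mapM_eq (X := X) (Y := Y) hf
    obtain ⟨t₂, h₂, rfl⟩ := exists_mapM_eq (X := Y) (Y := Z) hg
    obtain ⟨t₃, h₃, rfl⟩ := exists_mapM_eq (X := Z) (Y := U) hh
    have e1 := mapM_b2tw (b2tw_mem_cyc h₁ h₂) h₃
    have e2 := mapM_b2tw h₁ (b2tw_mem_cyc h₂ h₃)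
    rw [mapM_b2tw h₁ h₂] at e1
    rw [mapM_b2tw h₂ h₃, ← b2tw_assoc h₁ h₂ h₃] at e2
    exact e2.symm.trans e1

variable (m) in
theorem functorM_isEquivalence :
    (functorM (twIsCategory.{u, w} m) (modIsCategory m) (mIsFunctor m)).IsEquivalence where
  faithful := ⟨by
    rintro X Y ⟨t⟩ ⟨t'⟩ h
    have h' : mapM X.obj Y.obj t = mapM X.obj Y.obj t' := congrArg Subtype.val h
    exact congrArg (Quotient.mk _) (Subtype.ext (mapM_injective t.2 t'.2 h'))⟩
  full := ⟨by
    rintro X Y ⟨f, hf⟩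
    obtain ⟨t, ht, h⟩ := exists_mapM_eq hf
    exact ⟨Quotient.mk _ ⟨t, ht⟩, Subtype.ext h⟩⟩
  essSurj := ⟨by
    rintro ⟨M⟩
    obtain ⟨X, rfl⟩ := exists_eq_toIMod M
    exact ⟨⟨X⟩, ⟨Iso.refl _⟩⟩⟩

end Reconstruction

end HomologicalSystem

theorem mainTheorem4 {k : Type u} [Field k] [IsAlgClosed k] {Λ : Type u} [Ring Λ] [Algebra k Λ]
    [Module.Finite k Λ] {P : Type u} [Preorder P] [Fintype P] [DecidableEq P] [Nonempty P]
    (H : HomologicalSystem k Λ P) (hH : H.IsAdmissible) (m : H.StrictAInfinity) :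
    (∀ (X Y : SMod.{u, w} k P) (n : ℤ), n < -1 → H.ad X Y n = ⊥) ∧
    (∀ X Y : HomologicalSystem.TwObj.{u, w} m, HomologicalSystem.bdry X Y = ⊥) ∧
    ∃ (hT : HomologicalSystem.TwIsCategory.{u, w} m) (hM : HomologicalSystem.ModIsCategory.{u, w} m)
      (hF : HomologicalSystem.MIsFunctor.{u, w} m),
      (HomologicalSystem.functorM hT hM hF).IsEquivalence :=
  ⟨fun _ _ _ hn => HomologicalSystem.ad_eq_bot hn, HomologicalSystem.bdry_eq_bot,
    HomologicalSystem.twIsCategory m, HomologicalSystem.modIsCategory m, HomologicalSystem.mIsFunctor m,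
    HomologicalSystem.functorM_isEquivalence m⟩
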